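/- Let $(\Sigma_1,g_1)$ and $(\Sigma_2,g_2)$ be oriented smooth Riemannian surfaces (not necessarily complete) of constant Gauss curvatures $c_1\neq c_2$, let $J^i$ be the rotation by $+90^\circ$ on $\Sigma_i$ and $\omega_i=g_i(J^i\cdot,\cdot)$ its Kähler form. Endow $\Sigma_1\times\Sigma_2$ with the product metric and the Kähler form $\omega=\pi_1^*\omega_1+\pi_2^*\omega_2$. Let $\Sigma$ be a connected smooth surface (orientable or not, compact or not) and let $\Phi:\Sigma\to\Sigma_1\times\Sigma_2$ be a smooth Lagrangian immersion, i.e. an immersion with $\Phi^*\omega=0$. Let $H$ be its mean curvature vector. (1) If $\Phi$ is minimal ($H=0$) or, more generally, has parallel mean curvature vector ($\nabla^\perp H=0$ for the normal connection $\nabla^\perp$), then $\Phi$ is a product of two curves of constant curvature: there are open intervals $A,B\subseteq\mathbb{R}$ and smooth unit speed curves $\alpha:A\to\Sigma_1$, $\beta:B\to\Sigma_2$, each of constant geodesic curvature, such that around every point of $\Sigma$ there are smooth local coordinates $(s,t)$ with values in $A\times B$ in which $\Phi(s,t)=(\alpha(s),\beta(t))$. (2) In particular, if $\Sigma$ is homeomorphic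 to the sphere $\mathbb{S}^2$, then $\Phi$ is not minimal: there are no minimal Lagrangian spheres in $\Sigma_1\times\Sigma_2$. -/

import Mathlib

open scoped Manifold ContDiff

namespace LagrangianProduct

noncomputable section

/-- The model space `ℝ²` of all surfaces. -/
abbrev Plane : Type := EuclideanSpace ℝ (Fin 2)

/-! ### Riemannian geometry in coordinates

Here `G : E → E →L[ℝ] E →L[ℝ] ℝ` is a Riemannian metric written in coordinates, on an open subset
of a finite dimensional space `E`. -/

section Coordinates

variable {E E' : Type*} [NormedAddCommGroup E] [NormedSpace ℝ E]
  [NormedAddCommGroup E'] [NormedSpace ℝ E']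

/-- The pullback `(u, v) ↦ b(Lu, Lv)` of a bilinear form. -/
def pullbackForm (b : E →L[ℝ] E →L[ℝ] ℝ) (L : E' →L[ℝ] E) : E' →L[ℝ] E' →L[ℝ] ℝ :=
  b.bilinearComp L L

/-- The Christoffel symbols of `G`: the vector `Γ_y(u, v) = ∇_u v` (for constant fields `u`, `v`)
determined by the Koszul formula
`G(Γ(u, v), w) = (∂_u G(v, w) + ∂_v G(u, w) - ∂_w G(u, v)) / 2`. The index is raised with the
inverse of `G y : E → E*`. -/
def christoffel (G : E → E →L[ℝ] E →L[ℝ] ℝ) (y u v : E) : E :=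
  (G y).inverse ((1 / 2 : ℝ) •
    (fderiv ℝ G y u v + fderiv ℝ G y v u - ((fderiv ℝ G y).flip u).flip v))

/-- The Riemann curvature tensor `R(u, v)w = ∇_u ∇_v w - ∇_v ∇_u w - ∇_[u, v] w` of `G`. -/
def curvatureTensor (G : E → E →L[ℝ] E →L[ℝ] ℝ) (y u v w : E) : E :=
  fderiv ℝ (fun z => christoffel G z v w) y u - fderiv ℝ (fun z => christoffel G z u w) y v
    + christoffel G y u (christoffel G y v w) - christoffel G y v (christoffel G y u w)

/-- The Levi-Civita covariant derivative `∇_u V` at `x`, in the direction `u`, of a vector field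
`V` along a map `F` (for instance along a curve, or along an immersion). -/
def covDerivAlong (G : E → E →L[ℝ] E →L[ℝ] ℝ) (F V : E' → E) (x u : E') : E :=
  fderiv ℝ V x u + christoffel G (F x) (fderiv ℝ F x u) (V x)

/-- The metric induced by a map `F`. -/
def inducedMetric (G : E → E →L[ℝ] E →L[ℝ] ℝ) (F : E' → E) (x : E') : E' →L[ℝ] E' →L[ℝ] ℝ :=
  pullbackForm (G (F x)) (fderiv ℝ F x)

/-- The second fundamental form `σ(u, v) = ∇̄_u dF(v) - dF(∇_u v)` of an immersion `F`, where
`∇̄` is the ambient connection and `∇` the Levi-Civita connection of the induced metric. -/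
def secondFundamentalForm (G : E → E →L[ℝ] E →L[ℝ] ℝ) (F : E' → E) (x u v : E') : E :=
  covDerivAlong G F (fun z => fderiv ℝ F z v) x u
    - fderiv ℝ F x (christoffel (inducedMetric G F) x u v)

/-- The mean curvature vector `H = (1/2) ∑ gⁱʲ σ(∂ᵢ, ∂ⱼ)` of an immersed surface `F`, where `(gⁱʲ)`
is the inverse of the matrix of the induced metric. -/
def meanCurvature (G : E → E →L[ℝ] E →L[ℝ] ℝ) (F : Plane → E) (x : Plane) : E :=
  (1 / 2 : ℝ) • ∑ i : Fin 2, ∑ j : Fin 2,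
    (Matrix.of fun k l : Fin 2 => inducedMetric G F x (EuclideanSpace.single k 1)
      (EuclideanSpace.single l 1))⁻¹ i j •
      secondFundamentalForm G F x (EuclideanSpace.single i 1) (EuclideanSpace.single j 1)

end Coordinates

/-! ### Riemannian geometry on manifolds

Local quantities are expressed in all charts of the maximal smooth atlas. -/

section Manifolds

variable {E : Type*} [NormedAddCommGroup E] [NormedSpace ℝ E] {H : Type*} [TopologicalSpace H]
  (I : ModelWithCorners ℝ E H) {M : Type*} [TopologicalSpace M] [ChartedSpace H M]

/-- The coordinate expression of a metric `g` on `M` in the chart `e`. -/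
def chartMetric (g : ∀ x : M, TangentSpace I x →L[ℝ] TangentSpace I x →L[ℝ] ℝ)
    (e : OpenPartialHomeomorph M H) (y : E) : E →L[ℝ] E →L[ℝ] ℝ :=
  pullbackForm (E := E) (E' := E) (g ((e.extend I).symm y))
    (mfderiv 𝓘(ℝ, E) I (e.extend I).symm y)

/-- All sectional curvatures of `g` are equal to `c`; on a surface: the Gauss curvature is
constant, equal to `c`. -/
def HasConstantCurvature [IsManifold I ∞ M]
    (g : ∀ x : M, TangentSpace I x →L[ℝ] TangentSpace I x →L[ℝ] ℝ) (c : ℝ) : Prop :=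
  ∀ e ∈ IsManifold.maximalAtlas I ∞ M, ∀ y ∈ (e.extend I).target, ∀ u v : E,
    chartMetric I g e y (curvatureTensor (chartMetric I g e) y u v v) u
      = c * (chartMetric I g e y u u * chartMetric I g e y v v - chartMetric I g e y u v ^ 2)

/-- `α : A → M` is a smooth unit speed curve, defined on the open set `A ⊆ ℝ`, with constant
(signed) geodesic curvature `k`, that is `∇_{α'} α' = k J α'`. Here `J` is the rotation by a right
angle on the surface `M`. -/
structure IsCurveOfConstantCurvature [IsManifold I ∞ M]
    (g : ∀ x : M, TangentSpace I x →L[ℝ] TangentSpace I x →L[ℝ] ℝ)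
    (J : ∀ x : M, TangentSpace I x →L[ℝ] TangentSpace I x) (A : Set ℝ) (α : ℝ → M) (k : ℝ) :
    Prop where
  smooth : ContMDiffOn 𝓘(ℝ, ℝ) I ∞ α A
  unit_speed : ∀ t ∈ A,
    g (α t) (mfderiv 𝓘(ℝ, ℝ) I α t (1 : ℝ)) (mfderiv 𝓘(ℝ, ℝ) I α t (1 : ℝ)) = 1
  curvature : ∀ e ∈ IsManifold.maximalAtlas I ∞ M, ∀ t ∈ A, α t ∈ e.source →
    covDerivAlong (chartMetric I g e) (e.extend I ∘ α) (deriv (e.extend I ∘ α)) t (1 : ℝ)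
      = k • (mfderiv I 𝓘(ℝ, E) (e.extend I) (α t)
          (J (α t) (mfderiv 𝓘(ℝ, ℝ) I α t (1 : ℝ))) : E)

variable {S : Type*} [TopologicalSpace S] [ChartedSpace Plane S]

/-- The coordinate expression of `Φ : S → M` in the charts `e` and `e'`. -/
def localRep (Φ : S → M) (e : OpenPartialHomeomorph S Plane) (e' : OpenPartialHomeomorph M H) :
    Plane → E :=
  e'.extend I ∘ Φ ∘ e.symm

/-- `Φ` is a smooth immersion of the surface `S`. -/
structure IsSmoothImmersion (Φ : S → M) : Prop where
  smooth : ContMDiff 𝓘(ℝ, Plane) I ∞ Φ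
  injective : ∀ p : S, Function.Injective (mfderiv 𝓘(ℝ, Plane) I Φ p)

/-- The immersion `Φ` into `(M, g)` is minimal: its mean curvature vector vanishes. -/
def IsMinimal [IsManifold 𝓘(ℝ, Plane) ∞ S] [IsManifold I ∞ M]
    (g : ∀ x : M, TangentSpace I x →L[ℝ] TangentSpace I x →L[ℝ] ℝ) (Φ : S → M) : Prop :=
  ∀ e ∈ IsManifold.maximalAtlas 𝓘(ℝ, Plane) ∞ S, ∀ e' ∈ IsManifold.maximalAtlas I ∞ M,
    ∀ x ∈ e.target, Φ (e.symm x) ∈ e'.source →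
      meanCurvature (chartMetric I g e') (localRep I Φ e e') x = 0

/-- The immersion `Φ` into `(M, g)` has parallel mean curvature vector: `∇^⊥ H = 0`, that is, the
derivative `∇̄_u H` has no component along any normal vector `n`. -/
def HasParallelMeanCurvature [IsManifold 𝓘(ℝ, Plane) ∞ S] [IsManifold I ∞ M]
    (g : ∀ x : M, TangentSpace I x →L[ℝ] TangentSpace I x →L[ℝ] ℝ) (Φ : S → M) : Prop :=
  ∀ e ∈ IsManifold.maximalAtlas 𝓘(ℝ, Plane) ∞ S, ∀ e' ∈ IsManifold.maximalAtlas I ∞ M,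
    ∀ x ∈ e.target, Φ (e.symm x) ∈ e'.source → ∀ (u : Plane) (n : E),
      (∀ v : Plane, chartMetric I g e' (localRep I Φ e e' x)
        (fderiv ℝ (localRep I Φ e e') x v) n = 0) →
      chartMetric I g e' (localRep I Φ e e' x)
        (covDerivAlong (chartMetric I g e') (localRep I Φ e e')
          (meanCurvature (chartMetric I g e') (localRep I Φ e e')) x u) n = 0

end Manifolds

/-! ### Oriented Riemannian surfaces and their products -/

/-- An oriented Riemannian surface structure on the smooth surface `M`: a Riemannian metric and a
smooth field `J` of isometries of the tangent planes with `J² = -1`. Such a `J` is the same as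
an orientation: `J` is the rotation by `+90°`, the complex structure of `M` as a Riemann surface. -/
structure OrientedRiemannianSurface (M : Type*) [TopologicalSpace M] [ChartedSpace Plane M]
    [IsManifold 𝓘(ℝ, Plane) ∞ M] where
  metric : Bundle.ContMDiffRiemannianMetric 𝓘(ℝ, Plane) ∞ Plane
    (fun x : M => TangentSpace 𝓘(ℝ, Plane) x)
  J : ∀ x : M, TangentSpace 𝓘(ℝ, Plane) x →L[ℝ] TangentSpace 𝓘(ℝ, Plane) x
  J_sq : ∀ (x : M) (v : TangentSpace 𝓘(ℝ, Plane) x), J x (J x v) = -v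
  J_isometry : ∀ (x : M) (v w : TangentSpace 𝓘(ℝ, Plane) x),
    metric.inner x (J x v) (J x w) = metric.inner x v w
  J_smooth : ContMDiff 𝓘(ℝ, Plane) (𝓘(ℝ, Plane).prod 𝓘(ℝ, Plane →L[ℝ] Plane)) ∞
    (fun x : M => Bundle.TotalSpace.mk' (Plane →L[ℝ] Plane)
      (E := fun x : M => TangentSpace 𝓘(ℝ, Plane) x →L[ℝ] TangentSpace 𝓘(ℝ, Plane) x) x (J x))

section Products

variable {M₁ M₂ : Type*} [TopologicalSpace M₁] [ChartedSpace Plane M₁]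
  [IsManifold 𝓘(ℝ, Plane) ∞ M₁] [TopologicalSpace M₂] [ChartedSpace Plane M₂]
  [IsManifold 𝓘(ℝ, Plane) ∞ M₂]

/-- The Kähler form `ω(v, w) = g(Jv, w)` of an oriented Riemannian surface. -/
def OrientedRiemannianSurface.kahlerForm (X : OrientedRiemannianSurface M₁) (x : M₁) :
    TangentSpace 𝓘(ℝ, Plane) x →L[ℝ] TangentSpace 𝓘(ℝ, Plane) x →L[ℝ] ℝ :=
  (X.metric.inner x).comp (X.J x)

/-- The bilinear form `π₁^* b₁ + π₂^* b₂` on `M₁ × M₂`. -/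
def prodForm
    (b₁ : ∀ x : M₁, TangentSpace 𝓘(ℝ, Plane) x →L[ℝ] TangentSpace 𝓘(ℝ, Plane) x →L[ℝ] ℝ)
    (b₂ : ∀ x : M₂, TangentSpace 𝓘(ℝ, Plane) x →L[ℝ] TangentSpace 𝓘(ℝ, Plane) x →L[ℝ] ℝ)
    (q : M₁ × M₂) :
    TangentSpace (𝓘(ℝ, Plane).prod 𝓘(ℝ, Plane)) q →L[ℝ]
      TangentSpace (𝓘(ℝ, Plane).prod 𝓘(ℝ, Plane)) q →L[ℝ] ℝ :=
  pullbackForm (E := Plane) (E' := Plane × Plane) (b₁ q.1)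
      (mfderiv (𝓘(ℝ, Plane).prod 𝓘(ℝ, Plane)) 𝓘(ℝ, Plane) Prod.fst q) +
    pullbackForm (E := Plane) (E' := Plane × Plane) (b₂ q.2)
      (mfderiv (𝓘(ℝ, Plane).prod 𝓘(ℝ, Plane)) 𝓘(ℝ, Plane) Prod.snd q)

/-- The product metric on `M₁ × M₂`. -/
def prodMetric (X₁ : OrientedRiemannianSurface M₁) (X₂ : OrientedRiemannianSurface M₂)
    (q : M₁ × M₂) :
    TangentSpace (𝓘(ℝ, Plane).prod 𝓘(ℝ, Plane)) q →L[ℝ]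
      TangentSpace (𝓘(ℝ, Plane).prod 𝓘(ℝ, Plane)) q →L[ℝ] ℝ :=
  prodForm X₁.metric.inner X₂.metric.inner q

/-- The Kähler form `π₁^* ω₁ + π₂^* ω₂` of the product Kähler surface `M₁ × M₂`. -/
def prodKahlerForm (X₁ : OrientedRiemannianSurface M₁) (X₂ : OrientedRiemannianSurface M₂)
    (q : M₁ × M₂) :
    TangentSpace (𝓘(ℝ, Plane).prod 𝓘(ℝ, Plane)) q →L[ℝ]
      TangentSpace (𝓘(ℝ, Plane).prod 𝓘(ℝ, Plane)) q →L[ℝ] ℝ :=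
  prodForm X₁.kahlerForm X₂.kahlerForm q

variable {S : Type*} [TopologicalSpace S] [ChartedSpace Plane S]

/-- `Φ` is a Lagrangian immersion of the surface `S` into `M₁ × M₂`: an immersion with
`Φ^* ω = 0`. -/
structure IsLagrangianImmersion (X₁ : OrientedRiemannianSurface M₁)
    (X₂ : OrientedRiemannianSurface M₂) (Φ : S → M₁ × M₂) : Prop
    extends IsSmoothImmersion (𝓘(ℝ, Plane).prod 𝓘(ℝ, Plane)) Φ where
  lagrangian : ∀ (p : S) (v w : TangentSpace 𝓘(ℝ, Plane) p),
    prodKahlerForm X₁ X₂ (Φ p)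
      (mfderiv 𝓘(ℝ, Plane) (𝓘(ℝ, Plane).prod 𝓘(ℝ, Plane)) Φ p v)
      (mfderiv 𝓘(ℝ, Plane) (𝓘(ℝ, Plane).prod 𝓘(ℝ, Plane)) Φ p w) = 0

/-- `Φ` is a product of two curves of constant curvature: there are unit speed curves `α : A → M₁`
and `β : B → M₂` of constant curvature, defined on open intervals, such that around each point of
`S` there are smooth coordinates `(s, t)`, with values in `A × B`, in which
`Φ(s, t) = (α(s), β(t))`. -/
def IsProductOfConstantCurvatureCurves [IsManifold 𝓘(ℝ, Plane) ∞ S]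
    (X₁ : OrientedRiemannianSurface M₁) (X₂ : OrientedRiemannianSurface M₂)
    (Φ : S → M₁ × M₂) : Prop :=
  ∃ (A B : Set ℝ) (α : ℝ → M₁) (β : ℝ → M₂) (k₁ k₂ : ℝ),
    IsOpen A ∧ A.OrdConnected ∧ IsOpen B ∧ B.OrdConnected ∧
    IsCurveOfConstantCurvature 𝓘(ℝ, Plane) X₁.metric.inner X₁.J A α k₁ ∧
    IsCurveOfConstantCurvature 𝓘(ℝ, Plane) X₂.metric.inner X₂.J B β k₂ ∧
    ∀ p : S, ∃ e ∈ IsManifold.maximalAtlas 𝓘(ℝ, Plane) ∞ S, p ∈ e.source ∧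
      ∀ q ∈ e.source, e q 0 ∈ A ∧ e q 1 ∈ B ∧ Φ q = (α (e q 0), β (e q 1))

end Products

end

end LagrangianProduct

open LagrangianProduct

/-!
# Lagrangian surfaces with parallel mean curvature in products of surfaces

Let `Φ = (Φ₁, Φ₂)` be Lagrangian with parallel mean curvature vector. The heart of the matter is that
`Φ` is Lagrangian for each of the forms `ω₁` and `ω₂` (`kahler_pullback_eq_zero`). Since
`Φ₁^*ω₁ = -Φ₂^*ω₂`, at a point where one of these forms does not vanish both `Φ₁` and `Φ₂` are local
diffeomorphisms, and in suitable charts `Φ` is the diagonal map `x ↦ (x, x)` into a product of two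
metrics `G₁`, `G₂` on a plane domain with the same area form. The induced metric is `G₁ + G₂`, and
the components of the mean curvature vector `(H₁, H₂)` satisfy `H₁ - H₂ = ½ tr (∇¹ - ∇²)`, the trace
being taken with respect to `G₁ + G₂`. The trace of the curvature equations of `G₁`, `G₂` shows that
`2 div (H₁ - H₂) = c₁ - c₂`. The normal vectors to the diagonal are the `(G₁⁻¹ φ, -G₂⁻¹ φ)`, so
parallelism means `∇¹ H₁ = ∇² H₂`, and this makes the divergence vanish, because connections of
metrics with the same area form have the same trace. Hence `c₁ = c₂`
(`curvature_eq_of_parallel_diagonal`), a contradiction.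

Consequently both differentials `dΦ₁` and `dΦ₂` have rank one, and there are local coordinates in
which `Φ₁` depends on the first and `Φ₂` on the second coordinate only. After reparametrization by
arc length, `Φ (s, t) = (a s, b t)` has mean curvature vector `½ (∇ a', ∇ b')`, and it is parallel
only if the geodesic curvatures of `a` and `b` are constant (`exists_isLocalProduct`).

The local decompositions fit together because curves of constant curvature solve a second order
differential equation: two such decompositions differ, on an overlap, by changes of parameter
`s ↦ ± s + c`. A curve of constant curvature extends to a maximal one, and the set of points around
which `Φ` is a product of two fixed maximal curves is open and closed
(`isProductOfConstantCurvatureCurves_of_locally`).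

On a sphere, the parameter of the first curve is locally defined up to an affine change. The germs
of such parameters form a covering of the sphere, which has a global section. This is a continuous
function on a compact space that is locally an affine function of a coordinate of a chart, and thus
has no maximum, which is impossible (`IsProductOfConstantCurvatureCurves.not_homeomorph_sphere`).
-/

set_option maxSynthPendingDepth 3

namespace LagrangianProduct

/-! ### The Levi-Civita connection in coordinates -/

theorem two_le_infty : (2 : ℕ∞ω) ≤ ∞ := ENat.LEInfty.out

section Koszul

variable {E E' : Type*} [NormedAddCommGroup E] [NormedSpace ℝ E]
  [NormedAddCommGroup E'] [NormedSpace ℝ E']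

/-- `G` is a smooth Riemannian metric on the open subset `U` of `E`. -/
structure IsRiemannianOn (G : E → E →L[ℝ] E →L[ℝ] ℝ) (U : Set E) : Prop where
  isOpen : IsOpen U
  smooth : ContDiffOn ℝ ∞ G U
  symm : ∀ y ∈ U, ∀ u v, G y u v = G y v u
  pos : ∀ y ∈ U, ∀ u, u ≠ 0 → 0 < G y u u

variable {G : E → E →L[ℝ] E →L[ℝ] ℝ} {U : Set E} {y : E}

theorem IsRiemannianOn.contDiffAt (hG : IsRiemannianOn G U) (hy : y ∈ U) : ContDiffAt ℝ ∞ G y :=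
  hG.smooth.contDiffAt (hG.isOpen.mem_nhds hy)

theorem IsRiemannianOn.differentiableAt (hG : IsRiemannianOn G U) (hy : y ∈ U) :
    DifferentiableAt ℝ G y :=
  (hG.contDiffAt hy).differentiableAt (by simp)

theorem IsRiemannianOn.mono (hG : IsRiemannianOn G U) {V : Set E} (hV : IsOpen V) (h : V ⊆ U) :
    IsRiemannianOn G V :=
  ⟨hV, hG.smooth.mono h, fun y hy => hG.symm y (h hy), fun y hy => hG.pos y (h hy)⟩

theorem IsRiemannianOn.congr (hG : IsRiemannianOn G U) {G' : E → E →L[ℝ] E →L[ℝ] ℝ}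
    (h : ∀ y ∈ U, G' y = G y) : IsRiemannianOn G' U :=
  ⟨hG.isOpen, hG.smooth.congr h, fun y hy => by rw [h y hy]; exact hG.symm y hy,
    fun y hy => by rw [h y hy]; exact hG.pos y hy⟩

theorem IsRiemannianOn.eq_of_forall (hG : IsRiemannianOn G U) (hy : y ∈ U) {a b : E}
    (h : ∀ w, G y a w = G y b w) : a = b := by
  by_contra hab
  have h0 := hG.pos y hy (a - b) (sub_ne_zero.2 hab)
  have h1 : G y (a - b) (a - b) = 0 := by
    rw [map_sub (G y), sub_apply, h, sub_self]
  exact h0.ne' h1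

theorem fderiv_bilin_apply (hG : DifferentiableAt ℝ G y) (u v w : E) :
    fderiv ℝ (fun z => G z v w) y u = fderiv ℝ G y u v w := by
  have h1 := (hG.hasFDerivAt.clm_apply (hasFDerivAt_const v y)).clm_apply (hasFDerivAt_const w y)
  rw [h1.fderiv]; simp

theorem IsRiemannianOn.fderiv_symm (hG : IsRiemannianOn G U) (hy : y ∈ U) (u v w : E) :
    fderiv ℝ G y u v w = fderiv ℝ G y u w v := by
  rw [← fderiv_bilin_apply (hG.differentiableAt hy), ← fderiv_bilin_apply (hG.differentiableAt hy)]
  congr 1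
  apply Filter.EventuallyEq.fderiv_eq
  filter_upwards [hG.isOpen.mem_nhds hy] with z hz using hG.symm z hz v w

theorem christoffel_add_left (y u u' v : E) :
    christoffel G y (u + u') v = christoffel G y u v + christoffel G y u' v := by
  unfold christoffel
  rw [← map_add]
  congr 1
  ext w
  simp [ContinuousLinearMap.flip_apply]
  ring

theorem christoffel_smul_left (y u v : E) (c : ℝ) :
    christoffel G y (c • u) v = c • christoffel G y u v := by
  unfold christoffel
  rw [← map_smul]
  congr 1
  ext w
  simp [ContinuousLinearMap.flip_apply]
  ring

theorem christoffel_add_right (y u v v' : E) :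
    christoffel G y u (v + v') = christoffel G y u v + christoffel G y u v' := by
  unfold christoffel
  rw [← map_add]
  congr 1
  ext w
  simp [ContinuousLinearMap.flip_apply]
  ring

theorem christoffel_smul_right (y u v : E) (c : ℝ) :
    christoffel G y u (c • v) = c • christoffel G y u v := by
  unfold christoffel
  rw [← map_smul]
  congr 1
  ext w
  simp [ContinuousLinearMap.flip_apply]
  ring

@[simp] theorem christoffel_zero_right (y u : E) : christoffel G y u 0 = 0 := by
  simpa using christoffel_smul_right (G := G) y u 0 0

theorem christoffel_congr {G' : E → E →L[ℝ] E →L[ℝ] ℝ} (h : G =ᶠ[nhds y] G') (u v : E) :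
    christoffel G y u v = christoffel G' y u v := by
  unfold christoffel
  rw [h.fderiv_eq, h.self_of_nhds]

theorem christoffel_eq_zero_of_eventually_const {B : E →L[ℝ] E →L[ℝ] ℝ}
    (h : G =ᶠ[nhds y] fun _ => B) (u v : E) : christoffel G y u v = 0 := by
  rw [christoffel_congr h]
  unfold christoffel
  simp

variable [FiniteDimensional ℝ E]

/-- A Riemannian metric identifies the space with its dual. -/
theorem IsRiemannianOn.exists_equiv (hG : IsRiemannianOn G U) (hy : y ∈ U) :
    ∃ A : E ≃L[ℝ] (E →L[ℝ] ℝ), (A : E →L[ℝ] E →L[ℝ] ℝ) = G y := by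
  have hinj : Function.Injective (G y : E →ₗ[ℝ] (E →L[ℝ] ℝ)) := fun a b hab =>
    hG.eq_of_forall hy fun w => by
      have : G y a = G y b := hab
      rw [this]
  have hdim : Module.finrank ℝ E = Module.finrank ℝ (E →L[ℝ] ℝ) := by
    rw [← (LinearMap.toContinuousLinearMap (𝕜 := ℝ) (E := E) (F' := ℝ)).finrank_eq]
    exact (Subspace.dual_finrank_eq).symm
  refine ⟨(LinearEquiv.ofInjectiveOfFinrankEq _ hinj hdim).toContinuousLinearEquiv, ?_⟩
  ext a b
  rfl

theorem IsRiemannianOn.apply_inverse (hG : IsRiemannianOn G U) (hy : y ∈ U) (φ : E →L[ℝ] ℝ) :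
    G y ((G y).inverse φ) = φ := by
  obtain ⟨A, hA⟩ := hG.exists_equiv hy
  rw [← hA, ContinuousLinearMap.inverse_equiv]
  simp

theorem IsRiemannianOn.contDiffAt_inverse (hG : IsRiemannianOn G U) (hy : y ∈ U) :
    ContDiffAt ℝ ∞ (fun z => (G z).inverse) y := by
  obtain ⟨A, hA⟩ := hG.exists_equiv hy
  have : CompleteSpace E := FiniteDimensional.complete ℝ E
  have h := contDiffAt_map_inverse (n := ∞) A
  rw [hA] at h
  exact h.comp y (hG.contDiffAt hy)

theorem IsRiemannianOn.koszul (hG : IsRiemannianOn G U) (hy : y ∈ U) (u v w : E) :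
    G y (christoffel G y u v) w
      = (1 / 2) * (fderiv ℝ G y u v w + fderiv ℝ G y v u w - fderiv ℝ G y w u v) := by
  rw [christoffel, hG.apply_inverse hy]
  simp [ContinuousLinearMap.flip_apply]

theorem IsRiemannianOn.christoffel_comm (hG : IsRiemannianOn G U) (hy : y ∈ U) (u v : E) :
    christoffel G y u v = christoffel G y v u := by
  apply hG.eq_of_forall hy fun w => ?_
  rw [hG.koszul hy, hG.koszul hy, hG.fderiv_symm hy w u v]
  ring

/-- The connection is metric: `∂_u G(v, w) = G(∇_u v, w) + G(v, ∇_u w)`. -/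
theorem IsRiemannianOn.fderiv_eq (hG : IsRiemannianOn G U) (hy : y ∈ U) (u v w : E) :
    fderiv ℝ G y u v w = G y (christoffel G y u v) w + G y v (christoffel G y u w) := by
  rw [hG.symm y hy v, hG.koszul hy, hG.koszul hy, hG.fderiv_symm hy w u v,
    hG.fderiv_symm hy v u w, hG.fderiv_symm hy w v u, hG.fderiv_symm hy u v w]
  ring

/-- The Levi-Civita connection is the only torsion free metric connection. -/
theorem IsRiemannianOn.christoffel_unique (hG : IsRiemannianOn G U) (hy : y ∈ U) {B : E → E → E}
    (hB : ∀ u v, B u v = B v u)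
    (hc : ∀ u v w, fderiv ℝ G y u v w = G y (B u v) w + G y v (B u w)) (u v : E) :
    christoffel G y u v = B u v := by
  apply hG.eq_of_forall hy fun w => ?_
  rw [hG.koszul hy, hc, hc, hc, hB v u, hB w u, hB w v, hG.symm y hy _ v, hG.symm y hy u,
    hG.symm y hy v (B u w)]
  ring

/-- The Christoffel symbols as a bilinear map. -/
noncomputable def christoffelBilin (G : E → E →L[ℝ] E →L[ℝ] ℝ) (y : E) : E →L[ℝ] E →L[ℝ] E :=
  LinearMap.toContinuousLinearMap <|
    (LinearMap.toContinuousLinearMap (𝕜 := ℝ) (E := E) (F' := E)).toLinearMap ∘ₗ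
      LinearMap.mk₂ ℝ (christoffel G y) (christoffel_add_left y)
        (fun c u v => christoffel_smul_left y u v c) (christoffel_add_right y)
        (fun c u v => christoffel_smul_right y u v c)

@[simp] theorem christoffelBilin_apply (y u v : E) :
    christoffelBilin G y u v = christoffel G y u v := rfl

theorem IsRiemannianOn.contDiffOn_christoffelBilin (hG : IsRiemannianOn G U) :
    ContDiffOn ℝ ∞ (christoffelBilin G) U := by
  rw [contDiffOn_clm_apply]
  intro u
  rw [contDiffOn_clm_apply]
  intro v
  simp only [christoffelBilin_apply, christoffel]
  intro y hy
  apply ContDiffAt.contDiffWithinAt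
  apply (hG.contDiffAt_inverse hy).clm_apply
  refine ContDiffAt.const_smul (1 / 2 : ℝ) ?_
  have hD2 : ∀ a b c : E, ContDiffOn ℝ ∞ (fun z => fderiv ℝ G z a b c) U := by
    intro a b c
    have h1 : ContDiffOn ℝ ∞ (fun z => G z b c) U :=
      (hG.smooth.clm_apply contDiffOn_const).clm_apply contDiffOn_const
    have h2 : ContDiffOn ℝ ∞ (fderiv ℝ fun z => G z b c) U :=
      h1.fderiv_of_isOpen hG.isOpen (by simp)
    exact (h2.clm_apply contDiffOn_const).congr fun z hz =>
      (fderiv_bilin_apply (hG.differentiableAt hz) a b c).symm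
  refine ContDiffOn.contDiffAt (s := U) ?_ (hG.isOpen.mem_nhds hy)
  rw [contDiffOn_clm_apply]
  intro w
  simpa [ContinuousLinearMap.flip_apply] using ((hD2 u v w).add (hD2 v u w)).sub (hD2 w u v)

theorem IsRiemannianOn.contDiffOn_christoffel (hG : IsRiemannianOn G U) (u v : E) :
    ContDiffOn ℝ ∞ (fun y => christoffel G y u v) U :=
  (hG.contDiffOn_christoffelBilin.clm_apply contDiffOn_const).clm_apply contDiffOn_const

theorem IsRiemannianOn.differentiableAt_christoffel (hG : IsRiemannianOn G U) (hy : y ∈ U)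
    (u v : E) : DifferentiableAt ℝ (fun y => christoffel G y u v) y :=
  ((hG.contDiffOn_christoffel u v).contDiffAt (hG.isOpen.mem_nhds hy)).differentiableAt (by simp)

/-- Product rule for the metric along a map. -/
theorem IsRiemannianOn.fderiv_inner_along (hG : IsRiemannianOn G U) {F V W : E' → E} {x : E'}
    (hx : F x ∈ U) (hF : DifferentiableAt ℝ F x) (hV : DifferentiableAt ℝ V x)
    (hW : DifferentiableAt ℝ W x) (u : E') :
    fderiv ℝ (fun z => G (F z) (V z) (W z)) x u
      = G (F x) (covDerivAlong G F V x u) (W x) + G (F x) (V x) (covDerivAlong G F W x u) := by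
  have h0 := HasFDerivAt.comp (g := G) x (hG.differentiableAt hx).hasFDerivAt hF.hasFDerivAt
  have h1 := (h0.clm_apply hV.hasFDerivAt).clm_apply hW.hasFDerivAt
  have h2 := h1.fderiv
  simp only [Function.comp_apply] at h2
  rw [h2]
  simp only [covDerivAlong, map_add, add_apply]
  simp [hG.fderiv_eq hx]
  ring

/-- Transformation law of the Christoffel symbols under a change of coordinates. -/
theorem IsRiemannianOn.christoffel_transform (hG : IsRiemannianOn G U) (hy : y ∈ U)
    {G' : E → E →L[ℝ] E →L[ℝ] ℝ} {U' : Set E} (hG' : IsRiemannianOn G' U') {ψ : E → E}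
    (hψ : ContDiffAt ℝ 2 ψ y) (hψy : ψ y ∈ U')
    (hsurj : Function.Surjective (fderiv ℝ ψ y))
    (h : ∀ᶠ z in nhds y, G z = pullbackForm (G' (ψ z)) (fderiv ℝ ψ z)) (u v : E) :
    fderiv ℝ ψ y (christoffel G y u v)
      = christoffel G' (ψ y) (fderiv ℝ ψ y u) (fderiv ℝ ψ y v)
        + fderiv ℝ (fderiv ℝ ψ) y u v := by
  have hdψ : DifferentiableAt ℝ (fderiv ℝ ψ) y :=
    (hψ.fderiv_right (m := 1) (by norm_num)).differentiableAt (by simp)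
  have hsymm : ∀ u v, fderiv ℝ (fderiv ℝ ψ) y u v = fderiv ℝ (fderiv ℝ ψ) y v u := by
    intro u v
    exact (hψ.isSymmSndFDerivAt (by simp)) u v
  set B : E → E → E := fun u v => christoffel G' (ψ y) (fderiv ℝ ψ y u) (fderiv ℝ ψ y v)
        + fderiv ℝ (fderiv ℝ ψ) y u v with hBdef
  have hBsymm : ∀ u v, B u v = B v u := fun u v => by
    simp only [hBdef]
    rw [hG'.christoffel_comm hψy, hsymm]
  choose L hL using hsurj
  have hGy : ∀ a b, G y a b = G' (ψ y) (fderiv ℝ ψ y a) (fderiv ℝ ψ y b) := fun a b => by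
    rw [h.self_of_nhds]; simp [pullbackForm]
  have hinj : Function.Injective (fderiv ℝ ψ y) :=
    (LinearMap.injective_iff_surjective (f := (fderiv ℝ ψ y : E →ₗ[ℝ] E))).2
      fun z => ⟨L z, hL z⟩
  have key := hG.christoffel_unique hy (B := fun u v => L (B u v))
    (fun u v => by rw [hBsymm]) ?_ u v
  · rw [key, hL]
  intro u v w
  rw [← fderiv_bilin_apply (hG.differentiableAt hy)]
  have hev : (fun z => G z v w) =ᶠ[nhds y]
      fun z => G' (ψ z) (fderiv ℝ ψ z v) (fderiv ℝ ψ z w) := by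
    filter_upwards [h] with z hz
    rw [hz]; simp [pullbackForm]
  rw [hev.fderiv_eq, hG'.fderiv_inner_along hψy (hψ.differentiableAt (by simp))
    (hdψ.clm_apply (differentiableAt_const v)) (hdψ.clm_apply (differentiableAt_const w)),
    hGy, hGy, hL, hL]
  simp only [covDerivAlong, hBdef]
  rw [fderiv_clm_apply hdψ (differentiableAt_const v),
    fderiv_clm_apply hdψ (differentiableAt_const w)]
  simp [add_comm]

/-- The covariant derivative along a map does not depend on the coordinates. -/
theorem IsRiemannianOn.covDerivAlong_transform (hG : IsRiemannianOn G U)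
    {G' : E → E →L[ℝ] E →L[ℝ] ℝ} {U' : Set E} (hG' : IsRiemannianOn G' U') {ψ : E → E}
    {F V : E' → E} {x : E'} (hx : F x ∈ U)
    (hψ : ContDiffAt ℝ 2 ψ (F x)) (hψy : ψ (F x) ∈ U')
    (hsurj : Function.Surjective (fderiv ℝ ψ (F x)))
    (h : ∀ᶠ z in nhds (F x), G z = pullbackForm (G' (ψ z)) (fderiv ℝ ψ z))
    (hF : DifferentiableAt ℝ F x) (hV : DifferentiableAt ℝ V x) (u : E') :
    covDerivAlong G' (ψ ∘ F) (fun z => fderiv ℝ ψ (F z) (V z)) x u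
      = fderiv ℝ ψ (F x) (covDerivAlong G F V x u) := by
  have hdψ : DifferentiableAt ℝ (fderiv ℝ ψ) (F x) :=
    (hψ.fderiv_right (m := 1) (by norm_num)).differentiableAt (by simp)
  have h1 : fderiv ℝ (fun z => fderiv ℝ ψ (F z) (V z)) x u
      = fderiv ℝ (fderiv ℝ ψ) (F x) (fderiv ℝ F x u) (V x)
        + fderiv ℝ ψ (F x) (fderiv ℝ V x u) := by
    have := ((hdψ.hasFDerivAt.comp x hF.hasFDerivAt).clm_apply hV.hasFDerivAt).fderiv
    simp only [Function.comp_apply] at this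
    rw [this]
    simp [add_comm]
  have h2 : fderiv ℝ (ψ ∘ F) x u = fderiv ℝ ψ (F x) (fderiv ℝ F x u) := by
    rw [((hψ.differentiableAt (by simp)).hasFDerivAt.comp x hF.hasFDerivAt).fderiv]
    rfl
  simp only [covDerivAlong, h1, h2, Function.comp_apply, map_add]
  rw [hG.christoffel_transform hx hG' hψ hψy hsurj h]
  abel

/-- The curvature operator `R(u, v)` is skew-symmetric: `G(R(u, v)w, w) = 0`. -/
theorem IsRiemannianOn.curvatureTensor_skew (hG : IsRiemannianOn G U) (hy : y ∈ U) (u v w : E) :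
    G y (curvatureTensor G y u v w) w = 0 := by
  have hdiff : ContDiffAt ℝ 2 (fun z => G z w w) y :=
    (((hG.contDiffAt hy).clm_apply contDiffAt_const).clm_apply contDiffAt_const).of_le
      two_le_infty
  have hsymm := hdiff.isSymmSndFDerivAt (by simp) u v
  have h1 : ∀ a b, fderiv ℝ (fderiv ℝ (fun z => G z w w)) y a b
      = 2 * (G y (christoffel G y a (christoffel G y b w)) w
        + G y (christoffel G y b w) (christoffel G y a w)
        + G y (fderiv ℝ (fun z => christoffel G z b w) y a) w) := by
    intro a b
    have hD : DifferentiableAt ℝ (fderiv ℝ (fun z => G z w w)) y :=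
      (hdiff.fderiv_right (m := 1) (by norm_num)).differentiableAt (by simp)
    have e1 : fderiv ℝ (fderiv ℝ (fun z => G z w w)) y a b
        = fderiv ℝ (fun x => fderiv ℝ (fun z => G z w w) x b) y a := by
      rw [fderiv_clm_apply hD (differentiableAt_const b)]
      simp
    have e2 : (fun x => fderiv ℝ (fun z => G z w w) x b) =ᶠ[nhds y]
        fun x => 2 * G x (christoffel G x b w) w := by
      filter_upwards [hG.isOpen.mem_nhds hy] with x hx
      rw [fderiv_bilin_apply (hG.differentiableAt hx), hG.fderiv_eq hx, hG.symm x hx w]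
      ring
    have hc := hG.differentiableAt_christoffel hy b w
    rw [e1, e2.fderiv_eq]
    have h3 := ((hG.differentiableAt hy).hasFDerivAt.clm_apply hc.hasFDerivAt).clm_apply
      (hasFDerivAt_const w y)
    rw [(h3.const_mul 2).fderiv]
    simp [hG.fderiv_eq hy]
    ring
  rw [h1, h1] at hsymm
  unfold curvatureTensor
  simp only [map_sub, map_add, sub_apply, add_apply]
  rw [hG.symm y hy (christoffel G y v w) (christoffel G y u w)] at hsymm
  linarith

end Koszul

/-! ### Product metrics -/

section Block

variable {E₁ E₂ : Type*} [NormedAddCommGroup E₁] [NormedSpace ℝ E₁]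
  [NormedAddCommGroup E₂] [NormedSpace ℝ E₂]

/-- The product of two metrics. -/
noncomputable def blockMetric (G₁ : E₁ → E₁ →L[ℝ] E₁ →L[ℝ] ℝ) (G₂ : E₂ → E₂ →L[ℝ] E₂ →L[ℝ] ℝ)
    (q : E₁ × E₂) : (E₁ × E₂) →L[ℝ] (E₁ × E₂) →L[ℝ] ℝ :=
  pullbackForm (G₁ q.1) (ContinuousLinearMap.fst ℝ E₁ E₂)
    + pullbackForm (G₂ q.2) (ContinuousLinearMap.snd ℝ E₁ E₂)

variable {G₁ : E₁ → E₁ →L[ℝ] E₁ →L[ℝ] ℝ} {G₂ : E₂ → E₂ →L[ℝ] E₂ →L[ℝ] ℝ}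
  {U₁ : Set E₁} {U₂ : Set E₂}

@[simp] theorem blockMetric_apply (q v w : E₁ × E₂) :
    blockMetric G₁ G₂ q v w = G₁ q.1 v.1 w.1 + G₂ q.2 v.2 w.2 := by
  simp [blockMetric, pullbackForm]

theorem IsRiemannianOn.block [FiniteDimensional ℝ E₁] [FiniteDimensional ℝ E₂]
    (h₁ : IsRiemannianOn G₁ U₁) (h₂ : IsRiemannianOn G₂ U₂) :
    IsRiemannianOn (blockMetric G₁ G₂) (U₁ ×ˢ U₂) where
  isOpen := h₁.isOpen.prod h₂.isOpen
  smooth := by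
    rw [contDiffOn_clm_apply]
    intro v
    rw [contDiffOn_clm_apply]
    intro w
    simp only [blockMetric_apply]
    have e₁ : ContDiffOn ℝ ∞ (fun q : E₁ × E₂ => G₁ q.1) (U₁ ×ˢ U₂) :=
      h₁.smooth.comp contDiff_fst.contDiffOn fun q hq => hq.1
    have e₂ : ContDiffOn ℝ ∞ (fun q : E₁ × E₂ => G₂ q.2) (U₁ ×ˢ U₂) :=
      h₂.smooth.comp contDiff_snd.contDiffOn fun q hq => hq.2
    exact ((e₁.clm_apply contDiffOn_const).clm_apply contDiffOn_const).add
      ((e₂.clm_apply contDiffOn_const).clm_apply contDiffOn_const)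
  symm q hq v w := by
    simp [h₁.symm q.1 hq.1 v.1 w.1, h₂.symm q.2 hq.2 v.2 w.2]
  pos q hq v hv := by
    rw [blockMetric_apply]
    have p₁ : 0 ≤ G₁ q.1 v.1 v.1 := by
      by_cases h : v.1 = 0
      · simp [h]
      · exact (h₁.pos _ hq.1 _ h).le
    have p₂ : 0 ≤ G₂ q.2 v.2 v.2 := by
      by_cases h : v.2 = 0
      · simp [h]
      · exact (h₂.pos _ hq.2 _ h).le
    by_cases h : v.1 = 0
    · have : v.2 ≠ 0 := fun h' => hv (Prod.ext h h')
      exact add_pos_of_nonneg_of_pos p₁ (h₂.pos _ hq.2 _ this)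
    · exact add_pos_of_pos_of_nonneg (h₁.pos _ hq.1 _ h) p₂

theorem christoffel_block [FiniteDimensional ℝ E₁] [FiniteDimensional ℝ E₂]
    (h₁ : IsRiemannianOn G₁ U₁) (h₂ : IsRiemannianOn G₂ U₂) {q : E₁ × E₂} (hq : q ∈ U₁ ×ˢ U₂)
    (v w : E₁ × E₂) : christoffel (blockMetric G₁ G₂) q v w
      = (christoffel G₁ q.1 v.1 w.1, christoffel G₂ q.2 v.2 w.2) := by
  refine (h₁.block h₂).christoffel_unique hq
    (B := fun v w => (christoffel G₁ q.1 v.1 w.1, christoffel G₂ q.2 v.2 w.2)) ?_ ?_ v w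
  · intro u v
    rw [h₁.christoffel_comm hq.1, h₂.christoffel_comm hq.2]
  · intro u v w
    rw [← fderiv_bilin_apply ((h₁.block h₂).differentiableAt hq)]
    simp only [blockMetric_apply]
    have e₁ : HasFDerivAt (fun q : E₁ × E₂ => G₁ q.1)
        ((fderiv ℝ G₁ q.1).comp (ContinuousLinearMap.fst ℝ E₁ E₂)) q := by
      have f₁ := (h₁.differentiableAt hq.1).hasFDerivAt
      have f₂ : HasFDerivAt (𝕜 := ℝ) (fun q : E₁ × E₂ => q.1)
        (ContinuousLinearMap.fst ℝ E₁ E₂) q := hasFDerivAt_fst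
      exact f₁.comp q f₂
    have e₂ : HasFDerivAt (fun q : E₁ × E₂ => G₂ q.2)
        ((fderiv ℝ G₂ q.2).comp (ContinuousLinearMap.snd ℝ E₁ E₂)) q := by
      have f₁ := (h₂.differentiableAt hq.2).hasFDerivAt
      have f₂ : HasFDerivAt (𝕜 := ℝ) (fun q : E₁ × E₂ => q.2)
        (ContinuousLinearMap.snd ℝ E₁ E₂) q := hasFDerivAt_snd
      exact f₁.comp q f₂
    have f := (((e₁.clm_apply (hasFDerivAt_const v.1 q)).clm_apply (hasFDerivAt_const w.1 q)).add
      ((e₂.clm_apply (hasFDerivAt_const v.2 q)).clm_apply (hasFDerivAt_const w.2 q))).fderiv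
    have := congrArg (fun L => L u) f
    refine Eq.trans this ?_
    simp [h₁.fderiv_eq hq.1, h₂.fderiv_eq hq.2]
    ring

end Block

/-! ### Metrics on plane domains -/

section PlaneDomains

/-- The standard basis of the plane. -/
noncomputable abbrev bas (i : Fin 2) : Plane := EuclideanSpace.single i (1 : ℝ)

theorem plane_eq (X : Plane) : X = X 0 • bas 0 + X 1 • bas 1 := by
  ext i
  fin_cases i <;> simp

variable {G : Plane → Plane →L[ℝ] Plane →L[ℝ] ℝ} {U : Set Plane} {y : Plane}

theorem IsRiemannianOn.gram_pos (hG : IsRiemannianOn G U) (hy : y ∈ U) :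
    0 < G y (bas 0) (bas 0) * G y (bas 1) (bas 1) - G y (bas 0) (bas 1) ^ 2 := by
  have h0 : (bas 0 : Plane) ≠ 0 := by simp
  have ha := hG.pos y hy _ h0
  have hX : G y (bas 0) (bas 0) • bas 1 - G y (bas 0) (bas 1) • bas 0 ≠ (0 : Plane) := by
    intro h
    have := congrArg (fun X : Plane => X 1) h
    simp at this
    simp [this] at ha
  have := hG.pos y hy _ hX
  simp only [map_sub, map_smul, sub_apply, smul_apply, smul_eq_mul,
    hG.symm y hy (bas 1) (bas 0)] at this
  have h2 : 0 < G y (bas 0) (bas 0) *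
      (G y (bas 0) (bas 0) * G y (bas 1) (bas 1) - G y (bas 0) (bas 1) ^ 2) := by
    linarith
  exact (pos_iff_pos_of_mul_pos h2).1 ha

theorem curvatureTensor_antisymm {E : Type*} [NormedAddCommGroup E] [NormedSpace ℝ E]
    (G : E → E →L[ℝ] E →L[ℝ] ℝ) (y u v w : E) :
    curvatureTensor G y u v w = - curvatureTensor G y v u w := by
  unfold curvatureTensor
  abel

/-- On a surface, constant Gauss curvature `c` means `R(u, v)w = c (G(v, w)u - G(u, w)v)`. -/
theorem IsRiemannianOn.curvature_components (hG : IsRiemannianOn G U) (hy : y ∈ U) {c : ℝ}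
    (h : ∀ u v, G y (curvatureTensor G y u v v) u = c * (G y u u * G y v v - G y u v ^ 2)) :
    curvatureTensor G y (bas 0) (bas 1) (bas 1) 0 = c * G y (bas 1) (bas 1) ∧
    curvatureTensor G y (bas 0) (bas 1) (bas 1) 1 = - (c * G y (bas 0) (bas 1)) ∧
    curvatureTensor G y (bas 0) (bas 1) (bas 0) 0 = c * G y (bas 0) (bas 1) ∧
    curvatureTensor G y (bas 0) (bas 1) (bas 0) 1 = - (c * G y (bas 0) (bas 0)) := by
  have hpos := hG.gram_pos hy
  have s1 := hG.curvatureTensor_skew hy (bas 0) (bas 1) (bas 1)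
  have s0 := hG.curvatureTensor_skew hy (bas 0) (bas 1) (bas 0)
  have k1 := h (bas 0) (bas 1)
  have k0 := h (bas 1) (bas 0)
  rw [curvatureTensor_antisymm, map_neg, neg_apply] at k0
  generalize curvatureTensor G y (bas 0) (bas 1) (bas 1) = X at *
  generalize curvatureTensor G y (bas 0) (bas 1) (bas 0) = Y at *
  rw [plane_eq X] at s1 k1
  rw [plane_eq Y] at s0 k0
  simp only [map_add, map_smul, add_apply, smul_apply, smul_eq_mul,
    hG.symm y hy (bas 1) (bas 0)] at s1 k1 s0 k0
  set a := G y (bas 0) (bas 0)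
  set b := G y (bas 0) (bas 1)
  set d := G y (bas 1) (bas 1)
  refine ⟨?_, ?_, ?_, ?_⟩ <;> apply mul_left_cancel₀ hpos.ne'
  · linear_combination d * k1 - b * s1
  · linear_combination a * s1 - b * k1
  · linear_combination d * s0 + b * k0
  · linear_combination -a * k0 - b * s0

end PlaneDomains

/-! ### Immersions that are diagonal in coordinates -/

/-- The pointwise computation behind the equality of the two curvatures. The `p` and `q` are the
Christoffel symbols `p k i j = Γᵏᵢⱼ` of two metrics with matrices `(a, b, c)` and `(a', b', c')` and
equal determinants, `d0` and `d1` denote derivatives along the two axes, the `P` and `Q` are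
the curvature components, and `g` stands for the derivatives of the entries of the sum of the
metrics. `W` is half the trace of the difference of the connections with respect to the sum `G`
of the metrics. Equality of the determinants makes the `G`-traces of both metrics equal to `1`, and
makes the terms quadratic in the difference of the connections cancel, which leaves
`κ₁ - κ₂ = 2 div W`. -/
theorem curvature_eq_of_divergence_eq_zero (a b c a' b' c' κ₁ κ₂ : ℝ)
    (p000 p001 p011 p100 p101 p111 q000 q001 q011 q100 q101 q111 : ℝ)
    (d0p000 d0p001 d1p001 d0p011 d1p100 d0p101 d1p101 d0p111 d1p111 : ℝ)
    (d0q000 d0q001 d1q001 d0q011 d1q100 d0q101 d1q101 d0q111 d1q111 : ℝ)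
    (hpos : 0 < (a + a') * (c + c') - (b + b') ^ 2)
    (hdet : a * c - b ^ 2 = a' * c' - b' ^ 2)
    (t0 : p000 + p101 = q000 + q101) (t1 : p001 + p111 = q001 + q111)
    (t00 : d0p000 + d0p101 = d0q000 + d0q101)
    (t01 : d0p001 + d0p111 = d0q001 + d0q111) (t11 : d1p001 + d1p111 = d1q001 + d1q111)
    (P1 : d0p011 - d1p001 + (p000 * p011 + p001 * p111) - (p001 * p001 + p011 * p101) = κ₁ * c)
    (P2 : d0p111 - d1p101 + (p100 * p011 + p101 * p111) - (p101 * p001 + p111 * p101) = -(κ₁ * b))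
    (P4 : d0p101 - d1p100 + (p100 * p001 + p101 * p101) - (p101 * p000 + p111 * p100) = -(κ₁ * a))
    (Q1 : d0q011 - d1q001 + (q000 * q011 + q001 * q111) - (q001 * q001 + q011 * q101) = κ₂ * c')
    (Q2 : d0q111 - d1q101 + (q100 * q011 + q101 * q111) - (q101 * q001 + q111 * q101) = -(κ₂ * b'))
    (Q4 : d0q101 - d1q100 + (q100 * q001 + q101 * q101) - (q101 * q000 + q111 * q100) = -(κ₂ * a'))
    (W0 W1 dW0 dW1 g0a g0b g0c g1a g1b g1c : ℝ)
    (hg0a : g0a = 2 * (p000 * a + p100 * b) + 2 * (q000 * a' + q100 * b'))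
    (hg0b : g0b = (p000 * b + p100 * c + p001 * a + p101 * b)
      + (q000 * b' + q100 * c' + q001 * a' + q101 * b'))
    (hg0c : g0c = 2 * (p001 * b + p101 * c) + 2 * (q001 * b' + q101 * c'))
    (hg1a : g1a = 2 * (p001 * a + p101 * b) + 2 * (q001 * a' + q101 * b'))
    (hg1b : g1b = (p001 * b + p101 * c + p011 * a + p111 * b)
      + (q001 * b' + q101 * c' + q011 * a' + q111 * b'))
    (hg1c : g1c = 2 * (p011 * b + p111 * c) + 2 * (q011 * b' + q111 * c'))
    (hW0 : 2 * (((a + a') * (c + c') - (b + b') ^ 2) * W0)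
      = (c + c') * (p000 - q000) - 2 * ((b + b') * (p001 - q001)) + (a + a') * (p011 - q011))
    (hW1 : 2 * (((a + a') * (c + c') - (b + b') ^ 2) * W1)
      = (c + c') * (p100 - q100) - 2 * ((b + b') * (p101 - q101)) + (a + a') * (p111 - q111))
    (hdW0 : 2 * ((g0a * (c + c') + (a + a') * g0c - 2 * (b + b') * g0b) * W0
        + ((a + a') * (c + c') - (b + b') ^ 2) * dW0)
      = (g0c * (p000 - q000) + (c + c') * (d0p000 - d0q000))
        - 2 * (g0b * (p001 - q001) + (b + b') * (d0p001 - d0q001))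
        + (g0a * (p011 - q011) + (a + a') * (d0p011 - d0q011)))
    (hdW1 : 2 * ((g1a * (c + c') + (a + a') * g1c - 2 * (b + b') * g1b) * W1
        + ((a + a') * (c + c') - (b + b') ^ 2) * dW1)
      = (g1c * (p100 - q100) + (c + c') * (d1p100 - d1q100))
        - 2 * (g1b * (p101 - q101) + (b + b') * (d1p101 - d1q101))
        + (g1a * (p111 - q111) + (a + a') * (d1p111 - d1q111)))
    (hdiv : dW0 + dW1 + (p000 + p101) * W0 + (p001 + p111) * W1 = 0) :
    κ₁ = κ₂ := by
  obtain rfl : q101 = p000 + p101 - q000 := by linarith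
  obtain rfl : q001 = p001 + p111 - q111 := by linarith
  obtain rfl : d0q101 = d0p000 + d0p101 - d0q000 := by linarith
  obtain rfl : d0q001 = d0p001 + d0p111 - d0q111 := by linarith
  obtain rfl : d1q001 = d1p001 + d1p111 - d1q111 := by linarith
  subst hg0a hg0b hg0c hg1a hg1b hg1c
  set Δ : ℝ := (a + a') * (c + c') - (b + b') ^ 2 with hΔ
  have key : Δ ^ 2 * (κ₁ - κ₂) = 0 := by
    linear_combination -Δ * ((c + c') * (Q4 - P4) - 2 * (b + b') * (Q2 - P2) + (a + a') * (P1 - Q1))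
      - Δ * (hdW0 + hdW1)
      + (((2 * (p000 * a + p100 * b) + 2 * (q000 * a' + q100 * b')) * (c + c') + (a + a') * (2 * (p001 * b + p101 * c) + 2 * ((p001 + p111 - q111) * b' + (p000 + p101 - q000) * c')) - 2 * (b + b') * ((p000 * b + p100 * c + p001 * a + p101 * b)
      + (q000 * b' + q100 * c' + (p001 + p111 - q111) * a' + (p000 + p101 - q000) * b')))) * hW0
      + (((2 * (p001 * a + p101 * b) + 2 * ((p001 + p111 - q111) * a' + (p000 + p101 - q000) * b')) * (c + c') + (a + a') * (2 * (p011 * b + p111 * c) + 2 * (q011 * b' + q111 * c')) - 2 * (b + b') * ((p001 * b + p101 * c + p011 * a + p111 * b)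
      + ((p001 + p111 - q111) * b' + (p000 + p101 - q000) * c' + q011 * a' + q111 * b')))) * hW1
      + 2 * Δ ^ 2 * hdiv - Δ * ((p000 + p101) * hW0 + (p001 + p111) * hW1)
      - (Δ * (κ₁ + κ₂) - ((c + c') * ((p000 - q000) ^ 2 + 2 * (p001 - (p001 + p111 - q111)) * (p100 - q100) + (p101 - (p000 + p101 - q000)) ^ 2)
        - 2 * (b + b') * ((p000 - q000) * (p001 - (p001 + p111 - q111)) + (p001 - (p001 + p111 - q111)) * (p101 - (p000 + p101 - q000))
          + (p100 - q100) * (p011 - q011) + (p101 - (p000 + p101 - q000)) * (p111 - q111))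
        + (a + a') * ((p001 - (p001 + p111 - q111)) ^ 2 + 2 * (p011 - q011) * (p101 - (p000 + p101 - q000)) + (p111 - q111) ^ 2))) * hdet
  have := (mul_eq_zero.1 key).resolve_left (pow_pos hpos 2).ne'
  linarith

section Diagonal

variable {G G₁ G₂ : Plane → Plane →L[ℝ] Plane →L[ℝ] ℝ} {U : Set Plane} {x y : Plane}

theorem christoffel_expand (G : Plane → Plane →L[ℝ] Plane →L[ℝ] ℝ) (y u X : Plane) (k : Fin 2) :
    christoffel G y u X k
      = X 0 * christoffel G y u (bas 0) k + X 1 * christoffel G y u (bas 1) k := by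
  conv_lhs => rw [plane_eq X, christoffel_add_right, christoffel_smul_right,
    christoffel_smul_right]
  simp

theorem bilin_expand_left (B : Plane →L[ℝ] Plane →L[ℝ] ℝ) (X w : Plane) :
    B X w = X 0 * B (bas 0) w + X 1 * B (bas 1) w := by
  conv_lhs => rw [plane_eq X, map_add, map_smul, map_smul]
  simp

theorem bilin_expand_right (B : Plane →L[ℝ] Plane →L[ℝ] ℝ) (w X : Plane) :
    B w X = X 0 * B w (bas 0) + X 1 * B w (bas 1) := by
  conv_lhs => rw [plane_eq X, map_add, map_smul, map_smul]
  simp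

theorem IsRiemannianOn.hasFDerivAt_apply (hG : IsRiemannianOn G U) (hy : y ∈ U) (v w : Plane) :
    HasFDerivAt (fun z => G z v w) (fderiv ℝ (fun z => G z v w) y) y :=
  (((hG.differentiableAt hy).clm_apply (differentiableAt_const v)).clm_apply
    (differentiableAt_const w)).hasFDerivAt

/-- `∂_u det G = 2 tr(∇_u) det G`. -/
theorem IsRiemannianOn.fderiv_gram (hG : IsRiemannianOn G U) (hy : y ∈ U) (u : Plane) :
    fderiv ℝ (fun z => G z (bas 0) (bas 0) * G z (bas 1) (bas 1) - G z (bas 0) (bas 1) ^ 2) y u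
      = 2 * (christoffel G y u (bas 0) 0 + christoffel G y u (bas 1) 1)
        * (G y (bas 0) (bas 0) * G y (bas 1) (bas 1) - G y (bas 0) (bas 1) ^ 2) := by
  have h := (((hG.hasFDerivAt_apply hy (bas 0) (bas 0)).mul
    (hG.hasFDerivAt_apply hy (bas 1) (bas 1))).sub
    ((hG.hasFDerivAt_apply hy (bas 0) (bas 1)).pow 2)).fderiv
  refine (congrArg (fun L => L u) h).trans ?_
  simp only [sub_apply, add_apply, smul_apply, smul_eq_mul,
    fderiv_bilin_apply (hG.differentiableAt hy), hG.fderiv_eq hy]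
  simp only [bilin_expand_left _ (christoffel G y _ _), bilin_expand_right _ _ (christoffel G y _ _),
    hG.symm y hy (bas 1) (bas 0)]
  simp
  ring

/-- Metrics with the same area form have connections with the same trace. -/
theorem trace_christoffel_eq (h₁ : IsRiemannianOn G₁ U) (h₂ : IsRiemannianOn G₂ U)
    (hdet : ∀ z ∈ U, G₁ z (bas 0) (bas 0) * G₁ z (bas 1) (bas 1) - G₁ z (bas 0) (bas 1) ^ 2
      = G₂ z (bas 0) (bas 0) * G₂ z (bas 1) (bas 1) - G₂ z (bas 0) (bas 1) ^ 2)
    (hy : y ∈ U) (u : Plane) :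
    christoffel G₁ y u (bas 0) 0 + christoffel G₁ y u (bas 1) 1
      = christoffel G₂ y u (bas 0) 0 + christoffel G₂ y u (bas 1) 1 := by
  have e : fderiv ℝ (fun z => G₁ z (bas 0) (bas 0) * G₁ z (bas 1) (bas 1)
      - G₁ z (bas 0) (bas 1) ^ 2) y u = fderiv ℝ (fun z => G₂ z (bas 0) (bas 0)
      * G₂ z (bas 1) (bas 1) - G₂ z (bas 0) (bas 1) ^ 2) y u := by
    congr 1
    apply Filter.EventuallyEq.fderiv_eq
    filter_upwards [h₁.isOpen.mem_nhds hy] with z hz using hdet z hz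
  rw [h₁.fderiv_gram hy, h₂.fderiv_gram hy, ← hdet y hy] at e
  have := mul_right_cancel₀ (h₁.gram_pos hy).ne' e
  linarith

theorem IsRiemannianOn.hasFDerivAt_christoffel (hG : IsRiemannianOn G U) (hy : y ∈ U)
    (v w : Plane) (k : Fin 2) :
    HasFDerivAt (fun z => christoffel G z v w k)
      ((EuclideanSpace.proj k : Plane →L[ℝ] ℝ).comp
        (fderiv ℝ (fun z => christoffel G z v w) y)) y :=
  (EuclideanSpace.proj k : Plane →L[ℝ] ℝ).hasFDerivAt.comp y
    (hG.differentiableAt_christoffel hy v w).hasFDerivAt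

/-- The derivatives of the traces of two connections agree if the traces do. -/
theorem fderiv_trace_christoffel_eq (h₁ : IsRiemannianOn G₁ U) (h₂ : IsRiemannianOn G₂ U)
    (hdet : ∀ z ∈ U, G₁ z (bas 0) (bas 0) * G₁ z (bas 1) (bas 1) - G₁ z (bas 0) (bas 1) ^ 2
      = G₂ z (bas 0) (bas 0) * G₂ z (bas 1) (bas 1) - G₂ z (bas 0) (bas 1) ^ 2)
    (hy : y ∈ U) (u v : Plane) :
    fderiv ℝ (fun z => christoffel G₁ z v (bas 0)) y u 0
        + fderiv ℝ (fun z => christoffel G₁ z v (bas 1)) y u 1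
      = fderiv ℝ (fun z => christoffel G₂ z v (bas 0)) y u 0
        + fderiv ℝ (fun z => christoffel G₂ z v (bas 1)) y u 1 := by
  have e := ((h₁.hasFDerivAt_christoffel hy v (bas 0) 0).add
    (h₁.hasFDerivAt_christoffel hy v (bas 1) 1)).congr_of_eventuallyEq
    (f₁ := fun z => christoffel G₂ z v (bas 0) 0 + christoffel G₂ z v (bas 1) 1) (by
      filter_upwards [h₁.isOpen.mem_nhds hy] with z hz
      exact (trace_christoffel_eq h₁ h₂ hdet hz v).symm)
  have e' := (h₂.hasFDerivAt_christoffel hy v (bas 0) 0).add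
    (h₂.hasFDerivAt_christoffel hy v (bas 1) 1)
  have := congrArg (fun L => L u) (e.unique e')
  simpa using this

theorem IsRiemannianOn.add (h₁ : IsRiemannianOn G₁ U) (h₂ : IsRiemannianOn G₂ U) :
    IsRiemannianOn (fun z => G₁ z + G₂ z) U where
  isOpen := h₁.isOpen
  smooth := h₁.smooth.add h₂.smooth
  symm y hy u v := by simp [h₁.symm y hy u v, h₂.symm y hy u v]
  pos y hy u hu := by
    simpa using add_pos (h₁.pos y hy u hu) (h₂.pos y hy u hu)

section Mean

variable (h₁ : IsRiemannianOn G₁ U) (h₂ : IsRiemannianOn G₂ U)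
  {GG : Plane × Plane → (Plane × Plane) →L[ℝ] (Plane × Plane) →L[ℝ] ℝ}
  (hGG : ∀ q ∈ U ×ˢ U, GG q = blockMetric G₁ G₂ q) {F : Plane → Plane × Plane}
  (hF : ∀ z ∈ U, F z = (z, z))

include h₁ h₂ hGG hF

theorem fderiv_diagonal (hy : y ∈ U) (v : Plane) : fderiv ℝ F y v = (v, v) := by
  have : F =ᶠ[nhds y] fun z => (z, z) := by
    filter_upwards [h₁.isOpen.mem_nhds hy] with z hz using hF z hz
  have h2 : HasFDerivAt (𝕜 := ℝ) (fun z : Plane => (z, z)) _ y :=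
    (hasFDerivAt_id y).prodMk (hasFDerivAt_id y)
  rw [this.fderiv_eq, h2.fderiv]
  rfl

theorem christoffel_ambient (hy : y ∈ U) (v w : Plane × Plane) :
    christoffel GG (F y) v w = (christoffel G₁ y v.1 w.1, christoffel G₂ y v.2 w.2) := by
  have hq : (y, y) ∈ U ×ˢ U := ⟨hy, hy⟩
  rw [hF y hy, christoffel_congr (G' := blockMetric G₁ G₂), christoffel_block h₁ h₂ hq]
  filter_upwards [(h₁.isOpen.prod h₂.isOpen).mem_nhds hq] with z hz using hGG z hz

theorem inducedMetric_diagonal (hy : y ∈ U) : inducedMetric GG F y = G₁ y + G₂ y := by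
  ext v w
  have hq : (y, y) ∈ U ×ˢ U := ⟨hy, hy⟩
  simp [inducedMetric, pullbackForm, fderiv_diagonal h₁ h₂ hGG hF hy, hF y hy, hGG _ hq]

/-- The induced metric of the diagonal is `G₁ + G₂`, and its second fundamental form compares the
three connections. -/
theorem secondFundamentalForm_diagonal (hy : y ∈ U) (u v : Plane) :
    secondFundamentalForm GG F y u v
      = (christoffel G₁ y u v - christoffel (fun z => G₁ z + G₂ z) y u v,
        christoffel G₂ y u v - christoffel (fun z => G₁ z + G₂ z) y u v) := by
  have e : (fun z => fderiv ℝ F z v) =ᶠ[nhds y] fun _ => (v, v) := by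
    filter_upwards [h₁.isOpen.mem_nhds hy] with z hz using fderiv_diagonal h₁ h₂ hGG hF hz v
  have e' : inducedMetric GG F =ᶠ[nhds y] fun z => G₁ z + G₂ z := by
    filter_upwards [h₁.isOpen.mem_nhds hy] with z hz using inducedMetric_diagonal h₁ h₂ hGG hF hz
  rw [secondFundamentalForm, covDerivAlong, e.fderiv_eq, christoffel_ambient h₁ h₂ hGG hF hy,
    christoffel_congr e']
  simp [fderiv_diagonal h₁ h₂ hGG hF hy]

/-- The mean curvature vector of the diagonal, with the inverse of the first fundamental form written
out. -/
theorem meanCurvature_diagonal (hy : y ∈ U) :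
    meanCurvature GG F y = (2 * ((G₁ y (bas 0) (bas 0) + G₂ y (bas 0) (bas 0))
        * (G₁ y (bas 1) (bas 1) + G₂ y (bas 1) (bas 1))
        - (G₁ y (bas 0) (bas 1) + G₂ y (bas 0) (bas 1)) ^ 2))⁻¹ •
      ((G₁ y (bas 1) (bas 1) + G₂ y (bas 1) (bas 1)) • secondFundamentalForm GG F y (bas 0) (bas 0)
      - (2 * (G₁ y (bas 0) (bas 1) + G₂ y (bas 0) (bas 1))) •
          secondFundamentalForm GG F y (bas 0) (bas 1)
      + (G₁ y (bas 0) (bas 0) + G₂ y (bas 0) (bas 0)) •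
          secondFundamentalForm GG F y (bas 1) (bas 1)) := by
  have hs : secondFundamentalForm GG F y (bas 1) (bas 0)
      = secondFundamentalForm GG F y (bas 0) (bas 1) := by
    rw [secondFundamentalForm_diagonal h₁ h₂ hGG hF hy,
      secondFundamentalForm_diagonal h₁ h₂ hGG hF hy, h₁.christoffel_comm hy,
      h₂.christoffel_comm hy, (h₁.add h₂).christoffel_comm hy]
  rw [meanCurvature, inducedMetric_diagonal h₁ h₂ hGG hF hy]
  simp only [Fin.sum_univ_two, Matrix.inv_def, Matrix.adjugate_fin_two, Matrix.det_fin_two,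
    Ring.inverse_eq_inv', hs]
  simp [h₁.symm y hy (bas 1) (bas 0), h₂.symm y hy (bas 1) (bas 0)]
  module

theorem differentiableAt_meanCurvature_diagonal (hy : y ∈ U) :
    DifferentiableAt ℝ (meanCurvature GG F) y := by
  have hU := h₁.isOpen.mem_nhds hy
  have hs : ∀ u v, DifferentiableAt ℝ (fun z => secondFundamentalForm GG F z u v) y := by
    intro u v
    have e : DifferentiableAt ℝ (fun y =>
      (christoffel G₁ y u v - christoffel (fun z => G₁ z + G₂ z) y u v,
        christoffel G₂ y u v - christoffel (fun z => G₁ z + G₂ z) y u v)) y :=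
      ((h₁.differentiableAt_christoffel hy u v).sub
        ((h₁.add h₂).differentiableAt_christoffel hy u v)).prodMk
      ((h₂.differentiableAt_christoffel hy u v).sub
        ((h₁.add h₂).differentiableAt_christoffel hy u v))
    refine e.congr_of_eventuallyEq ?_
    filter_upwards [hU] with z hz using secondFundamentalForm_diagonal h₁ h₂ hGG hF hz u v
  have hg : ∀ u v, DifferentiableAt ℝ (fun z => G₁ z u v + G₂ z u v) y := fun u v =>
    (h₁.hasFDerivAt_apply hy u v).differentiableAt.add
      (h₂.hasFDerivAt_apply hy u v).differentiableAt
  have hpos := (h₁.add h₂).gram_pos hy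
  simp only [add_apply] at hpos
  have e : DifferentiableAt ℝ (fun y => (2 * ((G₁ y (bas 0) (bas 0) + G₂ y (bas 0) (bas 0))
        * (G₁ y (bas 1) (bas 1) + G₂ y (bas 1) (bas 1))
        - (G₁ y (bas 0) (bas 1) + G₂ y (bas 0) (bas 1)) ^ 2))⁻¹ •
      ((G₁ y (bas 1) (bas 1) + G₂ y (bas 1) (bas 1)) • secondFundamentalForm GG F y (bas 0) (bas 0)
      - (2 * (G₁ y (bas 0) (bas 1) + G₂ y (bas 0) (bas 1))) •
          secondFundamentalForm GG F y (bas 0) (bas 1)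
      + (G₁ y (bas 0) (bas 0) + G₂ y (bas 0) (bas 0)) •
          secondFundamentalForm GG F y (bas 1) (bas 1))) y := by
    have hd := (((hg (bas 0) (bas 0)).mul (hg (bas 1) (bas 1))).sub
      ((hg (bas 0) (bas 1)).pow 2)).const_mul 2
    exact (hd.inv (mul_pos two_pos hpos).ne').smul
      ((((hg _ _).smul (hs _ _)).sub (((hg _ _).const_mul 2).smul (hs _ _))).add
        ((hg _ _).smul (hs _ _)))
  refine e.congr_of_eventuallyEq ?_
  filter_upwards [hU] with z hz using meanCurvature_diagonal h₁ h₂ hGG hF hz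

/-- The two components `H₁`, `H₂` of a parallel mean curvature vector have the same covariant
derivatives: the normal vectors are the `(G₁⁻¹ φ, -G₂⁻¹ φ)` with `φ` a covector. -/
theorem fderiv_meanCurvature_diagonal (hy : y ∈ U) (u : Plane)
    (hpar : ∀ n : Plane × Plane, (∀ v : Plane, GG (F y) (fderiv ℝ F y v) n = 0) →
      GG (F y) (covDerivAlong GG F (meanCurvature GG F) y u) n = 0) :
    (fderiv ℝ (meanCurvature GG F) y u).1 + christoffel G₁ y u (meanCurvature GG F y).1
      = (fderiv ℝ (meanCurvature GG F) y u).2 + christoffel G₂ y u (meanCurvature GG F y).2 := by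
  have hq : (y, y) ∈ U ×ˢ U := ⟨hy, hy⟩
  have key : ∀ φ : Plane →L[ℝ] ℝ,
      φ ((fderiv ℝ (meanCurvature GG F) y u).1 + christoffel G₁ y u (meanCurvature GG F y).1)
      = φ ((fderiv ℝ (meanCurvature GG F) y u).2
        + christoffel G₂ y u (meanCurvature GG F y).2) := by
    intro φ
    have a₁ : ∀ v, G₁ y v ((G₁ y).inverse φ) = φ v := fun v => by
      rw [h₁.symm y hy, h₁.apply_inverse hy]
    have a₂ : ∀ v, G₂ y v (-(G₂ y).inverse φ) = - φ v := fun v => by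
      rw [map_neg, h₂.symm y hy, h₂.apply_inverse hy]
    -- the normal vector to the diagonal with covector `φ`
    have := hpar ((G₁ y).inverse φ, -(G₂ y).inverse φ) (by
      intro v
      rw [fderiv_diagonal h₁ h₂ hGG hF hy, hF y hy, hGG _ hq]
      simp only [blockMetric_apply, a₁, a₂]
      ring)
    rw [covDerivAlong, christoffel_ambient h₁ h₂ hGG hF hy, fderiv_diagonal h₁ h₂ hGG hF hy,
      hF y hy, hGG _ hq] at this
    simp only [blockMetric_apply, Prod.fst_add, Prod.snd_add, a₁, a₂] at this
    linarith
  ext k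
  exact key (EuclideanSpace.proj k)

/-- If the diagonal is an immersion with parallel mean curvature vector into the product of two
metrics of constant curvature with the same area form, then these curvatures are equal. -/
theorem curvature_eq_of_parallel_diagonal
    (hdet : ∀ z ∈ U, G₁ z (bas 0) (bas 0) * G₁ z (bas 1) (bas 1) - G₁ z (bas 0) (bas 1) ^ 2
      = G₂ z (bas 0) (bas 0) * G₂ z (bas 1) (bas 1) - G₂ z (bas 0) (bas 1) ^ 2)
    {κ₁ κ₂ : ℝ} (hy : y ∈ U)
    (hκ₁ : ∀ u v, G₁ y (curvatureTensor G₁ y u v v) u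
      = κ₁ * (G₁ y u u * G₁ y v v - G₁ y u v ^ 2))
    (hκ₂ : ∀ u v, G₂ y (curvatureTensor G₂ y u v v) u
      = κ₂ * (G₂ y u u * G₂ y v v - G₂ y u v ^ 2))
    (hpar : ∀ (u : Plane) (n : Plane × Plane), (∀ v : Plane, GG (F y) (fderiv ℝ F y v) n = 0) →
      GG (F y) (covDerivAlong GG F (meanCurvature GG F) y u) n = 0) : κ₁ = κ₂ := by
  obtain ⟨P1, P2, -, P4⟩ := h₁.curvature_components hy hκ₁
  obtain ⟨Q1, Q2, -, Q4⟩ := h₂.curvature_components hy hκ₂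
  have hU := h₁.isOpen.mem_nhds hy
  have hm := (differentiableAt_meanCurvature_diagonal h₁ h₂ hGG hF hy).hasFDerivAt
  set H := meanCurvature GG F with hH
  -- the components of `W = H₁ - H₂`, whose divergence is `(κ₁ - κ₂) / 2`
  have hW : ∀ k : Fin 2, HasFDerivAt (fun z => (H z).1 k - (H z).2 k)
      ((EuclideanSpace.proj k : Plane →L[ℝ] ℝ).comp ((ContinuousLinearMap.fst ℝ Plane Plane).comp
        (fderiv ℝ H y)) - (EuclideanSpace.proj k : Plane →L[ℝ] ℝ).comp
        ((ContinuousLinearMap.snd ℝ Plane Plane).comp (fderiv ℝ H y))) y := fun k =>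
    ((EuclideanSpace.proj k : Plane →L[ℝ] ℝ).hasFDerivAt.comp y hm.fst).sub
      ((EuclideanSpace.proj k : Plane →L[ℝ] ℝ).hasFDerivAt.comp y hm.snd)
  -- the definition of the mean curvature, with the denominator cleared
  have hWeq : ∀ z ∈ U, ∀ k : Fin 2, 2 * (((G₁ z (bas 0) (bas 0) + G₂ z (bas 0) (bas 0))
        * (G₁ z (bas 1) (bas 1) + G₂ z (bas 1) (bas 1))
        - (G₁ z (bas 0) (bas 1) + G₂ z (bas 0) (bas 1)) ^ 2) * ((H z).1 k - (H z).2 k))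
      = (G₁ z (bas 1) (bas 1) + G₂ z (bas 1) (bas 1))
          * (christoffel G₁ z (bas 0) (bas 0) k - christoffel G₂ z (bas 0) (bas 0) k)
        - 2 * ((G₁ z (bas 0) (bas 1) + G₂ z (bas 0) (bas 1))
          * (christoffel G₁ z (bas 0) (bas 1) k - christoffel G₂ z (bas 0) (bas 1) k))
        + (G₁ z (bas 0) (bas 0) + G₂ z (bas 0) (bas 0))
          * (christoffel G₁ z (bas 1) (bas 1) k - christoffel G₂ z (bas 1) (bas 1) k) := by
    intro z hz k
    have hpos := (h₁.add h₂).gram_pos hz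
    simp only [add_apply] at hpos
    rw [hH, meanCurvature_diagonal h₁ h₂ hGG hF hz]
    simp only [secondFundamentalForm_diagonal h₁ h₂ hGG hF hz]
    simp
    field_simp
    ring
  have hline : ∀ {f : Plane → ℝ} {f' : Plane →L[ℝ] ℝ} (k : Fin 2), HasFDerivAt f f' y →
      HasDerivAt (fun t : ℝ => f (y + t • bas k)) (f' (bas k)) 0 := fun k hf =>
    hf.hasLineDerivAt (bas k)
  -- differentiating `hWeq` gives the derivatives of `W`
  have hdW : ∀ k : Fin 2, _ := fun k => by
    have g := fun i j => (hline k (h₁.hasFDerivAt_apply hy (bas i) (bas j))).add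
      (hline k (h₂.hasFDerivAt_apply hy (bas i) (bas j)))
    have A := fun i j => (hline k (h₁.hasFDerivAt_christoffel hy (bas i) (bas j) k)).sub
      (hline k (h₂.hasFDerivAt_christoffel hy (bas i) (bas j) k))
    have L := ((((g 0 0).mul (g 1 1)).sub ((g 0 1).pow 2)).mul (hline k (hW k))).const_mul 2
    have R := (((g 1 1).mul (A 0 0)).sub (((g 0 1).mul (A 0 1)).const_mul 2)).add
      ((g 0 0).mul (A 1 1))
    refine L.unique (R.congr_of_eventuallyEq ?_)
    have hc : Filter.Tendsto (fun t : ℝ => y + t • (bas k : Plane)) (nhds 0) (nhds y) := by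
      have : Continuous fun t : ℝ => y + t • (bas k : Plane) := by fun_prop
      simpa using this.tendsto 0
    filter_upwards [hc hU] with t ht
    exact hWeq _ ht k
  have hdW0 := hdW 0
  have hdW1 := hdW 1
  -- `∇¹ H₁ = ∇² H₂` and the traces of the connections agree, hence `div W = div H₁ - div H₂ = 0`
  have hdiv0 := congrArg (fun X : Plane => X 0)
    (fderiv_meanCurvature_diagonal h₁ h₂ hGG hF hy (bas 0) (hpar (bas 0)))
  have hdiv1 := congrArg (fun X : Plane => X 1)
    (fderiv_meanCurvature_diagonal h₁ h₂ hGG hF hy (bas 1) (hpar (bas 1)))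
  rw [← hH] at hdiv0 hdiv1
  simp only [PiLp.add_apply] at hdiv0 hdiv1
  rw [christoffel_expand G₁, christoffel_expand G₂] at hdiv0 hdiv1
  have t0 := trace_christoffel_eq h₁ h₂ hdet hy (bas 0)
  have t1 := trace_christoffel_eq h₁ h₂ hdet hy (bas 1)
  have t00 := fderiv_trace_christoffel_eq h₁ h₂ hdet hy (bas 0) (bas 0)
  have t01 := fderiv_trace_christoffel_eq h₁ h₂ hdet hy (bas 0) (bas 1)
  have t11 := fderiv_trace_christoffel_eq h₁ h₂ hdet hy (bas 1) (bas 1)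
  have hpos := (h₁.add h₂).gram_pos hy
  simp only [add_apply] at hpos
  have c₁ : christoffel G₁ y (bas 1) (bas 0) = christoffel G₁ y (bas 0) (bas 1) :=
    h₁.christoffel_comm hy _ _
  have c₂ : christoffel G₂ y (bas 1) (bas 0) = christoffel G₂ y (bas 0) (bas 1) :=
    h₂.christoffel_comm hy _ _
  have d₁ : fderiv ℝ (fun z => christoffel G₁ z (bas 1) (bas 0)) y
      = fderiv ℝ (fun z => christoffel G₁ z (bas 0) (bas 1)) y := by
    apply Filter.EventuallyEq.fderiv_eq
    filter_upwards [hU] with z hz using h₁.christoffel_comm hz _ _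
  have d₂ : fderiv ℝ (fun z => christoffel G₂ z (bas 1) (bas 0)) y
      = fderiv ℝ (fun z => christoffel G₂ z (bas 0) (bas 1)) y := by
    apply Filter.EventuallyEq.fderiv_eq
    filter_upwards [hU] with z hz using h₂.christoffel_comm hz _ _
  simp only [curvatureTensor, PiLp.add_apply, PiLp.sub_apply, christoffel_expand _ _ _
    (christoffel _ _ _ _), c₁, c₂, d₁, d₂] at P1 P2 P4 Q1 Q2 Q4
  simp only [c₁, c₂, d₁, d₂] at t0 t1 t00 t01 t11 hdiv0 hdiv1
  simp [fderiv_bilin_apply (h₁.differentiableAt hy), fderiv_bilin_apply (h₂.differentiableAt hy)]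
    at hdW0 hdW1
  have E₁ := fun u v w => h₁.fderiv_eq hy u v w
  have E₂ := fun u v w => h₂.fderiv_eq hy u v w
  simp only [bilin_expand_left _ (christoffel _ y _ _), bilin_expand_right _ _ (christoffel _ y _ _),
    h₁.symm y hy (bas 1) (bas 0), h₂.symm y hy (bas 1) (bas 0)] at E₁ E₂
  refine curvature_eq_of_divergence_eq_zero (a := G₁ y (bas 0) (bas 0)) (b := G₁ y (bas 0) (bas 1))
    (c := G₁ y (bas 1) (bas 1)) (a' := G₂ y (bas 0) (bas 0)) (b' := G₂ y (bas 0) (bas 1))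
    (c' := G₂ y (bas 1) (bas 1)) (κ₁ := κ₁) (κ₂ := κ₂)
    (d0p011 := fderiv ℝ (fun z => christoffel G₁ z (bas 1) (bas 1)) y (bas 0) 0)
    (d0q011 := fderiv ℝ (fun z => christoffel G₂ z (bas 1) (bas 1)) y (bas 0) 0)
    (d1p100 := fderiv ℝ (fun z => christoffel G₁ z (bas 0) (bas 0)) y (bas 1) 1)
    (d1p101 := fderiv ℝ (fun z => christoffel G₁ z (bas 0) (bas 1)) y (bas 1) 1)
    (d1q100 := fderiv ℝ (fun z => christoffel G₂ z (bas 0) (bas 0)) y (bas 1) 1)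
    (d1q101 := fderiv ℝ (fun z => christoffel G₂ z (bas 0) (bas 1)) y (bas 1) 1)
    (W0 := (H y).1 0 - (H y).2 0) (W1 := (H y).1 1 - (H y).2 1)
    (dW0 := (fderiv ℝ H y (bas 0)).1 0 - (fderiv ℝ H y (bas 0)).2 0)
    (dW1 := (fderiv ℝ H y (bas 1)).1 1 - (fderiv ℝ H y (bas 1)).2 1)
    (hpos := hpos) (hdet := hdet y hy) (t0 := t0) (t1 := t1) (t00 := t00) (t01 := t01)
    (t11 := t11) (P1 := ?_) (P2 := ?_) (P4 := ?_) (Q1 := ?_) (Q2 := ?_) (Q4 := ?_)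
    (hg0a := rfl) (hg0b := rfl) (hg0c := rfl) (hg1a := rfl) (hg1b := rfl) (hg1c := rfl)
    (hW0 := hWeq y hy 0) (hW1 := hWeq y hy 1) (hdW0 := ?_) (hdW1 := ?_) (hdiv := ?_)
  · linear_combination P1
  · linear_combination P2
  · linear_combination P4
  · linear_combination Q1
  · linear_combination Q2
  · linear_combination Q4
  · simp only [E₁, E₂, h₁.symm y hy (bas 1) (bas 0), h₂.symm y hy (bas 1) (bas 0)] at hdW0
    linear_combination hdW0
  · simp only [E₁, E₂, c₁, c₂, h₁.symm y hy (bas 1) (bas 0),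
      h₂.symm y hy (bas 1) (bas 0)] at hdW1
    linear_combination hdW1
  · linear_combination hdiv0 + hdiv1 - (H y).2 0 * t0 - (H y).2 1 * t1

end Mean

end Diagonal

/-! ### Surfaces in charts -/

section Charts

variable {M : Type*} [TopologicalSpace M]

theorem extend_target_eq (e : OpenPartialHomeomorph M Plane) :
    (e.extend 𝓘(ℝ, Plane)).target = e.target := by simp

variable [ChartedSpace Plane M]

theorem chartMetric_apply
    (b : ∀ x : M, TangentSpace 𝓘(ℝ, Plane) x →L[ℝ] TangentSpace 𝓘(ℝ, Plane) x →L[ℝ] ℝ)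
    (e : OpenPartialHomeomorph M Plane) (y u v : Plane) :
    chartMetric 𝓘(ℝ, Plane) b e y u v
      = b (e.symm y) (mfderiv 𝓘(ℝ, Plane) 𝓘(ℝ, Plane) e.symm y u)
          (mfderiv 𝓘(ℝ, Plane) 𝓘(ℝ, Plane) e.symm y v) := rfl

variable [IsManifold 𝓘(ℝ, Plane) ∞ M] {e : OpenPartialHomeomorph M Plane}

theorem mdifferentiable_of_mem_maximalAtlas
    (he : e ∈ IsManifold.maximalAtlas 𝓘(ℝ, Plane) ∞ M) :
    e.MDifferentiable 𝓘(ℝ, Plane) 𝓘(ℝ, Plane) :=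
  ⟨(contMDiffOn_of_mem_maximalAtlas he).mdifferentiableOn (by simp),
    (contMDiffOn_symm_of_mem_maximalAtlas he).mdifferentiableOn (by simp)⟩

/-- The coordinate vector fields of a chart are smooth. -/
theorem contMDiffOn_coordinate_field (he : e ∈ IsManifold.maximalAtlas 𝓘(ℝ, Plane) ∞ M)
    (u : Plane) : ContMDiffOn 𝓘(ℝ, Plane) 𝓘(ℝ, Plane).tangent ∞
      (fun y => (⟨e.symm y, mfderiv 𝓘(ℝ, Plane) 𝓘(ℝ, Plane) e.symm y u⟩ :
        TangentBundle 𝓘(ℝ, Plane) M)) e.target := by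
  have h1 := (contMDiffOn_symm_of_mem_maximalAtlas he).contMDiffOn_tangentMapWithin
    (m := ∞) (by simp) e.open_target.uniqueMDiffOn
  have h2 : ContMDiff 𝓘(ℝ, Plane) 𝓘(ℝ, Plane).tangent ∞
      (fun y : Plane => (⟨y, u⟩ : TangentBundle 𝓘(ℝ, Plane) Plane)) := by
    have := (contMDiff_vectorSpace_iff_contDiff (𝕜 := ℝ) (E := Plane) (n := ∞)
      (V := fun _ => u)).2 contDiff_const
    exact this
  refine (h1.comp h2.contMDiffOn (fun y hy => hy)).congr ?_
  intro y hy
  simp only [tangentMapWithin, Function.comp_apply]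
  rw [mfderivWithin_of_isOpen e.open_target hy]

variable (X : OrientedRiemannianSurface M)

theorem contMDiffWithinAt_metric {f : Plane → M} {v w : ∀ y, TangentSpace 𝓘(ℝ, Plane) (f y)}
    {s : Set Plane} {y : Plane} (hf : ContMDiffWithinAt 𝓘(ℝ, Plane) 𝓘(ℝ, Plane) ∞ f s y)
    (hv : ContMDiffWithinAt 𝓘(ℝ, Plane) 𝓘(ℝ, Plane).tangent ∞
      (fun y => (⟨f y, v y⟩ : TangentBundle 𝓘(ℝ, Plane) M)) s y)
    (hw : ContMDiffWithinAt 𝓘(ℝ, Plane) 𝓘(ℝ, Plane).tangent ∞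
      (fun y => (⟨f y, w y⟩ : TangentBundle 𝓘(ℝ, Plane) M)) s y) :
    ContMDiffWithinAt 𝓘(ℝ, Plane) 𝓘(ℝ, ℝ) ∞ (fun y => X.metric.inner (f y) (v y) (w y)) s y := by
  have : ContMDiffWithinAt 𝓘(ℝ, Plane) (𝓘(ℝ, Plane).prod 𝓘(ℝ)) ∞
      (fun y ↦ Bundle.TotalSpace.mk' ℝ (E := Bundle.Trivial M ℝ) (f y)
        (X.metric.inner (f y) (v y) (w y))) s y := by
    apply ContMDiffWithinAt.clm_bundle_apply₂ (F₁ := Plane) (F₂ := Plane)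
    · exact ContMDiffAt.comp_contMDiffWithinAt y X.metric.contMDiff.contMDiffAt hf
    · exact hv
    · exact hw
  simp only [Bundle.contMDiffWithinAt_totalSpace] at this
  exact this.2

theorem contMDiffWithinAt_J {f : Plane → M} {v : ∀ y, TangentSpace 𝓘(ℝ, Plane) (f y)}
    {s : Set Plane} {y : Plane} (hf : ContMDiffWithinAt 𝓘(ℝ, Plane) 𝓘(ℝ, Plane) ∞ f s y)
    (hv : ContMDiffWithinAt 𝓘(ℝ, Plane) 𝓘(ℝ, Plane).tangent ∞
      (fun y => (⟨f y, v y⟩ : TangentBundle 𝓘(ℝ, Plane) M)) s y) :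
    ContMDiffWithinAt 𝓘(ℝ, Plane) 𝓘(ℝ, Plane).tangent ∞
      (fun y => (⟨f y, X.J (f y) (v y)⟩ : TangentBundle 𝓘(ℝ, Plane) M)) s y := by
  apply ContMDiffWithinAt.clm_bundle_apply (F₁ := Plane) (F₂ := Plane)
  · exact ContMDiffAt.comp_contMDiffWithinAt y X.J_smooth.contMDiffAt hf
  · exact hv

theorem isRiemannianOn_chartMetric (he : e ∈ IsManifold.maximalAtlas 𝓘(ℝ, Plane) ∞ M) :
    IsRiemannianOn (chartMetric 𝓘(ℝ, Plane) X.metric.inner e) e.target where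
  isOpen := e.open_target
  smooth := by
    rw [contDiffOn_clm_apply]
    intro u
    rw [contDiffOn_clm_apply]
    intro v
    rw [← contMDiffOn_iff_contDiffOn]
    intro y hy
    exact contMDiffWithinAt_metric X (contMDiffOn_symm_of_mem_maximalAtlas he y hy)
      (contMDiffOn_coordinate_field he u y hy) (contMDiffOn_coordinate_field he v y hy)
  symm y hy u v := by
    rw [chartMetric_apply, chartMetric_apply]
    exact X.metric.symm _ _ _
  pos y hy u hu := by
    rw [chartMetric_apply]
    apply X.metric.pos
    intro h
    have := (mdifferentiable_of_mem_maximalAtlas he).symm.mfderiv_injective hy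
    exact hu (this (h.trans (map_zero _).symm))

theorem contDiffOn_chartKahler (he : e ∈ IsManifold.maximalAtlas 𝓘(ℝ, Plane) ∞ M) :
    ContDiffOn ℝ ∞ (chartMetric 𝓘(ℝ, Plane) X.kahlerForm e) e.target := by
  rw [contDiffOn_clm_apply]
  intro u
  rw [contDiffOn_clm_apply]
  intro v
  rw [← contMDiffOn_iff_contDiffOn]
  intro y hy
  have hs := contMDiffOn_symm_of_mem_maximalAtlas he y hy
  exact contMDiffWithinAt_metric X hs
    (contMDiffWithinAt_J X hs (contMDiffOn_coordinate_field he u y hy))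
    (contMDiffOn_coordinate_field he v y hy)

/-- The coordinate expression of the complex structure `J`, recovered from the metric and the
Kähler form. -/
noncomputable def chartJ (e : OpenPartialHomeomorph M Plane) (y : Plane) : Plane →L[ℝ] Plane :=
  (chartMetric 𝓘(ℝ, Plane) X.metric.inner e y).inverse.comp
    (chartMetric 𝓘(ℝ, Plane) X.kahlerForm e y)

theorem contDiffOn_chartJ (he : e ∈ IsManifold.maximalAtlas 𝓘(ℝ, Plane) ∞ M) :
    ContDiffOn ℝ ∞ (chartJ X e) e.target := fun y hy =>
  (((isRiemannianOn_chartMetric X he).contDiffAt_inverse hy).contDiffWithinAt).clm_comp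
    (contDiffOn_chartKahler X he y hy)

theorem chartMetric_chartJ (he : e ∈ IsManifold.maximalAtlas 𝓘(ℝ, Plane) ∞ M) {y : Plane}
    (hy : y ∈ e.target) (u v : Plane) :
    chartMetric 𝓘(ℝ, Plane) X.metric.inner e y (chartJ X e y u) v
      = chartMetric 𝓘(ℝ, Plane) X.kahlerForm e y u v := by
  simp only [chartJ, ContinuousLinearMap.comp_apply]
  rw [(isRiemannianOn_chartMetric X he).apply_inverse hy]

/-- The coordinates of a tangent vector in the chart `e`. -/
noncomputable def tangentCoord (e : OpenPartialHomeomorph M Plane) (x : M) :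
    TangentSpace 𝓘(ℝ, Plane) x →L[ℝ] Plane :=
  mfderiv 𝓘(ℝ, Plane) 𝓘(ℝ, Plane) e x

theorem tangentCoord_surjective (he : e ∈ IsManifold.maximalAtlas 𝓘(ℝ, Plane) ∞ M) {x : M}
    (hx : x ∈ e.source) : Function.Surjective (tangentCoord e x) :=
  (mdifferentiable_of_mem_maximalAtlas he).mfderiv_surjective hx

/-- The metric in terms of its coordinate expression. -/
theorem form_eq_chartMetric
    (b : ∀ x : M, TangentSpace 𝓘(ℝ, Plane) x →L[ℝ] TangentSpace 𝓘(ℝ, Plane) x →L[ℝ] ℝ)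
    (he : e ∈ IsManifold.maximalAtlas 𝓘(ℝ, Plane) ∞ M) {x : M}
    (hx : x ∈ e.source) (v w : TangentSpace 𝓘(ℝ, Plane) x) :
    b x v w = chartMetric 𝓘(ℝ, Plane) b e (e x) (tangentCoord e x v) (tangentCoord e x w) := by
  have key : ∀ v : TangentSpace 𝓘(ℝ, Plane) x,
      mfderiv 𝓘(ℝ, Plane) 𝓘(ℝ, Plane) e.symm (e x) (tangentCoord e x v) = v := fun v =>
    congrArg (fun L => L v) ((mdifferentiable_of_mem_maximalAtlas he).symm_comp_deriv hx)
  have hb : ∀ (x' : M) (_ : x' = x) (v w : Plane),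
      (b x' : Plane →L[ℝ] Plane →L[ℝ] ℝ) v w = (b x : Plane →L[ℝ] Plane →L[ℝ] ℝ) v w := by
    rintro _ rfl _ _
    rfl
  refine Eq.trans ?_ (hb _ (e.left_inv hx) _ _).symm
  have kv := key v
  have kw := key w
  exact congrArg₂ (fun v w : Plane => (b x : Plane →L[ℝ] Plane →L[ℝ] ℝ) v w) kv.symm kw.symm

theorem tangentCoord_J (he : e ∈ IsManifold.maximalAtlas 𝓘(ℝ, Plane) ∞ M) {x : M}
    (hx : x ∈ e.source) (w : TangentSpace 𝓘(ℝ, Plane) x) :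
    tangentCoord e x (X.J x w) = chartJ X e (e x) (tangentCoord e x w) := by
  have hy : e x ∈ e.target := e.map_source hx
  refine (isRiemannianOn_chartMetric X he).eq_of_forall hy fun v => ?_
  obtain ⟨v', rfl⟩ := tangentCoord_surjective he hx v
  rw [chartMetric_chartJ X he hy, ← form_eq_chartMetric _ he hx, ← form_eq_chartMetric _ he hx]
  rfl

theorem chartJ_sq (he : e ∈ IsManifold.maximalAtlas 𝓘(ℝ, Plane) ∞ M) {y : Plane}
    (hy : y ∈ e.target) (v : Plane) : chartJ X e y (chartJ X e y v) = -v := by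
  have hx : e.symm y ∈ e.source := e.map_target hy
  obtain ⟨v', rfl⟩ := tangentCoord_surjective he hx v
  have h1 := tangentCoord_J X he hx v'
  have h2 := tangentCoord_J X he hx (X.J _ v')
  rw [h1, X.J_sq, map_neg, e.right_inv hy] at h2
  exact h2.symm

theorem chartJ_isometry (he : e ∈ IsManifold.maximalAtlas 𝓘(ℝ, Plane) ∞ M) {y : Plane}
    (hy : y ∈ e.target) (v w : Plane) :
    chartMetric 𝓘(ℝ, Plane) X.metric.inner e y (chartJ X e y v) (chartJ X e y w)
      = chartMetric 𝓘(ℝ, Plane) X.metric.inner e y v w := by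
  have hx : e.symm y ∈ e.source := e.map_target hy
  obtain ⟨v', rfl⟩ := tangentCoord_surjective he hx v
  obtain ⟨w', rfl⟩ := tangentCoord_surjective he hx w
  have h1 := tangentCoord_J X he hx v'
  have h2 := tangentCoord_J X he hx w'
  have h3 := form_eq_chartMetric X.metric.inner he hx v' w'
  have h4 := form_eq_chartMetric X.metric.inner he hx (X.J _ v') (X.J _ w')
  rw [X.J_isometry, h1, h2, h3, e.right_inv hy] at h4
  exact h4.symm

/-- The coordinate expressions of a form in two charts. -/
theorem chartMetric_eventuallyEq
    (b : ∀ x : M, TangentSpace 𝓘(ℝ, Plane) x →L[ℝ] TangentSpace 𝓘(ℝ, Plane) x →L[ℝ] ℝ)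
    {e' : OpenPartialHomeomorph M Plane} (he : e ∈ IsManifold.maximalAtlas 𝓘(ℝ, Plane) ∞ M)
    (he' : e' ∈ IsManifold.maximalAtlas 𝓘(ℝ, Plane) ∞ M) {y : Plane} (hy : y ∈ e.target)
    (hy' : e.symm y ∈ e'.source) :
    chartMetric 𝓘(ℝ, Plane) b e y
      = pullbackForm (chartMetric 𝓘(ℝ, Plane) b e' ((e' ∘ e.symm) y))
          (fderiv ℝ (e' ∘ e.symm) y) := by
  ext u v
  have h1 : fderiv ℝ (e' ∘ e.symm) y = (mfderiv 𝓘(ℝ, Plane) 𝓘(ℝ, Plane) e' (e.symm y)).comp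
      (mfderiv 𝓘(ℝ, Plane) 𝓘(ℝ, Plane) e.symm y) := by
    rw [← mfderiv_eq_fderiv]
    exact mfderiv_comp y ((mdifferentiable_of_mem_maximalAtlas he').mdifferentiableAt hy')
      ((mdifferentiable_of_mem_maximalAtlas he).mdifferentiableAt_symm hy)
  rw [chartMetric_apply, form_eq_chartMetric b he' hy', h1]
  rfl

end Charts

/-! ### Constructing charts -/

/-- The inverse function theorem: a smooth map of the plane with injective differential at a point
is a diffeomorphism near this point. -/
theorem exists_localDiffeo {Θ : Plane → Plane} {O : Set Plane} (hO : IsOpen O)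
    (hΘ : ContDiffOn ℝ ∞ Θ O) {x : Plane} (hx : x ∈ O)
    (hinj : ∀ v, fderiv ℝ Θ x v = 0 → v = 0) :
    ∃ T : OpenPartialHomeomorph Plane Plane, x ∈ T.source ∧ T.source ⊆ O ∧ ⇑T = Θ ∧
      ContDiffOn ℝ ∞ T T.source ∧ ContDiffOn ℝ ∞ T.symm T.target := by
  have hat : ∀ z ∈ O, ContDiffAt ℝ ∞ Θ z := fun z hz => hΘ.contDiffAt (hO.mem_nhds hz)
  have hdet : (fderiv ℝ Θ x).det ≠ 0 := by
    intro h
    obtain ⟨v, hv, hv0⟩ := (Submodule.ne_bot_iff _).1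
      (LinearMap.bot_lt_ker_of_det_eq_zero (f := (fderiv ℝ Θ x : Plane →ₗ[ℝ] Plane)) h).ne'
    exact hv0 (hinj v hv)
  have hcont : ContinuousOn (fun z => (fderiv ℝ Θ z).det) O :=
    ContinuousLinearMap.continuous_det.comp_continuousOn
      (hΘ.continuousOn_fderiv_of_isOpen hO (by simp))
  set O' : Set Plane := O ∩ (fun z => (fderiv ℝ Θ z).det) ⁻¹' {0}ᶜ with hO'
  have hO'o : IsOpen O' := hcont.isOpen_inter_preimage hO isOpen_compl_singleton
  have hderiv : ∀ z ∈ O', ∃ A : Plane ≃L[ℝ] Plane, HasFDerivAt Θ (A : Plane →L[ℝ] Plane) z := by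
    rintro z ⟨hz, hz' : (fderiv ℝ Θ z).det ≠ 0⟩
    refine ⟨(fderiv ℝ Θ z).toContinuousLinearEquivOfDetNeZero hz', ?_⟩
    rw [ContinuousLinearMap.coe_toContinuousLinearEquivOfDetNeZero]
    exact ((hat z hz).differentiableAt (by simp)).hasFDerivAt
  obtain ⟨A, hA⟩ := hderiv x ⟨hx, hdet⟩
  let T₀ := (hat x hx).toOpenPartialHomeomorph Θ hA (by simp)
  have hT₀ : ⇑T₀ = Θ := rfl
  refine ⟨T₀.restrOpen O' hO'o, ?_, ?_, rfl, ?_, ?_⟩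
  · exact ⟨(hat x hx).mem_toOpenPartialHomeomorph_source hA (by simp), hx, hdet⟩
  · intro z hz
    exact hz.2.1
  · intro z hz
    exact (hat z hz.2.1).contDiffWithinAt
  · intro z hz
    have hz' := (T₀.restrOpen O' hO'o).map_target hz
    obtain ⟨B, hB⟩ := hderiv _ hz'.2
    exact ((T₀.restrOpen O' hO'o).contDiffAt_symm hz hB (hat _ hz'.2.1)).contDiffWithinAt

section Charts

variable {M : Type*} [TopologicalSpace M] [ChartedSpace Plane M] [IsManifold 𝓘(ℝ, Plane) ∞ M]
  {e : OpenPartialHomeomorph M Plane}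

theorem trans_mem_maximalAtlas (he : e ∈ IsManifold.maximalAtlas 𝓘(ℝ, Plane) ∞ M)
    {T : OpenPartialHomeomorph Plane Plane} (hT : ContDiffOn ℝ ∞ T T.source)
    (hT' : ContDiffOn ℝ ∞ T.symm T.target) :
    e.trans T ∈ IsManifold.maximalAtlas 𝓘(ℝ, Plane) ∞ M := by
  apply OpenPartialHomeomorph.mem_maximalAtlas_of_contMDiffOn
  · rw [OpenPartialHomeomorph.coe_trans]
    exact hT.contMDiffOn.comp ((contMDiffOn_of_mem_maximalAtlas he).mono
      (by rw [OpenPartialHomeomorph.trans_source]; exact Set.inter_subset_left))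
      (by intro q hq; rw [OpenPartialHomeomorph.trans_source] at hq; exact hq.2)
  · rw [OpenPartialHomeomorph.coe_trans_symm]
    exact (contMDiffOn_symm_of_mem_maximalAtlas he).comp (hT'.contMDiffOn.mono
      (by rw [OpenPartialHomeomorph.trans_target]; exact Set.inter_subset_left))
      (by intro q hq; rw [OpenPartialHomeomorph.trans_target] at hq; exact hq.2)

/-- Changing coordinates by a map with injective differential at a point. -/
theorem exists_chart_comp (he : e ∈ IsManifold.maximalAtlas 𝓘(ℝ, Plane) ∞ M)
    {Θ : Plane → Plane} {O : Set Plane} (hO : IsOpen O) (hΘ : ContDiffOn ℝ ∞ Θ O) {p : M}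
    (hp : p ∈ e.source) (hpO : e p ∈ O) (hinj : ∀ v, fderiv ℝ Θ (e p) v = 0 → v = 0) :
    ∃ e' ∈ IsManifold.maximalAtlas 𝓘(ℝ, Plane) ∞ M, p ∈ e'.source ∧ e'.source ⊆ e.source ∧
      (∀ q ∈ e'.source, e q ∈ O) ∧ ∀ q ∈ e'.source, e' q = Θ (e q) := by
  obtain ⟨T, hxT, hTO, hT, h1, h2⟩ := exists_localDiffeo hO hΘ hpO hinj
  refine ⟨e.trans T, trans_mem_maximalAtlas he h1 h2, ?_, ?_, ?_, ?_⟩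
  · simp [hp, hxT]
  · rw [OpenPartialHomeomorph.trans_source]; exact Set.inter_subset_left
  · intro q hq
    rw [OpenPartialHomeomorph.trans_source] at hq
    exact hTO hq.2
  · intro q hq
    simp [hT]

/-- The open square with center `x` and half side `δ`. -/
def square (x : Plane) (δ : ℝ) : Set Plane := {z | ∀ i, z i ∈ Set.Ioo (x i - δ) (x i + δ)}

theorem isOpen_square (x : Plane) (δ : ℝ) : IsOpen (square x δ) := by
  have : square x δ = ⋂ i : Fin 2, (fun z : Plane => z i) ⁻¹' Set.Ioo (x i - δ) (x i + δ) := by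
    ext z; simp [square]
  rw [this]
  exact isOpen_iInter_of_finite fun i => isOpen_Ioo.preimage (by fun_prop)

theorem mem_square_self (x : Plane) {δ : ℝ} (hδ : 0 < δ) : x ∈ square x δ := fun i =>
  ⟨by linarith, by linarith⟩

theorem exists_square_subset {x : Plane} {O : Set Plane} (hO : O ∈ nhds x) :
    ∃ δ > 0, square x δ ⊆ O := by
  have h : (fun f : Fin 2 → ℝ => (WithLp.toLp 2 f : Plane)) ⁻¹' O ∈ nhds (x : Fin 2 → ℝ) := by
    have hc : Continuous (fun f : Fin 2 → ℝ => (WithLp.toLp 2 f : Plane)) := by fun_prop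
    exact hc.continuousAt.preimage_mem_nhds (by simpa using hO)
  obtain ⟨δ, hδ, hb⟩ := Metric.mem_nhds_iff.1 h
  refine ⟨δ, hδ, fun z hz => ?_⟩
  have : (z : Fin 2 → ℝ) ∈ Metric.ball (x : Fin 2 → ℝ) δ := by
    rw [Metric.mem_ball, dist_pi_lt_iff hδ]
    intro i
    rw [Real.dist_eq, abs_lt]
    have := hz i
    constructor <;> linarith [this.1, this.2]
  exact hb this

/-- A chart may be restricted to a small square. -/
theorem exists_chart_square (he : e ∈ IsManifold.maximalAtlas 𝓘(ℝ, Plane) ∞ M) {p : M}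
    (hp : p ∈ e.source) {N : Set M} (hN : N ∈ nhds p) :
    ∃ e' ∈ IsManifold.maximalAtlas 𝓘(ℝ, Plane) ∞ M, p ∈ e'.source ∧ e'.source ⊆ e.source ∩ N ∧
      ⇑e' = e ∧ ∃ δ > 0, e'.target = square (e p) δ := by
  have h1 : e.target ∩ e.symm ⁻¹' N ∈ nhds (e p) := by
    refine Filter.inter_mem (e.open_target.mem_nhds (e.map_source hp)) ?_
    exact (e.continuousAt_symm (e.map_source hp)).preimage_mem_nhds (by rwa [e.left_inv hp])
  obtain ⟨δ, hδ, hsub⟩ := exists_square_subset h1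
  let R : OpenPartialHomeomorph Plane Plane :=
    OpenPartialHomeomorph.ofSet (square (e p) δ) (isOpen_square _ _)
  refine ⟨e.trans R, trans_mem_maximalAtlas he ?_ ?_, ?_, ?_, ?_, δ, hδ, ?_⟩
  · exact contDiffOn_id
  · exact contDiffOn_id
  · simpa [R, hp] using mem_square_self (e p) hδ
  · intro q hq
    have hq' : q ∈ e.source ∧ e q ∈ square (e p) δ := by simpa [R] using hq
    refine ⟨hq'.1, ?_⟩
    have := (hsub hq'.2).2
    rwa [Set.mem_preimage, e.left_inv hq'.1] at this
  · ext q; simp [R]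
  · ext z
    simp only [R, OpenPartialHomeomorph.trans_target, OpenPartialHomeomorph.ofSet_target,
      OpenPartialHomeomorph.ofSet_symm, OpenPartialHomeomorph.ofSet_apply, Set.mem_inter_iff,
      Set.mem_preimage, id]
    exact ⟨fun h => h.1, fun h => ⟨h, (hsub h).1⟩⟩

/-- The Kähler form in coordinates is the area form, up to sign. -/
theorem chartKahler_apply (X : OrientedRiemannianSurface M)
    (he : e ∈ IsManifold.maximalAtlas 𝓘(ℝ, Plane) ∞ M) {y : Plane} (hy : y ∈ e.target)
    (u v : Plane) : chartMetric 𝓘(ℝ, Plane) X.kahlerForm e y u v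
      = (u 0 * v 1 - u 1 * v 0) * chartMetric 𝓘(ℝ, Plane) X.kahlerForm e y (bas 0) (bas 1) := by
  have hG := isRiemannianOn_chartMetric X he
  have halt : ∀ u, chartMetric 𝓘(ℝ, Plane) X.kahlerForm e y u u = 0 := by
    intro u
    have h1 := chartJ_isometry X he hy (chartJ X e y u) u
    rw [chartJ_sq X he hy, map_neg, neg_apply, hG.symm y hy] at h1
    rw [← chartMetric_chartJ X he hy]
    linarith
  have h10 : chartMetric 𝓘(ℝ, Plane) X.kahlerForm e y (bas 1) (bas 0)
      = - chartMetric 𝓘(ℝ, Plane) X.kahlerForm e y (bas 0) (bas 1) := by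
    have := halt (bas 0 + bas 1)
    simp only [map_add, add_apply, halt] at this
    linarith
  rw [bilin_expand_left, bilin_expand_right _ (bas 0), bilin_expand_right _ (bas 1), halt, halt,
    h10]
  ring

theorem chartKahler_sq (X : OrientedRiemannianSurface M)
    (he : e ∈ IsManifold.maximalAtlas 𝓘(ℝ, Plane) ∞ M) {y : Plane} (hy : y ∈ e.target) :
    chartMetric 𝓘(ℝ, Plane) X.kahlerForm e y (bas 0) (bas 1) ^ 2
      = chartMetric 𝓘(ℝ, Plane) X.metric.inner e y (bas 0) (bas 0)
          * chartMetric 𝓘(ℝ, Plane) X.metric.inner e y (bas 1) (bas 1)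
        - chartMetric 𝓘(ℝ, Plane) X.metric.inner e y (bas 0) (bas 1) ^ 2 := by
  have hG := isRiemannianOn_chartMetric X he
  have ha := hG.pos y hy (bas 0) (by simp)
  have h0 := chartMetric_chartJ X he hy (bas 0) (bas 0)
  have h1 := chartMetric_chartJ X he hy (bas 0) (bas 1)
  have h2 := chartJ_isometry X he hy (bas 0) (bas 0)
  have h3 := chartKahler_apply X he hy (bas 0) (bas 0)
  rw [bilin_expand_left _ (chartJ X e y (bas 0)),
    bilin_expand_right _ (bas 0) (chartJ X e y (bas 0)),
    bilin_expand_right _ (bas 1) (chartJ X e y (bas 0))] at h2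
  rw [bilin_expand_left] at h0 h1
  rw [hG.symm y hy (bas 1) (bas 0)] at h0 h2
  rw [h3] at h0
  simp at h0
  generalize chartMetric 𝓘(ℝ, Plane) X.kahlerForm e y (bas 0) (bas 1) = w at *
  generalize chartMetric 𝓘(ℝ, Plane) X.metric.inner e y (bas 0) (bas 0) = a at *
  generalize chartMetric 𝓘(ℝ, Plane) X.metric.inner e y (bas 0) (bas 1) = b at *
  generalize chartMetric 𝓘(ℝ, Plane) X.metric.inner e y (bas 1) (bas 1) = c at *
  generalize chartJ X e y (bas 0) 0 = α at *
  generalize chartJ X e y (bas 0) 1 = β at *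
  apply mul_left_cancel₀ ha.ne'
  linear_combination -w * (a * h1 - b * h0) + (a * c - b ^ 2) * (h2 - α * h0 - β * h1)

end Charts

/-! ### Immersions into products in charts -/

section Products

variable {M₁ M₂ S : Type*} [TopologicalSpace M₁] [ChartedSpace Plane M₁]
  [IsManifold 𝓘(ℝ, Plane) ∞ M₁] [TopologicalSpace M₂] [ChartedSpace Plane M₂]
  [IsManifold 𝓘(ℝ, Plane) ∞ M₂] [TopologicalSpace S] [ChartedSpace Plane S]
  [IsManifold 𝓘(ℝ, Plane) ∞ S]
  {X₁ : OrientedRiemannianSurface M₁} {X₂ : OrientedRiemannianSurface M₂}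
  {e : OpenPartialHomeomorph S Plane} {e₁ : OpenPartialHomeomorph M₁ Plane}
  {e₂ : OpenPartialHomeomorph M₂ Plane} {Φ : S → M₁ × M₂}

/-- The open set on which `Φ` is expressed in the charts `e`, `e₁` and `e₂`. -/
def coordDomain (Φ : S → M₁ × M₂) (e : OpenPartialHomeomorph S Plane)
    (e₁ : OpenPartialHomeomorph M₁ Plane) (e₂ : OpenPartialHomeomorph M₂ Plane) : Set Plane :=
  e.target ∩ e.symm ⁻¹' (Φ ⁻¹' (e₁.source ×ˢ e₂.source))

/-- The coordinate expression of a map between surfaces. -/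
def coordRep {M : Type*} [TopologicalSpace M] (φ : S → M) (e : OpenPartialHomeomorph S Plane)
    (e₁ : OpenPartialHomeomorph M Plane) : Plane → Plane := e₁ ∘ φ ∘ e.symm

theorem localRep_prod (Φ : S → M₁ × M₂) (e : OpenPartialHomeomorph S Plane)
    (e₁ : OpenPartialHomeomorph M₁ Plane) (e₂ : OpenPartialHomeomorph M₂ Plane) (x : Plane) :
    localRep (𝓘(ℝ, Plane).prod 𝓘(ℝ, Plane)) Φ e (e₁.prod e₂) x
      = (coordRep (fun q => (Φ q).1) e e₁ x, coordRep (fun q => (Φ q).2) e e₂ x) := rfl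

theorem isOpen_coordDomain (hΦ : Continuous Φ) : IsOpen (coordDomain Φ e e₁ e₂) :=
  e.symm.isOpen_inter_preimage ((e₁.open_source.prod e₂.open_source).preimage hΦ)

section OneFactor

variable {φ : S → M₁} (hφ : ContMDiff 𝓘(ℝ, Plane) 𝓘(ℝ, Plane) ∞ φ)
  (he : e ∈ IsManifold.maximalAtlas 𝓘(ℝ, Plane) ∞ S)
  (he₁ : e₁ ∈ IsManifold.maximalAtlas 𝓘(ℝ, Plane) ∞ M₁)

include hφ he he₁

theorem contDiffAt_coordRep {x : Plane} (hx : x ∈ e.target) (hx₁ : φ (e.symm x) ∈ e₁.source) :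
    ContDiffAt ℝ ∞ (coordRep φ e e₁) x := by
  rw [← contMDiffAt_iff_contDiffAt]
  exact (contMDiffAt_of_mem_maximalAtlas he₁ hx₁).comp x
    (hφ.contMDiffAt.comp x (contMDiffAt_symm_of_mem_maximalAtlas he hx))

theorem fderiv_coordRep {x : Plane} (hx : x ∈ e.target) (hx₁ : φ (e.symm x) ∈ e₁.source)
    (v : Plane) : fderiv ℝ (coordRep φ e e₁) x v
      = tangentCoord e₁ _ (mfderiv 𝓘(ℝ, Plane) 𝓘(ℝ, Plane) φ (e.symm x)
          (mfderiv 𝓘(ℝ, Plane) 𝓘(ℝ, Plane) e.symm x v)) := by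
  have h1 := (contMDiffAt_of_mem_maximalAtlas he₁ hx₁).mdifferentiableAt (by simp)
  have h2 := hφ.mdifferentiableAt (x := e.symm x) (by simp)
  have h3 := (contMDiffAt_symm_of_mem_maximalAtlas he hx).mdifferentiableAt (by simp)
  rw [← mfderiv_eq_fderiv]
  exact congrArg (fun L => L v) ((mfderiv_comp x h1 (h2.comp x h3)).trans
    (congrArg _ (mfderiv_comp x h2 h3)))

theorem chartMetric_coordRep
    (b : ∀ x : M₁, TangentSpace 𝓘(ℝ, Plane) x →L[ℝ] TangentSpace 𝓘(ℝ, Plane) x →L[ℝ] ℝ)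
    {x : Plane} (hx : x ∈ e.target) (hx₁ : φ (e.symm x) ∈ e₁.source) (v w : Plane) :
    chartMetric 𝓘(ℝ, Plane) b e₁ (coordRep φ e e₁ x) (fderiv ℝ (coordRep φ e e₁) x v)
        (fderiv ℝ (coordRep φ e e₁) x w)
      = b (φ (e.symm x)) (mfderiv 𝓘(ℝ, Plane) 𝓘(ℝ, Plane) φ (e.symm x)
          (mfderiv 𝓘(ℝ, Plane) 𝓘(ℝ, Plane) e.symm x v))
        (mfderiv 𝓘(ℝ, Plane) 𝓘(ℝ, Plane) φ (e.symm x)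
          (mfderiv 𝓘(ℝ, Plane) 𝓘(ℝ, Plane) e.symm x w)) := by
  rw [form_eq_chartMetric b he₁ hx₁, fderiv_coordRep hφ he he₁ hx hx₁,
    fderiv_coordRep hφ he he₁ hx hx₁]
  rfl

end OneFactor

theorem mfderiv_fst_comp (hΦ : ContMDiff 𝓘(ℝ, Plane) (𝓘(ℝ, Plane).prod 𝓘(ℝ, Plane)) ∞ Φ) (p : S)
    (v : TangentSpace 𝓘(ℝ, Plane) p) :
    mfderiv 𝓘(ℝ, Plane) 𝓘(ℝ, Plane) (fun q => (Φ q).1) p v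
      = mfderiv (𝓘(ℝ, Plane).prod 𝓘(ℝ, Plane)) 𝓘(ℝ, Plane) Prod.fst (Φ p)
        (mfderiv 𝓘(ℝ, Plane) (𝓘(ℝ, Plane).prod 𝓘(ℝ, Plane)) Φ p v) :=
  congrArg (fun L => L v) (mfderiv_comp p (g := Prod.fst) (f := Φ) mdifferentiableAt_fst
    (hΦ.mdifferentiableAt (by simp)))

theorem mfderiv_snd_comp (hΦ : ContMDiff 𝓘(ℝ, Plane) (𝓘(ℝ, Plane).prod 𝓘(ℝ, Plane)) ∞ Φ) (p : S)
    (v : TangentSpace 𝓘(ℝ, Plane) p) :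
    mfderiv 𝓘(ℝ, Plane) 𝓘(ℝ, Plane) (fun q => (Φ q).2) p v
      = mfderiv (𝓘(ℝ, Plane).prod 𝓘(ℝ, Plane)) 𝓘(ℝ, Plane) Prod.snd (Φ p)
        (mfderiv 𝓘(ℝ, Plane) (𝓘(ℝ, Plane).prod 𝓘(ℝ, Plane)) Φ p v) :=
  congrArg (fun L => L v) (mfderiv_comp p (g := Prod.snd) (f := Φ) mdifferentiableAt_snd
    (hΦ.mdifferentiableAt (by simp)))

theorem contMDiff_fst_comp (hΦ : ContMDiff 𝓘(ℝ, Plane) (𝓘(ℝ, Plane).prod 𝓘(ℝ, Plane)) ∞ Φ) :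
    ContMDiff 𝓘(ℝ, Plane) 𝓘(ℝ, Plane) ∞ (fun q => (Φ q).1) := contMDiff_fst.comp hΦ

theorem contMDiff_snd_comp (hΦ : ContMDiff 𝓘(ℝ, Plane) (𝓘(ℝ, Plane).prod 𝓘(ℝ, Plane)) ∞ Φ) :
    ContMDiff 𝓘(ℝ, Plane) 𝓘(ℝ, Plane) ∞ (fun q => (Φ q).2) := contMDiff_snd.comp hΦ

section Coordinates

variable (hΦ : IsLagrangianImmersion X₁ X₂ Φ)
  (he : e ∈ IsManifold.maximalAtlas 𝓘(ℝ, Plane) ∞ S)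
  (he₁ : e₁ ∈ IsManifold.maximalAtlas 𝓘(ℝ, Plane) ∞ M₁)
  (he₂ : e₂ ∈ IsManifold.maximalAtlas 𝓘(ℝ, Plane) ∞ M₂)

include hΦ he he₁ he₂

theorem coord_immersion {x : Plane} (hx : x ∈ coordDomain Φ e e₁ e₂) {v : Plane}
    (h₁ : fderiv ℝ (coordRep (fun q => (Φ q).1) e e₁) x v = 0)
    (h₂ : fderiv ℝ (coordRep (fun q => (Φ q).2) e e₂) x v = 0) : v = 0 := by
  rw [fderiv_coordRep (contMDiff_fst_comp hΦ.smooth) he he₁ hx.1 hx.2.1] at h₁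
  rw [fderiv_coordRep (contMDiff_snd_comp hΦ.smooth) he he₂ hx.1 hx.2.2] at h₂
  have k₁ := (mdifferentiable_of_mem_maximalAtlas he₁).mfderiv_injective hx.2.1
    (h₁.trans (map_zero _).symm)
  have k₂ := (mdifferentiable_of_mem_maximalAtlas he₂).mfderiv_injective hx.2.2
    (h₂.trans (map_zero _).symm)
  rw [mfderiv_fst_comp hΦ.smooth, mfderiv_fst] at k₁
  rw [mfderiv_snd_comp hΦ.smooth, mfderiv_snd] at k₂
  have k := hΦ.injective (e.symm x) ((Prod.ext k₁ k₂ : _ = (0 : Plane × Plane)).trans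
    (map_zero (mfderiv 𝓘(ℝ, Plane) (𝓘(ℝ, Plane).prod 𝓘(ℝ, Plane)) Φ (e.symm x))).symm)
  exact (mdifferentiable_of_mem_maximalAtlas he).symm.mfderiv_injective hx.1
    (k.trans (map_zero _).symm)

theorem coord_lagrangian {x : Plane} (hx : x ∈ coordDomain Φ e e₁ e₂) (v w : Plane) :
    chartMetric 𝓘(ℝ, Plane) X₁.kahlerForm e₁ (coordRep (fun q => (Φ q).1) e e₁ x)
        (fderiv ℝ (coordRep (fun q => (Φ q).1) e e₁) x v)
        (fderiv ℝ (coordRep (fun q => (Φ q).1) e e₁) x w)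
      + chartMetric 𝓘(ℝ, Plane) X₂.kahlerForm e₂ (coordRep (fun q => (Φ q).2) e e₂ x)
        (fderiv ℝ (coordRep (fun q => (Φ q).2) e e₂) x v)
        (fderiv ℝ (coordRep (fun q => (Φ q).2) e e₂) x w) = 0 := by
  rw [chartMetric_coordRep (contMDiff_fst_comp hΦ.smooth) he he₁ _ hx.1 hx.2.1,
    chartMetric_coordRep (contMDiff_snd_comp hΦ.smooth) he he₂ _ hx.1 hx.2.2,
    mfderiv_fst_comp hΦ.smooth, mfderiv_snd_comp hΦ.smooth, mfderiv_fst_comp hΦ.smooth,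
    mfderiv_snd_comp hΦ.smooth]
  exact hΦ.lagrangian (e.symm x) _ _

end Coordinates

theorem chartMetric_prodMetric (he₁ : e₁ ∈ IsManifold.maximalAtlas 𝓘(ℝ, Plane) ∞ M₁)
    (he₂ : e₂ ∈ IsManifold.maximalAtlas 𝓘(ℝ, Plane) ∞ M₂) {q : Plane × Plane}
    (hq : q ∈ e₁.target ×ˢ e₂.target) :
    chartMetric (𝓘(ℝ, Plane).prod 𝓘(ℝ, Plane)) (prodMetric X₁ X₂) (e₁.prod e₂) q
      = blockMetric (chartMetric 𝓘(ℝ, Plane) X₁.metric.inner e₁)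
          (chartMetric 𝓘(ℝ, Plane) X₂.metric.inner e₂) q := by
  have hsymm : MDifferentiableAt 𝓘(ℝ, Plane × Plane) (𝓘(ℝ, Plane).prod 𝓘(ℝ, Plane))
      ((e₁.prod e₂).extend (𝓘(ℝ, Plane).prod 𝓘(ℝ, Plane))).symm q := by
    have h := contMDiffOn_extend_symm (IsManifold.mem_maximalAtlas_prod he₁ he₂)
    refine (h.contMDiffAt ?_).mdifferentiableAt (by simp)
    have himage : (𝓘(ℝ, Plane).prod 𝓘(ℝ, Plane)) '' (e₁.prod e₂).target
        = e₁.target ×ˢ e₂.target := by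
      ext z
      exact ⟨fun ⟨z', hz', h⟩ => h ▸ hz', fun hz => ⟨z, hz, rfl⟩⟩
    rw [himage]
    exact (e₁.open_target.prod e₂.open_target).mem_nhds hq
  have h₁ : (mfderiv (𝓘(ℝ, Plane).prod 𝓘(ℝ, Plane)) 𝓘(ℝ, Plane) Prod.fst
        (((e₁.prod e₂).extend (𝓘(ℝ, Plane).prod 𝓘(ℝ, Plane))).symm q)).comp
      (mfderiv 𝓘(ℝ, Plane × Plane) (𝓘(ℝ, Plane).prod 𝓘(ℝ, Plane))
        ((e₁.prod e₂).extend (𝓘(ℝ, Plane).prod 𝓘(ℝ, Plane))).symm q)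
      = (mfderiv 𝓘(ℝ, Plane) 𝓘(ℝ, Plane) e₁.symm q.1).comp
        (ContinuousLinearMap.fst ℝ Plane Plane) := by
    have hf : MDifferentiableAt 𝓘(ℝ, Plane × Plane) 𝓘(ℝ, Plane)
      (Prod.fst : Plane × Plane → Plane) q := differentiableAt_fst.mdifferentiableAt
    refine (mfderiv_comp q (g := Prod.fst) mdifferentiableAt_fst hsymm).symm.trans ?_
    refine (mfderiv_comp q (g := e₁.symm) (f := Prod.fst)
      ((mdifferentiable_of_mem_maximalAtlas he₁).mdifferentiableAt_symm hq.1) hf).trans ?_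
    rw [mfderiv_eq_fderiv, fderiv_fst]
    rfl
  have h₂ : (mfderiv (𝓘(ℝ, Plane).prod 𝓘(ℝ, Plane)) 𝓘(ℝ, Plane) Prod.snd
        (((e₁.prod e₂).extend (𝓘(ℝ, Plane).prod 𝓘(ℝ, Plane))).symm q)).comp
      (mfderiv 𝓘(ℝ, Plane × Plane) (𝓘(ℝ, Plane).prod 𝓘(ℝ, Plane))
        ((e₁.prod e₂).extend (𝓘(ℝ, Plane).prod 𝓘(ℝ, Plane))).symm q)
      = (mfderiv 𝓘(ℝ, Plane) 𝓘(ℝ, Plane) e₂.symm q.2).comp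
        (ContinuousLinearMap.snd ℝ Plane Plane) := by
    have hf : MDifferentiableAt 𝓘(ℝ, Plane × Plane) 𝓘(ℝ, Plane)
      (Prod.snd : Plane × Plane → Plane) q := differentiableAt_snd.mdifferentiableAt
    refine (mfderiv_comp q (g := Prod.snd) mdifferentiableAt_snd hsymm).symm.trans ?_
    refine (mfderiv_comp q (g := e₂.symm) (f := Prod.snd)
      ((mdifferentiable_of_mem_maximalAtlas he₂).mdifferentiableAt_symm hq.2) hf).trans ?_
    rw [mfderiv_eq_fderiv, fderiv_snd]
    rfl
  refine ContinuousLinearMap.ext fun v => ContinuousLinearMap.ext fun w => ?_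
  rw [blockMetric_apply, chartMetric_apply, chartMetric_apply]
  have a₁ := fun v => congrArg (fun L => L v) h₁
  have a₂ := fun v => congrArg (fun L => L v) h₂
  have b₁ := congrArg₂ (fun v w : Plane => (X₁.metric.inner (e₁.symm q.1) :
    Plane →L[ℝ] Plane →L[ℝ] ℝ) v w) (a₁ v) (a₁ w)
  have b₂ := congrArg₂ (fun v w : Plane => (X₂.metric.inner (e₂.symm q.2) :
    Plane →L[ℝ] Plane →L[ℝ] ℝ) v w) (a₂ v) (a₂ w)
  exact congrArg₂ (· + ·) b₁ b₂

theorem IsMinimal.hasParallelMeanCurvature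
    (hΦ : Continuous Φ)
    (h : IsMinimal (𝓘(ℝ, Plane).prod 𝓘(ℝ, Plane)) (prodMetric X₁ X₂) Φ) :
    HasParallelMeanCurvature (𝓘(ℝ, Plane).prod 𝓘(ℝ, Plane)) (prodMetric X₁ X₂) Φ := by
  intro e he e' he' x hx hx' u n hn
  have hev : meanCurvature (chartMetric (𝓘(ℝ, Plane).prod 𝓘(ℝ, Plane)) (prodMetric X₁ X₂) e')
      (localRep (𝓘(ℝ, Plane).prod 𝓘(ℝ, Plane)) Φ e e') =ᶠ[nhds x] fun _ => 0 := by
    have ho : IsOpen (e.target ∩ e.symm ⁻¹' (Φ ⁻¹' e'.source)) :=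
      e.symm.isOpen_inter_preimage (e'.open_source.preimage hΦ)
    filter_upwards [ho.mem_nhds ⟨hx, hx'⟩] with z hz
    exact h e he e' he' z hz.1 hz.2
  have h0 : covDerivAlong (chartMetric (𝓘(ℝ, Plane).prod 𝓘(ℝ, Plane)) (prodMetric X₁ X₂) e')
      (localRep (𝓘(ℝ, Plane).prod 𝓘(ℝ, Plane)) Φ e e')
      (meanCurvature (chartMetric (𝓘(ℝ, Plane).prod 𝓘(ℝ, Plane)) (prodMetric X₁ X₂) e')
      (localRep (𝓘(ℝ, Plane).prod 𝓘(ℝ, Plane)) Φ e e')) x u = 0 := by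
    rw [covDerivAlong, hev.fderiv_eq, hev.self_of_nhds, christoffel_zero_right]
    simp
  rw [h0]
  simp

end Products

/-! ### Vanishing of both Kähler forms -/

section Products

variable {M₁ M₂ S : Type*} [TopologicalSpace M₁] [ChartedSpace Plane M₁]
  [IsManifold 𝓘(ℝ, Plane) ∞ M₁] [TopologicalSpace M₂] [ChartedSpace Plane M₂]
  [IsManifold 𝓘(ℝ, Plane) ∞ M₂] [TopologicalSpace S] [ChartedSpace Plane S]
  [IsManifold 𝓘(ℝ, Plane) ∞ S]
  {X₁ : OrientedRiemannianSurface M₁} {X₂ : OrientedRiemannianSurface M₂}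
  {e : OpenPartialHomeomorph S Plane} {e₁ : OpenPartialHomeomorph M₁ Plane}
  {e₂ : OpenPartialHomeomorph M₂ Plane} {Φ : S → M₁ × M₂}

/-- A linear map is injective if it pulls back an area form to a nonzero form. -/
theorem eq_zero_of_pullback_ne_zero {X : OrientedRiemannianSurface M₁}
    (he₁ : e₁ ∈ IsManifold.maximalAtlas 𝓘(ℝ, Plane) ∞ M₁) {y : Plane} (hy : y ∈ e₁.target)
    {L : Plane →L[ℝ] Plane} {v w : Plane}
    (h : chartMetric 𝓘(ℝ, Plane) X.kahlerForm e₁ y (L v) (L w) ≠ 0) {u : Plane} (hu : L u = 0) :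
    u = 0 := by
  set B : Plane →L[ℝ] Plane →L[ℝ] ℝ :=
    (chartMetric 𝓘(ℝ, Plane) X.kahlerForm e₁ y).bilinearComp L L with hB
  have hBap : ∀ a b, B a b = chartMetric 𝓘(ℝ, Plane) X.kahlerForm e₁ y (L a) (L b) := fun a b =>
    rfl
  have halt : ∀ a, B a a = 0 := fun a => by
    rw [hBap, chartKahler_apply X he₁ hy]; ring
  have h10 : B (bas 1) (bas 0) = - B (bas 0) (bas 1) := by
    have := halt (bas 0 + bas 1)
    simp only [map_add, add_apply, halt] at this
    linarith
  have hexp : ∀ a b : Plane, B a b = (a 0 * b 1 - a 1 * b 0) * B (bas 0) (bas 1) := by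
    intro a b
    rw [bilin_expand_left, bilin_expand_right _ (bas 0), bilin_expand_right _ (bas 1), halt, halt,
      h10]
    ring
  have hne : B (bas 0) (bas 1) ≠ 0 := by
    intro h0
    exact h (by rw [← hBap, hexp, h0, mul_zero])
  have hu' : ∀ b, B u b = 0 := fun b => by rw [hBap, hu]; simp
  ext i
  fin_cases i
  · have := hu' (bas 1)
    rw [hexp] at this
    simpa [hne] using this
  · have := hu' (bas 0)
    rw [hexp] at this
    simpa [hne] using this

/-- The coordinates on the target of a local diffeomorphism in which it is the identity. -/
theorem exists_chart_straightening
    {φ : S → M₁} (hφ : ContMDiff 𝓘(ℝ, Plane) 𝓘(ℝ, Plane) ∞ φ)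
    (he : e ∈ IsManifold.maximalAtlas 𝓘(ℝ, Plane) ∞ S)
    (he₁ : e₁ ∈ IsManifold.maximalAtlas 𝓘(ℝ, Plane) ∞ M₁) {x : Plane} (hx : x ∈ e.target)
    (hx₁ : φ (e.symm x) ∈ e₁.source)
    (hinj : ∀ u, fderiv ℝ (coordRep φ e e₁) x u = 0 → u = 0) :
    ∃ e' ∈ IsManifold.maximalAtlas 𝓘(ℝ, Plane) ∞ M₁, ∃ V : Set Plane, IsOpen V ∧ x ∈ V ∧
      V ⊆ e.target ∧ ∀ z ∈ V, φ (e.symm z) ∈ e'.source ∧ coordRep φ e e' z = z := by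
  set O : Set Plane := e.target ∩ e.symm ⁻¹' (φ ⁻¹' e₁.source) with hO
  have hOo : IsOpen O := e.symm.isOpen_inter_preimage (e₁.open_source.preimage hφ.continuous)
  obtain ⟨T, hxT, hTO, hT, h1, h2⟩ := exists_localDiffeo (Θ := coordRep φ e e₁) hOo
    (fun z hz => (contDiffAt_coordRep hφ he he₁ hz.1 hz.2).contDiffWithinAt)
    (⟨hx, hx₁⟩ : x ∈ O) hinj
  refine ⟨e₁.trans T.symm, trans_mem_maximalAtlas he₁ h2 (by simpa using h1), T.source,
    T.open_source, hxT, fun z hz => (hTO hz).1, fun z hz => ?_⟩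
  have hz1 : e₁ (φ (e.symm z)) = T z := by rw [hT]; rfl
  constructor
  · rw [OpenPartialHomeomorph.trans_source]
    refine ⟨(hTO hz).2, ?_⟩
    rw [Set.mem_preimage, hz1]
    exact T.map_source hz
  · change T.symm (e₁ (φ (e.symm z))) = z
    rw [hz1, T.left_inv hz]

/-- A Lagrangian immersion with parallel mean curvature vector into a product of two surfaces of
different constant curvatures is Lagrangian for each of the two Kähler forms. -/
theorem kahler_pullback_eq_zero {c₁ c₂ : ℝ}
    (h₁ : HasConstantCurvature 𝓘(ℝ, Plane) X₁.metric.inner c₁)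
    (h₂ : HasConstantCurvature 𝓘(ℝ, Plane) X₂.metric.inner c₂)
    (hc : c₁ ≠ c₂) (hΦ : IsLagrangianImmersion X₁ X₂ Φ)
    (hpar : HasParallelMeanCurvature (𝓘(ℝ, Plane).prod 𝓘(ℝ, Plane)) (prodMetric X₁ X₂) Φ)
    (he : e ∈ IsManifold.maximalAtlas 𝓘(ℝ, Plane) ∞ S)
    (he₁ : e₁ ∈ IsManifold.maximalAtlas 𝓘(ℝ, Plane) ∞ M₁)
    (he₂ : e₂ ∈ IsManifold.maximalAtlas 𝓘(ℝ, Plane) ∞ M₂) {x : Plane}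
    (hx : x ∈ coordDomain Φ e e₁ e₂) (v w : Plane) :
    chartMetric 𝓘(ℝ, Plane) X₁.kahlerForm e₁ (coordRep (fun q => (Φ q).1) e e₁ x)
        (fderiv ℝ (coordRep (fun q => (Φ q).1) e e₁) x v)
        (fderiv ℝ (coordRep (fun q => (Φ q).1) e e₁) x w) = 0 := by
  by_contra hne
  have hlag := coord_lagrangian hΦ he he₁ he₂ hx v w
  -- otherwise both components of `Φ` are local diffeomorphisms, and `Φ` is the diagonal in suitable
  -- charts
  obtain ⟨e₁', he₁', V₁, hV₁, hxV₁, hV₁e, hV₁'⟩ := exists_chart_straightening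
    (contMDiff_fst_comp hΦ.smooth) he he₁ hx.1 hx.2.1
    fun u hu => eq_zero_of_pullback_ne_zero he₁ (e₁.map_source hx.2.1) hne hu
  obtain ⟨e₂', he₂', V₂, hV₂, hxV₂, hV₂e, hV₂'⟩ := exists_chart_straightening
    (contMDiff_snd_comp hΦ.smooth) he he₂ hx.1 hx.2.2
    fun u hu => eq_zero_of_pullback_ne_zero he₂ (e₂.map_source hx.2.2)
      (fun h0 => hne (by rw [← hlag]; exact ((add_eq_left).2 h0).symm)) hu
  have hUo : IsOpen (V₁ ∩ V₂) := hV₁.inter hV₂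
  have hdom : ∀ z ∈ V₁ ∩ V₂, z ∈ coordDomain Φ e e₁' e₂' := fun z hz =>
    ⟨hV₁e hz.1, (hV₁' z hz.1).1, (hV₂' z hz.2).1⟩
  have ht₁ : V₁ ∩ V₂ ⊆ e₁'.target := fun z hz => by
    rw [← (hV₁' z hz.1).2]; exact e₁'.map_source (hV₁' z hz.1).1
  have ht₂ : V₁ ∩ V₂ ⊆ e₂'.target := fun z hz => by
    rw [← (hV₂' z hz.2).2]; exact e₂'.map_source (hV₂' z hz.2).1
  have hid₁ : ∀ z ∈ V₁ ∩ V₂, ∀ u, fderiv ℝ (coordRep (fun q => (Φ q).1) e e₁') z u = u := by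
    intro z hz u
    have : coordRep (fun q => (Φ q).1) e e₁' =ᶠ[nhds z] id := by
      filter_upwards [hUo.mem_nhds hz] with z' hz' using (hV₁' z' hz'.1).2
    rw [this.fderiv_eq, fderiv_id]
    rfl
  have hid₂ : ∀ z ∈ V₁ ∩ V₂, ∀ u, fderiv ℝ (coordRep (fun q => (Φ q).2) e e₂') z u = u := by
    intro z hz u
    have : coordRep (fun q => (Φ q).2) e e₂' =ᶠ[nhds z] id := by
      filter_upwards [hUo.mem_nhds hz] with z' hz' using (hV₂' z' hz'.2).2
    rw [this.fderiv_eq, fderiv_id]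
    rfl
  have hxU : x ∈ V₁ ∩ V₂ := ⟨hxV₁, hxV₂⟩
  refine hc (curvature_eq_of_parallel_diagonal (U := V₁ ∩ V₂)
    ((isRiemannianOn_chartMetric X₁ he₁').mono hUo ht₁)
    ((isRiemannianOn_chartMetric X₂ he₂').mono hUo ht₂)
    (GG := chartMetric (𝓘(ℝ, Plane).prod 𝓘(ℝ, Plane)) (prodMetric X₁ X₂) (e₁'.prod e₂'))
    (fun q hq => chartMetric_prodMetric he₁' he₂' ⟨ht₁ hq.1, ht₂ hq.2⟩)
    (F := localRep (𝓘(ℝ, Plane).prod 𝓘(ℝ, Plane)) Φ e (e₁'.prod e₂'))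
    (fun z hz => by rw [localRep_prod, (hV₁' z hz.1).2, (hV₂' z hz.2).2])
    ?_ hxU (h₁ e₁' he₁' x ?_) (h₂ e₂' he₂' x ?_) ?_)
  -- the Gram determinants agree because the Kähler forms are opposite to each other
  · intro z hz
    rw [← chartKahler_sq X₁ he₁' (ht₁ hz), ← chartKahler_sq X₂ he₂' (ht₂ hz)]
    have := coord_lagrangian hΦ he he₁' he₂' (hdom z hz) (bas 0) (bas 1)
    rw [hid₁ z hz, hid₁ z hz, hid₂ z hz, hid₂ z hz, (hV₁' z hz.1).2, (hV₂' z hz.2).2] at this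
    rw [eq_neg_of_add_eq_zero_left this]
    ring
  · rw [extend_target_eq]; exact ht₁ hxU
  · rw [extend_target_eq]; exact ht₂ hxU
  · exact fun u n hn => hpar e he (e₁'.prod e₂')
      (IsManifold.mem_maximalAtlas_prod he₁' he₂') x hx.1
      ⟨(hdom x hxU).2.1, (hdom x hxU).2.2⟩ u n hn

end Products

/-! ### Curves of constant curvature -/

theorem covDerivAlong_deriv {E : Type*} [NormedAddCommGroup E] [NormedSpace ℝ E]
    (G : E → E →L[ℝ] E →L[ℝ] ℝ) (a : ℝ → E) (t : ℝ) :
    covDerivAlong G a (deriv a) t (1 : ℝ)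
      = deriv (deriv a) t + christoffel G (a t) (deriv a t) (deriv a t) := by
  simp only [covDerivAlong, fderiv_eq_smul_deriv, one_smul]

theorem covDerivAlong_congr {E E' : Type*} [NormedAddCommGroup E] [NormedSpace ℝ E]
    [NormedAddCommGroup E'] [NormedSpace ℝ E'] (G : E → E →L[ℝ] E →L[ℝ] ℝ) {F F' V V' : E' → E}
    {x : E'} (hF : F =ᶠ[nhds x] F') (hV : V =ᶠ[nhds x] V') (u : E') :
    covDerivAlong G F V x u = covDerivAlong G F' V' x u := by
  simp only [covDerivAlong, hF.fderiv_eq, hV.fderiv_eq, hF.eq_of_nhds, hV.eq_of_nhds]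

section Curves

variable {M : Type*} [TopologicalSpace M] [ChartedSpace Plane M] [IsManifold 𝓘(ℝ, Plane) ∞ M]
  (X : OrientedRiemannianSurface M) {e e' : OpenPartialHomeomorph M Plane} {α β : ℝ → M}
  {A B : Set ℝ} {k t : ℝ}

/-- The differential equation of unit speed curves of geodesic curvature `k`, in the chart `e`, at
the time `t`. -/
def CurveEqAt (e : OpenPartialHomeomorph M Plane) (α : ℝ → M) (k t : ℝ) : Prop :=
  chartMetric 𝓘(ℝ, Plane) X.metric.inner e (e (α t)) (deriv (e ∘ α) t) (deriv (e ∘ α) t) = 1 ∧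
  deriv (deriv (e ∘ α)) t + christoffel (chartMetric 𝓘(ℝ, Plane) X.metric.inner e) (e (α t))
      (deriv (e ∘ α) t) (deriv (e ∘ α) t) = k • chartJ X e (e (α t)) (deriv (e ∘ α) t)

theorem tangentCoord_mfderiv_curve (he : e ∈ IsManifold.maximalAtlas 𝓘(ℝ, Plane) ∞ M)
    (hα : MDifferentiableAt 𝓘(ℝ, ℝ) 𝓘(ℝ, Plane) α t) (ht : α t ∈ e.source) :
    tangentCoord e (α t) (mfderiv 𝓘(ℝ, ℝ) 𝓘(ℝ, Plane) α t (1 : ℝ)) = deriv (e ∘ α) t := by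
  have h := mfderiv_comp t ((mdifferentiable_of_mem_maximalAtlas he).mdifferentiableAt ht) hα
  rw [mfderiv_eq_fderiv] at h
  rw [← fderiv_apply_one_eq_deriv, h]
  rfl

theorem tangentCoord_eq_fderiv_comp (he : e ∈ IsManifold.maximalAtlas 𝓘(ℝ, Plane) ∞ M)
    (he' : e' ∈ IsManifold.maximalAtlas 𝓘(ℝ, Plane) ∞ M) {x : M} (hx : x ∈ e.source)
    (hx' : x ∈ e'.source) (w : TangentSpace 𝓘(ℝ, Plane) x) :
    tangentCoord e' x w = fderiv ℝ (e' ∘ e.symm) (e x) (tangentCoord e x w) := by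
  have hev : (e' ∘ e.symm) ∘ e =ᶠ[nhds x] e' := by
    filter_upwards [e.open_source.mem_nhds hx] with z hz
    simp [e.left_inv hz]
  have h1 : MDifferentiableAt 𝓘(ℝ, Plane) 𝓘(ℝ, Plane) (e' ∘ e.symm) (e x) := by
    refine MDifferentiableAt.comp (I' := 𝓘(ℝ, Plane)) (e x)
      ((mdifferentiable_of_mem_maximalAtlas he').mdifferentiableAt ?_)
      ((mdifferentiable_of_mem_maximalAtlas he).mdifferentiableAt_symm (e.map_source hx))
    rwa [e.left_inv hx]
  have h2 := mfderiv_comp x h1 ((mdifferentiable_of_mem_maximalAtlas he).mdifferentiableAt hx)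
  rw [hev.mfderiv_eq, mfderiv_eq_fderiv] at h2
  exact congrArg (fun L => L w) h2

theorem contDiffAt_transition (he : e ∈ IsManifold.maximalAtlas 𝓘(ℝ, Plane) ∞ M)
    (he' : e' ∈ IsManifold.maximalAtlas 𝓘(ℝ, Plane) ∞ M) {x : M} (hx : x ∈ e.source)
    (hx' : x ∈ e'.source) : ContDiffAt ℝ ∞ (e' ∘ e.symm) (e x) := by
  rw [← contMDiffAt_iff_contDiffAt]
  refine ContMDiffAt.comp (I' := 𝓘(ℝ, Plane)) (e x) (contMDiffAt_of_mem_maximalAtlas he' ?_)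
    (contMDiffAt_symm_of_mem_maximalAtlas he (e.map_source hx))
  rwa [e.left_inv hx]

theorem contDiffAt_curve (he : e ∈ IsManifold.maximalAtlas 𝓘(ℝ, Plane) ∞ M)
    (hα : ContMDiffAt 𝓘(ℝ, ℝ) 𝓘(ℝ, Plane) ∞ α t) (ht : α t ∈ e.source) :
    ContDiffAt ℝ ∞ (e ∘ α) t := by
  rw [← contMDiffAt_iff_contDiffAt]
  exact (contMDiffAt_of_mem_maximalAtlas he ht).comp t hα

theorem curveEqAt_congr (h : α =ᶠ[nhds t] β) (hβ : CurveEqAt X e β k t) :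
    CurveEqAt X e α k t := by
  have h1 : e ∘ α =ᶠ[nhds t] e ∘ β := h.fun_comp e
  unfold CurveEqAt at *
  rwa [h1.deriv_eq, h1.deriv.deriv_eq, h.eq_of_nhds]

/-- The unit speed and curvature conditions on a smooth curve, read in one chart. -/
theorem curveEqAt_iff (he : e ∈ IsManifold.maximalAtlas 𝓘(ℝ, Plane) ∞ M)
    (hα : ContMDiffAt 𝓘(ℝ, ℝ) 𝓘(ℝ, Plane) ∞ α t) (ht : α t ∈ e.source) :
    CurveEqAt X e α k t ↔
      X.metric.inner (α t) (mfderiv 𝓘(ℝ, ℝ) 𝓘(ℝ, Plane) α t (1 : ℝ))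
        (mfderiv 𝓘(ℝ, ℝ) 𝓘(ℝ, Plane) α t (1 : ℝ)) = 1 ∧
      covDerivAlong (chartMetric 𝓘(ℝ, Plane) X.metric.inner e) (e ∘ α) (deriv (e ∘ α)) t (1 : ℝ)
        = k • tangentCoord e (α t)
          (X.J (α t) (mfderiv 𝓘(ℝ, ℝ) 𝓘(ℝ, Plane) α t (1 : ℝ))) := by
  rw [form_eq_chartMetric X.metric.inner he ht, tangentCoord_J X he ht,
    tangentCoord_mfderiv_curve he (hα.mdifferentiableAt (by simp)) ht, covDerivAlong_deriv]
  rfl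

theorem curveEqAt_transfer (he : e ∈ IsManifold.maximalAtlas 𝓘(ℝ, Plane) ∞ M)
    (he' : e' ∈ IsManifold.maximalAtlas 𝓘(ℝ, Plane) ∞ M)
    (hα : ContMDiffAt 𝓘(ℝ, ℝ) 𝓘(ℝ, Plane) ∞ α t) (ht : α t ∈ e.source) (ht' : α t ∈ e'.source)
    (h : CurveEqAt X e α k t) : CurveEqAt X e' α k t := by
  rw [curveEqAt_iff X he hα ht] at h
  rw [curveEqAt_iff X he' hα ht']
  refine ⟨h.1, ?_⟩
  have hsm := contDiffAt_curve he hα ht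
  have hF : DifferentiableAt ℝ (e ∘ α) t := hsm.differentiableAt (by simp)
  have hV : DifferentiableAt ℝ (deriv (e ∘ α)) t :=
    (hsm.derivWithin (m := 1) (one_add_one_eq_two.trans_le two_le_infty)).differentiableAt (by simp)
  have hev : ∀ᶠ s in nhds t, α s ∈ e.source ∩ e'.source :=
    hα.continuousAt.preimage_mem_nhds
      ((e.open_source.inter e'.open_source).mem_nhds ⟨ht, ht'⟩)
  have hev2 : ∀ᶠ s in nhds t, DifferentiableAt ℝ (e ∘ α) s := by
    filter_upwards [(hsm.of_le two_le_infty).eventually (by simp)] with s hs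
    exact hs.differentiableAt (by simp)
  have key := IsRiemannianOn.covDerivAlong_transform (isRiemannianOn_chartMetric X he)
    (isRiemannianOn_chartMetric X he') (ψ := e' ∘ e.symm) (F := e ∘ α) (V := deriv (e ∘ α)) (x := t)
    (e.map_source ht) ((contDiffAt_transition he he' ht ht').of_le two_le_infty)
    (by simpa [e.left_inv ht] using e'.map_source ht')
    (fun w => by
      obtain ⟨v, rfl⟩ := tangentCoord_surjective he' ht' w
      exact ⟨_, (tangentCoord_eq_fderiv_comp he he' ht ht' v).symm⟩)
    (by
      have : e.target ∩ e.symm ⁻¹' e'.source ∈ nhds (e (α t)) :=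
        (e.isOpen_inter_preimage_symm e'.open_source).mem_nhds
          ⟨e.map_source ht, by simpa [e.left_inv ht] using ht'⟩
      filter_upwards [this] with z hz
      exact chartMetric_eventuallyEq X.metric.inner he he' hz.1 hz.2) hF hV (1 : ℝ)
  have hc : (e' ∘ e.symm) ∘ e ∘ α =ᶠ[nhds t] e' ∘ α := by
    filter_upwards [hev] with s hs
    simp [e.left_inv hs.1]
  have hd : (fun z => fderiv ℝ (e' ∘ e.symm) ((e ∘ α) z) (deriv (e ∘ α) z))
      =ᶠ[nhds t] deriv (e' ∘ α) := by
    filter_upwards [hev, hev2, hc.eventuallyEq_nhds] with s hs hs2 hs3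
    rw [← hs3.deriv_eq, fderiv_comp_deriv (f := e ∘ α) s
      ((contDiffAt_transition he he' hs.1 hs.2).differentiableAt (by simp)) hs2]
  rw [covDerivAlong_congr _ hc hd, h.2, map_smul] at key
  rw [key, tangentCoord_eq_fderiv_comp he he' ht ht']
  rfl

variable {X}

theorem IsCurveOfConstantCurvature.contMDiffAt
    (h : IsCurveOfConstantCurvature 𝓘(ℝ, Plane) X.metric.inner X.J A α k) (hA : IsOpen A)
    (ht : t ∈ A) : ContMDiffAt 𝓘(ℝ, ℝ) 𝓘(ℝ, Plane) ∞ α t :=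
  h.smooth.contMDiffAt (hA.mem_nhds ht)

theorem IsCurveOfConstantCurvature.curveEqAt
    (h : IsCurveOfConstantCurvature 𝓘(ℝ, Plane) X.metric.inner X.J A α k) (hA : IsOpen A)
    (he : e ∈ IsManifold.maximalAtlas 𝓘(ℝ, Plane) ∞ M)
    (ht : t ∈ A) (hte : α t ∈ e.source) : CurveEqAt X e α k t :=
  (curveEqAt_iff X he (h.contMDiffAt hA ht) hte).2 ⟨h.unit_speed t ht, h.curvature e he t ht hte⟩

theorem isCurveOfConstantCurvature_of_curveEqAt (hA : IsOpen A)
    (hα : ContMDiffOn 𝓘(ℝ, ℝ) 𝓘(ℝ, Plane) ∞ α A)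
    (h : ∀ t ∈ A, ∃ e ∈ IsManifold.maximalAtlas 𝓘(ℝ, Plane) ∞ M,
      α t ∈ e.source ∧ CurveEqAt X e α k t) :
    IsCurveOfConstantCurvature 𝓘(ℝ, Plane) X.metric.inner X.J A α k where
  smooth := hα
  unit_speed t ht := by
    obtain ⟨e, he, hte, hc⟩ := h t ht
    exact ((curveEqAt_iff X he (hα.contMDiffAt (hA.mem_nhds ht)) hte).1 hc).1
  curvature e' he' t ht hte' := by
    obtain ⟨e, he, hte, hc⟩ := h t ht
    have hs := hα.contMDiffAt (hA.mem_nhds ht)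
    exact ((curveEqAt_iff X he' hs hte').1 (curveEqAt_transfer X he he' hs hte hte' hc)).2

/-- Being a curve of constant curvature is a local property. -/
theorem IsCurveOfConstantCurvature.of_locally (hA : IsOpen A)
    (h : ∀ t ∈ A, ∃ B β, IsOpen B ∧ t ∈ B ∧
      IsCurveOfConstantCurvature 𝓘(ℝ, Plane) X.metric.inner X.J B β k ∧ α =ᶠ[nhds t] β) :
    IsCurveOfConstantCurvature 𝓘(ℝ, Plane) X.metric.inner X.J A α k := by
  refine isCurveOfConstantCurvature_of_curveEqAt hA (fun t ht => ?_) fun t ht => ?_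
  · obtain ⟨B, β, hB, htB, hβ, hαβ⟩ := h t ht
    exact ((hβ.contMDiffAt hB htB).congr_of_eventuallyEq hαβ).contMDiffWithinAt
  · obtain ⟨B, β, hB, htB, hβ, hαβ⟩ := h t ht
    have hm := mem_chart_source Plane (β t)
    have hm' := IsManifold.chart_mem_maximalAtlas (I := 𝓘(ℝ, Plane)) (n := ∞) (β t)
    refine ⟨chartAt Plane (β t), hm', ?_, curveEqAt_congr X hαβ (hβ.curveEqAt hB hm' htB hm)⟩
    rwa [hαβ.eq_of_nhds]

theorem IsCurveOfConstantCurvature.mono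
    (h : IsCurveOfConstantCurvature 𝓘(ℝ, Plane) X.metric.inner X.J A α k) (hBA : B ⊆ A) :
    IsCurveOfConstantCurvature 𝓘(ℝ, Plane) X.metric.inner X.J B α k :=
  ⟨h.smooth.mono hBA, fun t ht => h.unit_speed t (hBA ht),
    fun e he t ht => h.curvature e he t (hBA ht)⟩

/-- The reparametrization `t ↦ ε t + c`, `ε = ±1`, multiplies the curvature by `ε`. -/
theorem IsCurveOfConstantCurvature.comp_affine
    (h : IsCurveOfConstantCurvature 𝓘(ℝ, Plane) X.metric.inner X.J A α k) (hA : IsOpen A)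
    {ε : ℝ} (hε : ε * ε = 1) (c : ℝ) :
    IsCurveOfConstantCurvature 𝓘(ℝ, Plane) X.metric.inner X.J ((fun t => ε * t + c) ⁻¹' A)
      (fun t => α (ε * t + c)) (ε * k) := by
  have hr : ContDiff ℝ ∞ (fun t : ℝ => ε * t + c) := by fun_prop
  have hd : ∀ t, HasDerivAt (fun t : ℝ => ε * t + c) ε t := fun t => by
    simpa using ((hasDerivAt_id t).const_mul ε).add_const c
  refine isCurveOfConstantCurvature_of_curveEqAt (hA.preimage hr.continuous)
    (h.smooth.comp hr.contMDiff.contMDiffOn (fun t ht => ht)) fun t ht => ?_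
  have hm := mem_chart_source Plane (α (ε * t + c))
  have he := IsManifold.chart_mem_maximalAtlas (I := 𝓘(ℝ, Plane)) (n := ∞) (α (ε * t + c))
  set e := chartAt Plane (α (ε * t + c))
  refine ⟨e, he, hm, ?_⟩
  have hsm := contDiffAt_curve he (h.contMDiffAt hA ht) hm
  have h1 : deriv (e ∘ fun t => α (ε * t + c))
      =ᶠ[nhds t] fun t => ε • deriv (e ∘ α) (ε * t + c) := by
    have := (hd t).continuousAt.eventually ((hsm.of_le two_le_infty).eventually (by simp))
    filter_upwards [this] with s hs
    have := (hs.differentiableAt (by simp)).hasDerivAt.scomp s (hd s)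
    exact this.deriv
  have h2 : deriv (fun t => ε • deriv (e ∘ α) (ε * t + c)) t
      = deriv (deriv (e ∘ α)) (ε * t + c) := by
    have hV : DifferentiableAt ℝ (deriv (e ∘ α)) (ε * t + c) :=
      (hsm.derivWithin (m := 1) (one_add_one_eq_two.trans_le two_le_infty)).differentiableAt (by simp)
    have := (hV.hasDerivAt.scomp t (hd t)).const_smul ε
    rw [smul_smul, hε, one_smul] at this
    exact this.deriv
  obtain ⟨h3, h4⟩ := h.curveEqAt hA he ht hm
  have hy := e.map_source hm
  have hG := isRiemannianOn_chartMetric X he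
  refine ⟨?_, ?_⟩
  · rw [h1.eq_of_nhds]
    simp only [map_smul, smul_apply, smul_smul, hε, one_smul]
    exact h3
  · rw [h1.deriv_eq, h1.eq_of_nhds, h2, christoffel_smul_left, christoffel_smul_right, smul_smul,
      hε, one_smul, h4, map_smul, smul_smul, mul_right_comm, hε, one_mul]

end Curves

/-! ### Uniqueness and maximal extension of curves of constant curvature -/

section Uniqueness

variable {M : Type*} [TopologicalSpace M] [ChartedSpace Plane M] [IsManifold 𝓘(ℝ, Plane) ∞ M]
  {X : OrientedRiemannianSurface M} {e : OpenPartialHomeomorph M Plane} {α β : ℝ → M}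
  {A B : Set ℝ} {k t : ℝ}

theorem contDiffAt_curveField (X : OrientedRiemannianSurface M)
    (he : e ∈ IsManifold.maximalAtlas 𝓘(ℝ, Plane) ∞ M) (k : ℝ) {q : Plane × Plane}
    (hq : q.1 ∈ e.target) :
    ContDiffAt ℝ ∞ (fun q : Plane × Plane => (q.2, k • chartJ X e q.1 q.2 -
      christoffel (chartMetric 𝓘(ℝ, Plane) X.metric.inner e) q.1 q.2 q.2)) q := by
  have hJ := ((contDiffOn_chartJ X he).contDiffAt (e.open_target.mem_nhds hq)).comp q contDiffAt_fst
  have hΓ := ((isRiemannianOn_chartMetric X he).contDiffOn_christoffelBilin.contDiffAt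
    (e.open_target.mem_nhds hq)).comp q contDiffAt_fst
  have h2 : ContDiffAt ℝ ∞ (fun q : Plane × Plane => q.2) q := contDiffAt_snd
  refine h2.prodMk (((hJ.clm_apply h2).const_smul k).sub ?_)
  exact ((hΓ.clm_apply h2).clm_apply h2)

/-- The curve and its velocity, in a chart, solve a first order differential equation. -/
theorem IsCurveOfConstantCurvature.hasDerivAt_pair
    (h : IsCurveOfConstantCurvature 𝓘(ℝ, Plane) X.metric.inner X.J A α k) (hA : IsOpen A)
    (he : e ∈ IsManifold.maximalAtlas 𝓘(ℝ, Plane) ∞ M) (ht : t ∈ A) (hte : α t ∈ e.source) :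
    HasDerivAt (fun s => ((e ∘ α) s, deriv (e ∘ α) s))
      (deriv (e ∘ α) t, k • chartJ X e ((e ∘ α) t) (deriv (e ∘ α) t) -
        christoffel (chartMetric 𝓘(ℝ, Plane) X.metric.inner e) ((e ∘ α) t) (deriv (e ∘ α) t)
          (deriv (e ∘ α) t)) t := by
  have hsm := contDiffAt_curve he (h.contMDiffAt hA ht) hte
  have h1 := (hsm.differentiableAt (by simp)).hasDerivAt
  have h2 := ((hsm.derivWithin (m := 1)
    (one_add_one_eq_two.trans_le two_le_infty)).differentiableAt (by simp)).hasDerivAt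
  refine h1.prodMk ?_
  rwa [eq_sub_of_add_eq (h.curveEqAt hA he ht hte).2] at h2

/-- A curve of given constant curvature is determined near a time by its position and velocity. -/
theorem IsCurveOfConstantCurvature.eventuallyEq_of_initial
    (hα : IsCurveOfConstantCurvature 𝓘(ℝ, Plane) X.metric.inner X.J A α k) (hA : IsOpen A)
    (hβ : IsCurveOfConstantCurvature 𝓘(ℝ, Plane) X.metric.inner X.J B β k) (hB : IsOpen B)
    (he : e ∈ IsManifold.maximalAtlas 𝓘(ℝ, Plane) ∞ M) (htA : t ∈ A) (htB : t ∈ B)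
    (hte : α t ∈ e.source) (h0 : α t = β t) (h1 : deriv (e ∘ α) t = deriv (e ∘ β) t) :
    α =ᶠ[nhds t] β := by
  have hte' : β t ∈ e.source := h0 ▸ hte
  obtain ⟨K, N, hN, hL⟩ := ((contDiffAt_curveField X he k (q := (e (α t), deriv (e ∘ α) t))
    (e.map_source hte)).of_le (m := 1) (by simp)).exists_lipschitzOnWith
  have aux : ∀ {γ : ℝ → M} {C : Set ℝ},
      IsCurveOfConstantCurvature 𝓘(ℝ, Plane) X.metric.inner X.J C γ k → IsOpen C → t ∈ C →
      γ t ∈ e.source → (e (γ t), deriv (e ∘ γ) t) = (e (α t), deriv (e ∘ α) t) →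
      ∀ᶠ s in nhds t, γ s ∈ e.source ∧ HasDerivAt (fun s => ((e ∘ γ) s, deriv (e ∘ γ) s))
        (deriv (e ∘ γ) s, k • chartJ X e ((e ∘ γ) s) (deriv (e ∘ γ) s) -
          christoffel (chartMetric 𝓘(ℝ, Plane) X.metric.inner e) ((e ∘ γ) s) (deriv (e ∘ γ) s)
          (deriv (e ∘ γ) s)) s ∧ ((e ∘ γ) s, deriv (e ∘ γ) s) ∈ N := by
    intro γ C hγ hC ht hte heq
    have e1 := (hγ.contMDiffAt hC ht).continuousAt.preimage_mem_nhds
      (e.open_source.mem_nhds hte)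
    have e2 := (hγ.hasDerivAt_pair hC he ht hte).continuousAt.preimage_mem_nhds
      (t := N) (by rw [← heq] at hN; exact hN)
    filter_upwards [e1, hC.mem_nhds ht, e2] with s hs hsC hsN
    exact ⟨hs, hγ.hasDerivAt_pair hC he hsC hs, hsN⟩
  have hfα := aux hα hA htA hte rfl
  have hfβ := aux hβ hB htB hte' (by rw [h0, h1])
  have := ODE_solution_unique_of_eventually (t₀ := t) (s := fun _ => N) (K := K)
    (v := fun _ (q : Plane × Plane) => (q.2, k • chartJ X e q.1 q.2 -
      christoffel (chartMetric 𝓘(ℝ, Plane) X.metric.inner e) q.1 q.2 q.2))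
    (Filter.Eventually.of_forall fun _ => hL) (hfα.mono fun s hs => hs.2)
    (hfβ.mono fun s hs => hs.2) (by simp [h0, h1])
  filter_upwards [this, hfα, hfβ] with s hs hsα hsβ
  exact e.injOn hsα.1 hsβ.1 (congrArg Prod.fst hs)

variable [T2Space M]

/-- Two curves of the same constant curvature that agree near a time agree on every interval on
which both are defined. -/
theorem IsCurveOfConstantCurvature.eqOn
    (hα : IsCurveOfConstantCurvature 𝓘(ℝ, Plane) X.metric.inner X.J A α k) (hA : IsOpen A)
    (hβ : IsCurveOfConstantCurvature 𝓘(ℝ, Plane) X.metric.inner X.J B β k) (hB : IsOpen B)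
    {C : Set ℝ} (hC : C.OrdConnected) (hCA : C ⊆ A) (hCB : C ⊆ B) (ht : t ∈ C)
    (h : α =ᶠ[nhds t] β) : ∀ s ∈ C, α =ᶠ[nhds s] β := by
  have hopen : IsOpen {s | α =ᶠ[nhds s] β} := isOpen_setOfPred_eventually_nhds
  refine hC.isPreconnected.subset_of_closure_inter_subset hopen ⟨t, ht, h⟩ ?_
  rintro s ⟨hs, hsC⟩
  have hsA := hα.contMDiffAt hA (hCA hsC)
  have hsB := hβ.contMDiffAt hB (hCB hsC)
  have hf : ∃ᶠ r in nhds s, α =ᶠ[nhds r] β := mem_closure_iff_frequently.1 hs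
  have h0 : α s = β s := tendsto_nhds_unique_of_frequently_eq hsA.continuousAt hsB.continuousAt
    (hf.mono fun r hr => hr.eq_of_nhds)
  have hm := mem_chart_source Plane (α s)
  have he := IsManifold.chart_mem_maximalAtlas (I := 𝓘(ℝ, Plane)) (n := ∞) (α s)
  refine hα.eventuallyEq_of_initial hA hβ hB he (hCA hsC) (hCB hsC) hm h0 ?_
  have c1 := (hα.hasDerivAt_pair hA he (hCA hsC) hm).continuousAt
  have c2 := (hβ.hasDerivAt_pair hB he (hCB hsC) (h0 ▸ hm)).continuousAt
  exact tendsto_nhds_unique_of_frequently_eq (continuousAt_snd.comp c1) (continuousAt_snd.comp c2)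
    (hf.mono fun r hr => (hr.fun_comp _).deriv_eq)

/-- A curve that contains every curve of the same curvature with which it shares a germ. -/
structure IsMaximalCurve (X : OrientedRiemannianSurface M) (A : Set ℝ) (α : ℝ → M) (k : ℝ) :
    Prop where
  isOpen : IsOpen A
  ordConnected : A.OrdConnected
  curve : IsCurveOfConstantCurvature 𝓘(ℝ, Plane) X.metric.inner X.J A α k
  maximal : ∀ B β, IsOpen B → B.OrdConnected →
    IsCurveOfConstantCurvature 𝓘(ℝ, Plane) X.metric.inner X.J B β k →
    ∀ s ∈ A ∩ B, α =ᶠ[nhds s] β → B ⊆ A ∧ ∀ r ∈ B, α r = β r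

/-- The union of all extensions of a curve of constant curvature is a maximal curve. -/
theorem IsCurveOfConstantCurvature.exists_maximal
    (hα : IsCurveOfConstantCurvature 𝓘(ℝ, Plane) X.metric.inner X.J A α k) (hA : IsOpen A)
    (hAc : A.OrdConnected) (ht : t ∈ A) :
    ∃ A' α', IsMaximalCurve X A' α' k ∧ A ⊆ A' ∧ ∀ s ∈ A, α' s = α s := by
  classical
  -- the curves on intervals around `t` with the germ of `α`; any two agree where both are defined
  set F : Set (Set ℝ × (ℝ → M)) := {c | IsOpen c.1 ∧ c.1.OrdConnected ∧ t ∈ c.1 ∧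
    IsCurveOfConstantCurvature 𝓘(ℝ, Plane) X.metric.inner X.J c.1 c.2 k ∧ c.2 =ᶠ[nhds t] α}
    with hF
  have hcomp : ∀ c ∈ F, ∀ d ∈ F, ∀ s ∈ c.1 ∩ d.1, c.2 s = d.2 s := by
    intro c hc d hd s hs
    exact (hc.2.2.2.1.eqOn hc.1 hd.2.2.2.1 hd.1 (hc.2.1.inter hd.2.1) Set.inter_subset_left
      Set.inter_subset_right ⟨hc.2.2.1, hd.2.2.1⟩
      (hc.2.2.2.2.trans hd.2.2.2.2.symm) s hs).eq_of_nhds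
  set A' : Set ℝ := ⋃ c ∈ F, c.1 with hA'
  set α' : ℝ → M := fun s => if h : ∃ c ∈ F, s ∈ c.1 then h.choose.2 s else α s with hα'
  have hval : ∀ c ∈ F, ∀ s ∈ c.1, α' s = c.2 s := by
    intro c hc s hs
    have h : ∃ c ∈ F, s ∈ c.1 := ⟨c, hc, hs⟩
    simp only [hα', dif_pos h]
    exact hcomp _ h.choose_spec.1 c hc s ⟨h.choose_spec.2, hs⟩
  have hgerm : ∀ c ∈ F, ∀ s ∈ c.1, α' =ᶠ[nhds s] c.2 := fun c hc s hs =>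
    Filter.eventuallyEq_of_mem (hc.1.mem_nhds hs) (hval c hc)
  have hopen : IsOpen A' := isOpen_biUnion fun c hc => hc.1
  have hconn : A'.OrdConnected := by
    rw [← isPreconnected_iff_ordConnected]
    refine isPreconnected_of_forall t fun s hs => ?_
    obtain ⟨c, hc, hsc⟩ := Set.mem_iUnion₂.1 hs
    exact ⟨c.1, fun r hr => Set.mem_biUnion hc hr, hc.2.2.1, hsc, hc.2.1.isPreconnected⟩
  have hmemα : (A, α) ∈ F := ⟨hA, hAc, ht, hα, Filter.EventuallyEq.rfl⟩
  have hcurve : IsCurveOfConstantCurvature 𝓘(ℝ, Plane) X.metric.inner X.J A' α' k := by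
    refine .of_locally hopen fun s hs => ?_
    obtain ⟨c, hc, hsc⟩ := Set.mem_iUnion₂.1 hs
    exact ⟨c.1, c.2, hc.1, hsc, hc.2.2.2.1, hgerm c hc s hsc⟩
  have htA' : t ∈ A' := Set.mem_biUnion hmemα ht
  refine ⟨A', α', ⟨hopen, hconn, hcurve, ?_⟩, fun s hs => Set.mem_biUnion hmemα hs,
    hval _ hmemα⟩
  intro B β hB hBc hβ s hs hsβ
  have hag := hcurve.eqOn hopen hβ hB (hconn.inter hBc) Set.inter_subset_left
    Set.inter_subset_right hs hsβ
  set γ : ℝ → M := fun r => if r ∈ A' then α' r else β r with hγ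
  have hγA : ∀ r ∈ A', γ =ᶠ[nhds r] α' := fun r hr =>
    Filter.eventuallyEq_of_mem (hopen.mem_nhds hr) fun x hx => if_pos hx
  have hγB' : ∀ r ∈ B, γ r = β r := by
    intro r hr
    by_cases h : r ∈ A'
    · exact (if_pos h).trans (hag r ⟨h, hr⟩).eq_of_nhds
    · exact if_neg h
  -- gluing `β` to the union gives another member of `F`
  have hmem : (A' ∪ B, γ) ∈ F := by
    refine ⟨hopen.union hB, ?_, Or.inl htA', ?_, (hγA t htA').trans (hgerm _ hmemα t ht)⟩
    · rw [← isPreconnected_iff_ordConnected]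
      exact hconn.isPreconnected.union s hs.1 hs.2 hBc.isPreconnected
    · refine .of_locally (hopen.union hB) fun r hr => ?_
      rcases hr with hr | hr
      · exact ⟨A', α', hopen, hr, hcurve, hγA r hr⟩
      · exact ⟨B, β, hB, hr, hβ, Filter.eventuallyEq_of_mem (hB.mem_nhds hr) hγB'⟩
  exact ⟨fun r hr => Set.mem_biUnion hmem (Or.inr hr), fun r hr =>
    (hval _ hmem r (Or.inr hr)).trans (hγB' r hr)⟩

end Uniqueness

/-! ### Coordinates in which the immersion is a product -/

/-- A degenerate endomorphism of the plane is determined, up to its kernel, by one component. -/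
theorem exists_component_injective {L : Plane →L[ℝ] Plane}
    (hdet : ∀ v w, L v 0 * L w 1 - L v 1 * L w 0 = 0) (hL : L ≠ 0) :
    ∃ i, ∀ v, L v i = 0 → L v = 0 := by
  have h : ∃ w, L w ≠ 0 := by
    by_contra! h
    exact hL (ContinuousLinearMap.ext h)
  obtain ⟨w, hw⟩ := h
  have hw' : L w 0 ≠ 0 ∨ L w 1 ≠ 0 := by
    by_contra! h
    exact hw (by ext i; fin_cases i <;> simp [h.1, h.2])
  rcases hw' with hw | hw
  · refine ⟨0, fun v hv => ?_⟩
    have := hdet v w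
    rw [hv, zero_mul, zero_sub, neg_eq_zero, mul_eq_zero, or_iff_left hw] at this
    ext i; fin_cases i <;> simp [hv, this]
  · refine ⟨1, fun v hv => ?_⟩
    have := hdet v w
    rw [hv, zero_mul, sub_zero, mul_eq_zero, or_iff_left hw] at this
    ext i; fin_cases i <;> simp [hv, this]

/-- A degenerate endomorphism of the plane has a nontrivial kernel. -/
theorem exists_ne_zero_apply_eq_zero {L : Plane →L[ℝ] Plane}
    (hdet : ∀ v w, L v 0 * L w 1 - L v 1 * L w 0 = 0) : ∃ v, v ≠ 0 ∧ L v = 0 := by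
  by_contra! h
  have hz : ∀ i : Fin 2, L (bas 0) i = 0 := by
    intro i
    by_contra hi
    refine h (L (bas 1) i • bas 0 - L (bas 0) i • bas 1) (fun h0 => hi ?_) ?_
    · simpa using congrArg (fun z : Plane => z 1) h0
    · have := hdet (bas 0) (bas 1)
      ext j
      fin_cases i <;> fin_cases j <;> simp <;> linarith
  exact h (bas 0) (by simp) (by ext i; simp [hz i])

section ProductCharts

variable {M₁ M₂ S : Type*} [TopologicalSpace M₁] [ChartedSpace Plane M₁]
  [IsManifold 𝓘(ℝ, Plane) ∞ M₁] [TopologicalSpace M₂] [ChartedSpace Plane M₂]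
  [IsManifold 𝓘(ℝ, Plane) ∞ M₂] [TopologicalSpace S] [ChartedSpace Plane S]
  [IsManifold 𝓘(ℝ, Plane) ∞ S]
  {X₁ : OrientedRiemannianSurface M₁} {X₂ : OrientedRiemannianSurface M₂} {Φ : S → M₁ × M₂}
  {e : OpenPartialHomeomorph S Plane} {e₁ : OpenPartialHomeomorph M₁ Plane}
  {e₂ : OpenPartialHomeomorph M₂ Plane}

/-- The chart `e` separates the variables of `Φ`: its first component depends on the first
coordinate only, and the second component on the second coordinate. -/
structure IsProductChart (Φ : S → M₁ × M₂) (e : OpenPartialHomeomorph S Plane)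
    (e₁ : OpenPartialHomeomorph M₁ Plane) (e₂ : OpenPartialHomeomorph M₂ Plane) : Prop where
  mem_atlas : e ∈ IsManifold.maximalAtlas 𝓘(ℝ, Plane) ∞ S
  mem_atlas₁ : e₁ ∈ IsManifold.maximalAtlas 𝓘(ℝ, Plane) ∞ M₁
  mem_atlas₂ : e₂ ∈ IsManifold.maximalAtlas 𝓘(ℝ, Plane) ∞ M₂
  mapsTo : ∀ q ∈ e.source, (Φ q).1 ∈ e₁.source ∧ (Φ q).2 ∈ e₂.source
  fst : ∀ z ∈ e.target, fderiv ℝ (coordRep (fun q => (Φ q).1) e e₁) z (bas 1) = 0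
  snd : ∀ z ∈ e.target, fderiv ℝ (coordRep (fun q => (Φ q).2) e e₂) z (bas 0) = 0

theorem coordDomain_eq (hm : ∀ q ∈ e.source, (Φ q).1 ∈ e₁.source ∧ (Φ q).2 ∈ e₂.source) {z : Plane}
    (hz : z ∈ e.target) : z ∈ coordDomain Φ e e₁ e₂ :=
  ⟨hz, (hm _ (e.map_target hz)).1, (hm _ (e.map_target hz)).2⟩

theorem det_eq_zero_of_kahler (X : OrientedRiemannianSurface M₁)
    (he₁ : e₁ ∈ IsManifold.maximalAtlas 𝓘(ℝ, Plane) ∞ M₁) {y : Plane} (hy : y ∈ e₁.target)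
    {v w : Plane} (h : chartMetric 𝓘(ℝ, Plane) X.kahlerForm e₁ y v w = 0) :
    v 0 * w 1 - v 1 * w 0 = 0 := by
  rw [chartKahler_apply X he₁ hy] at h
  refine (mul_eq_zero.1 h).resolve_right fun h0 => ?_
  have h1 := chartKahler_sq X he₁ hy
  have h2 := (isRiemannianOn_chartMetric X he₁).gram_pos hy
  rw [h0] at h1
  linarith

variable (hΦ : IsLagrangianImmersion X₁ X₂ Φ)
  (hK : ∀ {e : OpenPartialHomeomorph S Plane} {e₁ : OpenPartialHomeomorph M₁ Plane}
    {e₂ : OpenPartialHomeomorph M₂ Plane}, e ∈ IsManifold.maximalAtlas 𝓘(ℝ, Plane) ∞ S →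
    e₁ ∈ IsManifold.maximalAtlas 𝓘(ℝ, Plane) ∞ M₁ →
    e₂ ∈ IsManifold.maximalAtlas 𝓘(ℝ, Plane) ∞ M₂ →
    ∀ {x : Plane}, x ∈ coordDomain Φ e e₁ e₂ → ∀ v w : Plane,
      chartMetric 𝓘(ℝ, Plane) X₁.kahlerForm e₁ (coordRep (fun q => (Φ q).1) e e₁ x)
        (fderiv ℝ (coordRep (fun q => (Φ q).1) e e₁) x v)
        (fderiv ℝ (coordRep (fun q => (Φ q).1) e e₁) x w) = 0)

include hΦ hK

theorem det_fst_eq_zero (he : e ∈ IsManifold.maximalAtlas 𝓘(ℝ, Plane) ∞ S)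
    (he₁ : e₁ ∈ IsManifold.maximalAtlas 𝓘(ℝ, Plane) ∞ M₁)
    (he₂ : e₂ ∈ IsManifold.maximalAtlas 𝓘(ℝ, Plane) ∞ M₂)
    {x : Plane} (hx : x ∈ coordDomain Φ e e₁ e₂) (v w : Plane) :
    fderiv ℝ (coordRep (fun q => (Φ q).1) e e₁) x v 0 *
        fderiv ℝ (coordRep (fun q => (Φ q).1) e e₁) x w 1 -
      fderiv ℝ (coordRep (fun q => (Φ q).1) e e₁) x v 1 *
        fderiv ℝ (coordRep (fun q => (Φ q).1) e e₁) x w 0 = 0 :=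
  det_eq_zero_of_kahler X₁ he₁ (e₁.map_source hx.2.1) (hK he he₁ he₂ hx v w)

theorem det_snd_eq_zero (he : e ∈ IsManifold.maximalAtlas 𝓘(ℝ, Plane) ∞ S)
    (he₁ : e₁ ∈ IsManifold.maximalAtlas 𝓘(ℝ, Plane) ∞ M₁)
    (he₂ : e₂ ∈ IsManifold.maximalAtlas 𝓘(ℝ, Plane) ∞ M₂)
    {x : Plane} (hx : x ∈ coordDomain Φ e e₁ e₂) (v w : Plane) :
    fderiv ℝ (coordRep (fun q => (Φ q).2) e e₂) x v 0 *
        fderiv ℝ (coordRep (fun q => (Φ q).2) e e₂) x w 1 -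
      fderiv ℝ (coordRep (fun q => (Φ q).2) e e₂) x v 1 *
        fderiv ℝ (coordRep (fun q => (Φ q).2) e e₂) x w 0 = 0 := by
  refine det_eq_zero_of_kahler X₂ he₂ (e₂.map_source hx.2.2) ?_
  have := coord_lagrangian hΦ he he₁ he₂ hx v w
  rwa [hK he he₁ he₂ hx v w, zero_add] at this

/-- If both Kähler forms pull back to zero, the two components of `Φ` have differentials of rank one,
and a component of each of them provides a coordinate in which it depends on nothing else. -/
theorem exists_isProductChart {p : S}
    (he₁ : e₁ ∈ IsManifold.maximalAtlas 𝓘(ℝ, Plane) ∞ M₁) (hp₁ : (Φ p).1 ∈ e₁.source)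
    (he₂ : e₂ ∈ IsManifold.maximalAtlas 𝓘(ℝ, Plane) ∞ M₂) (hp₂ : (Φ p).2 ∈ e₂.source) :
    ∃ e, IsProductChart Φ e e₁ e₂ ∧ p ∈ e.source := by
  have hp := mem_chart_source Plane p
  have he := IsManifold.chart_mem_maximalAtlas (I := 𝓘(ℝ, Plane)) (n := ∞) p
  set e := chartAt Plane p
  have hx : e p ∈ coordDomain Φ e e₁ e₂ := ⟨e.map_source hp, by
    rw [Set.mem_preimage, Set.mem_preimage, e.left_inv hp]; exact ⟨hp₁, hp₂⟩⟩
  set f₁ := coordRep (fun q => (Φ q).1) e e₁ with hf₁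
  set f₂ := coordRep (fun q => (Φ q).2) e e₂ with hf₂
  have hd₁ : ∀ z ∈ coordDomain Φ e e₁ e₂, ContDiffAt ℝ ∞ f₁ z := fun z hz =>
    contDiffAt_coordRep (contMDiff_fst_comp hΦ.smooth) he he₁ hz.1 hz.2.1
  have hd₂ : ∀ z ∈ coordDomain Φ e e₁ e₂, ContDiffAt ℝ ∞ f₂ z := fun z hz =>
    contDiffAt_coordRep (contMDiff_snd_comp hΦ.smooth) he he₂ hz.1 hz.2.2
  have det₁ := det_fst_eq_zero hΦ hK he he₁ he₂ hx
  have det₂ := det_snd_eq_zero hΦ hK he he₁ he₂ hx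
  have hinj := fun v => coord_immersion (v := v) hΦ he he₁ he₂ hx
  -- neither differential vanishes: the other one is degenerate and `Φ` is an immersion
  obtain ⟨i, hi⟩ := exists_component_injective det₁ (fun h0 => by
    obtain ⟨v, hv, hv0⟩ := exists_ne_zero_apply_eq_zero det₂
    exact hv (hinj v (by rw [← hf₁, h0]; rfl) hv0))
  obtain ⟨j, hj⟩ := exists_component_injective det₂ (fun h0 => by
    obtain ⟨v, hv, hv0⟩ := exists_ne_zero_apply_eq_zero det₁
    exact hv (hinj v hv0 (by rw [← hf₂, h0]; rfl)))
  -- the new coordinates are the component `i` of `Φ₁` and the component `j` of `Φ₂`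
  have hΘd : ∀ z ∈ coordDomain Φ e e₁ e₂,
      HasFDerivAt (fun z => (!₂[f₁ z i, f₂ z j] : Plane))
        ((EuclideanSpace.equiv (Fin 2) ℝ).symm.toContinuousLinearMap.comp
          (ContinuousLinearMap.pi ![(EuclideanSpace.proj i).comp (fderiv ℝ f₁ z),
            (EuclideanSpace.proj j).comp (fderiv ℝ f₂ z)])) z := by
    intro z hz
    have h1 := (EuclideanSpace.proj i : Plane →L[ℝ] ℝ).hasFDerivAt.comp z
      ((hd₁ z hz).differentiableAt (by simp)).hasFDerivAt
    have h2 := (EuclideanSpace.proj j : Plane →L[ℝ] ℝ).hasFDerivAt.comp z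
      ((hd₂ z hz).differentiableAt (by simp)).hasFDerivAt
    rw [← (EuclideanSpace.equiv (Fin 2) ℝ).comp_hasFDerivAt_iff, hasFDerivAt_pi']
    intro l
    fin_cases l
    · exact h1
    · exact h2
  obtain ⟨e', he', hpe', hsub, hO, hee'⟩ := exists_chart_comp he
    (Θ := fun z => (!₂[f₁ z i, f₂ z j] : Plane)) (isOpen_coordDomain hΦ.smooth.continuous)
    (fun z hz => by
      refine ContDiffAt.contDiffWithinAt ?_
      rw [contDiffAt_euclidean]
      intro l
      fin_cases l
      · exact (EuclideanSpace.proj i : Plane →L[ℝ] ℝ).contDiff.contDiffAt.comp z (hd₁ z hz)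
      · exact (EuclideanSpace.proj j : Plane →L[ℝ] ℝ).contDiff.contDiffAt.comp z (hd₂ z hz)) hp hx
    (fun v hv => by
      rw [(hΘd _ hx).fderiv] at hv
      have h0 := congrArg (fun z : Plane => z 0) hv
      have h1 := congrArg (fun z : Plane => z 1) hv
      exact hinj v (hi v (by simpa using h0)) (hj v (by simpa using h1)))
  have hm : ∀ q ∈ e'.source, (Φ q).1 ∈ e₁.source ∧ (Φ q).2 ∈ e₂.source := fun q hq => by
    have := (hO q hq).2
    rw [Set.mem_preimage, Set.mem_preimage, e.left_inv (hsub hq)] at this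
    exact this
  have hval : ∀ z ∈ e'.target, coordRep (fun q => (Φ q).1) e' e₁ z i = z 0 ∧
      coordRep (fun q => (Φ q).2) e' e₂ z j = z 1 := by
    intro z hz
    have hq := e'.map_target hz
    have h1 := hee' _ hq
    rw [e'.right_inv hz] at h1
    have h2 : f₁ (e (e'.symm z)) = coordRep (fun q => (Φ q).1) e' e₁ z := by
      simp [hf₁, coordRep, e.left_inv (hsub hq)]
    have h3 : f₂ (e (e'.symm z)) = coordRep (fun q => (Φ q).2) e' e₂ z := by
      simp [hf₂, coordRep, e.left_inv (hsub hq)]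
    rw [h2, h3] at h1
    constructor
    · simpa using (congrArg (fun z : Plane => z 0) h1).symm
    · simpa using (congrArg (fun z : Plane => z 1) h1).symm
  have hcomp : ∀ z ∈ e'.target, ∀ v : Plane,
      fderiv ℝ (coordRep (fun q => (Φ q).1) e' e₁) z v i = v 0 ∧
      fderiv ℝ (coordRep (fun q => (Φ q).2) e' e₂) z v j = v 1 := by
    intro z hz v
    have hz' := coordDomain_eq hm hz
    have a1 := (EuclideanSpace.proj i : Plane →L[ℝ] ℝ).hasFDerivAt.comp z
      ((contDiffAt_coordRep (contMDiff_fst_comp hΦ.smooth) he' he₁ hz'.1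
        hz'.2.1).differentiableAt (by simp)).hasFDerivAt
    have a2 := (EuclideanSpace.proj j : Plane →L[ℝ] ℝ).hasFDerivAt.comp z
      ((contDiffAt_coordRep (contMDiff_snd_comp hΦ.smooth) he' he₂ hz'.1
        hz'.2.2).differentiableAt (by simp)).hasFDerivAt
    have b1 := (EuclideanSpace.proj 0 : Plane →L[ℝ] ℝ).hasFDerivAt (x := z)
    have b2 := (EuclideanSpace.proj 1 : Plane →L[ℝ] ℝ).hasFDerivAt (x := z)
    have hN := e'.open_target.mem_nhds hz
    constructor
    · exact congrArg (fun L => L v) (a1.unique (b1.congr_of_eventuallyEq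
        (Filter.eventuallyEq_of_mem hN fun y hy => (hval y hy).1)))
    · exact congrArg (fun L => L v) (a2.unique (b2.congr_of_eventuallyEq
        (Filter.eventuallyEq_of_mem hN fun y hy => (hval y hy).2)))
  -- the component that is not a coordinate is controlled by the vanishing of the determinant
  refine ⟨e', ⟨he', he₁, he₂, hm, fun z hz => ?_, fun z hz => ?_⟩, hpe'⟩
  · have hd := det_fst_eq_zero hΦ hK he' he₁ he₂ (coordDomain_eq hm hz) (bas 0) (bas 1)
    have h0 := (hcomp z hz (bas 0)).1
    have h1 := (hcomp z hz (bas 1)).1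
    clear_value f₁ f₂
    fin_cases i <;> simp at h0 h1 <;> rw [h0, h1] at hd <;> ext l <;> fin_cases l <;>
      simp [h1] <;> linarith
  · have hd := det_snd_eq_zero hΦ hK he' he₁ he₂ (coordDomain_eq hm hz) (bas 0) (bas 1)
    have h0 := (hcomp z hz (bas 0)).2
    have h1 := (hcomp z hz (bas 1)).2
    fin_cases j <;> simp at h0 h1 <;> rw [h0, h1] at hd <;> ext l <;> fin_cases l <;>
      simp [h0] <;> linarith

end ProductCharts

/-! ### Arc length coordinates -/

section Separation

variable {f : Plane → Plane} {a : ℝ → Plane} {x z : Plane} {δ : ℝ}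

theorem square_add_smul (hz : z ∈ square x δ) {j : Fin 2} {r : ℝ}
    (hr : r ∈ Set.Ioo (x j - δ) (x j + δ)) : z + (r - z j) • bas j ∈ square x δ := by
  intro i
  by_cases h : i = j
  · subst h; simpa using hr
  · simpa [h] using hz i

theorem eq_of_fderiv_bas_eq_zero (hf : ContDiffOn ℝ ∞ f (square x δ)) {j : Fin 2}
    (h : ∀ z ∈ square x δ, fderiv ℝ f z (bas j) = 0) (hz : z ∈ square x δ) {r : ℝ}
    (hr : r ∈ Set.Ioo (x j - δ) (x j + δ)) : f (z + (r - z j) • bas j) = f z := by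
  have hd : ∀ s ∈ Set.Ioo (x j - δ) (x j + δ),
      HasDerivAt (fun s => f (z + (s - z j) • bas j)) 0 s := by
    intro s hs
    have h1 : HasDerivAt (fun s : ℝ => z + (s - z j) • bas j) (bas j) s := by
      simpa using (((hasDerivAt_id s).sub_const (z j)).smul_const (bas j)).const_add z
    have hm := square_add_smul hz hs
    have h2 := ((hf.contDiffAt ((isOpen_square x δ).mem_nhds hm)).differentiableAt
      (by simp)).hasFDerivAt.comp_hasDerivAt s h1
    rwa [h _ hm] at h2
  have := isOpen_Ioo.is_const_of_deriv_eq_zero isPreconnected_Ioo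
    (fun s hs => (hd s hs).differentiableAt.differentiableWithinAt) (fun s hs => (hd s hs).deriv)
    hr (hz j)
  simpa using this

/-- A function on a square with one vanishing partial derivative depends on one variable only. -/
theorem exists_factor (hδ : 0 < δ) (hf : ContDiffOn ℝ ∞ f (square x δ)) {i j : Fin 2} (hij : i ≠ j)
    (h : ∀ z ∈ square x δ, fderiv ℝ f z (bas j) = 0) :
    ∃ a : ℝ → Plane, ContDiffOn ℝ ∞ a (Set.Ioo (x i - δ) (x i + δ)) ∧
      ∀ z ∈ square x δ, f z = a (z i) := by
  have hx := mem_square_self x hδ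
  refine ⟨fun r => f (x + (r - x i) • bas i), ?_, fun z hz => ?_⟩
  · exact hf.comp (by fun_prop) fun r hr => square_add_smul hx hr
  · rw [← eq_of_fderiv_bas_eq_zero hf h hz (hx j)]
    congr 1
    ext l
    by_cases hl : l = i
    · subst hl; simp [hij]
    · have : l = j := by omega
      subst this; simp [hl]

theorem fderiv_factor {i : Fin 2} (hfa : ∀ z ∈ square x δ, f z = a (z i)) (hz : z ∈ square x δ)
    (ha : DifferentiableAt ℝ a (z i)) (v : Plane) : fderiv ℝ f z v = v i • deriv a (z i) := by
  have h1 : f =ᶠ[nhds z] a ∘ (EuclideanSpace.proj i : Plane →L[ℝ] ℝ) :=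
    Filter.eventuallyEq_of_mem ((isOpen_square x δ).mem_nhds hz) hfa
  have h2 := ha.hasFDerivAt.comp z (EuclideanSpace.proj i : Plane →L[ℝ] ℝ).hasFDerivAt
  rw [h1.fderiv_eq, h2.fderiv]
  change fderiv ℝ a (z i) (v i) = _
  rw [fderiv_eq_smul_deriv]

theorem exists_smooth_primitive {v : ℝ → ℝ} {l r : ℝ} (hv : ContDiffOn ℝ ∞ v (Set.Ioo l r)) :
    ∃ σ : ℝ → ℝ, ContDiffOn ℝ ∞ σ (Set.Ioo l r) ∧
      ∀ s ∈ Set.Ioo l r, HasDerivAt σ (v s) s := by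
  by_cases hlr : l < r
  swap
  · exact ⟨0, contDiffOn_const, fun s hs => absurd (hs.1.trans hs.2) hlr⟩
  have hm : (l + r) / 2 ∈ Set.Ioo l r := ⟨by linarith, by linarith⟩
  have hd : ∀ s ∈ Set.Ioo l r, HasDerivAt (fun s => ∫ t in ((l + r) / 2)..s, v t) (v s) s := by
    intro s hs
    have hsub : Set.uIcc ((l + r) / 2) s ⊆ Set.Ioo l r := Set.OrdConnected.uIcc_subset
      Set.ordConnected_Ioo hm hs
    have hc := hv.continuousOn.continuousAt (isOpen_Ioo.mem_nhds hs)
    exact intervalIntegral.integral_hasDerivAt_right (hv.continuousOn.mono hsub).intervalIntegrable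
      (hv.continuousOn.stronglyMeasurableAtFilter isOpen_Ioo _ hs) hc
  refine ⟨_, ?_, hd⟩
  rw [contDiffOn_infty_iff_deriv_of_isOpen isOpen_Ioo]
  exact ⟨fun s hs => (hd s hs).differentiableAt.differentiableWithinAt,
    hv.congr fun s hs => (hd s hs).deriv⟩

end Separation

section ArcLength

variable {M₁ M₂ S : Type*} [TopologicalSpace M₁] [ChartedSpace Plane M₁]
  [IsManifold 𝓘(ℝ, Plane) ∞ M₁] [TopologicalSpace M₂] [ChartedSpace Plane M₂]
  [IsManifold 𝓘(ℝ, Plane) ∞ M₂] [TopologicalSpace S] [ChartedSpace Plane S]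
  [IsManifold 𝓘(ℝ, Plane) ∞ S]
  {X₁ : OrientedRiemannianSurface M₁} {X₂ : OrientedRiemannianSurface M₂} {Φ : S → M₁ × M₂}
  {e e' : OpenPartialHomeomorph S Plane} {e₁ : OpenPartialHomeomorph M₁ Plane}
  {e₂ : OpenPartialHomeomorph M₂ Plane}

theorem coordRep_eq {φ : S → M₁} (hsub : e'.source ⊆ e.source) {z : Plane} (hz : z ∈ e'.target) :
    coordRep φ e' e₁ z = coordRep φ e e₁ (e (e'.symm z)) := by
  simp [coordRep, e.left_inv (hsub (e'.map_target hz))]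

/-- The effect of a change of coordinates `Θ` of the source on the differential. -/
theorem fderiv_coordRep_change {φ : S → M₁} (hφ : ContMDiff 𝓘(ℝ, Plane) 𝓘(ℝ, Plane) ∞ φ)
    (he' : e' ∈ IsManifold.maximalAtlas 𝓘(ℝ, Plane) ∞ S)
    (he₁ : e₁ ∈ IsManifold.maximalAtlas 𝓘(ℝ, Plane) ∞ M₁) {Θ : Plane → Plane}
    (hsub : e'.source ⊆ e.source) (hee' : ∀ q ∈ e'.source, e' q = Θ (e q)) {z : Plane}
    (hz : z ∈ e'.target) (hz₁ : φ (e'.symm z) ∈ e₁.source)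
    (hΘ : DifferentiableAt ℝ Θ (e (e'.symm z))) (v : Plane) :
    fderiv ℝ (coordRep φ e' e₁) z (fderiv ℝ Θ (e (e'.symm z)) v)
      = fderiv ℝ (coordRep φ e e₁) (e (e'.symm z)) v := by
  have hq := e'.map_target hz
  set y := e (e'.symm z) with hy
  have hΘy : Θ y = z := by rw [hy, ← hee' _ hq, e'.right_inv hz]
  have hev : coordRep φ e e₁ =ᶠ[nhds y] coordRep φ e' e₁ ∘ Θ := by
    have hN : e.target ∩ e.symm ⁻¹' e'.source ∈ nhds y :=
      (e.isOpen_inter_preimage_symm e'.open_source).mem_nhds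
        ⟨e.map_source (hsub hq), by rw [Set.mem_preimage, hy, e.left_inv (hsub hq)]; exact hq⟩
    filter_upwards [hN] with y' hy'
    have h1 : Θ y' = e' (e.symm y') := by rw [hee' _ hy'.2, e.right_inv hy'.1]
    simp [coordRep, h1, e'.left_inv hy'.2]
  have h1 : DifferentiableAt ℝ (coordRep φ e' e₁) (Θ y) := by
    rw [hΘy]
    exact (contDiffAt_coordRep hφ he' he₁ hz hz₁).differentiableAt (by simp)
  rw [hev.fderiv_eq, fderiv_comp y h1 hΘ, hΘy]
  rfl

/-- A product chart in which both factors have unit speed, defined on a square. -/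
structure IsUnitSpeedChart (X₁ : OrientedRiemannianSurface M₁) (X₂ : OrientedRiemannianSurface M₂)
    (Φ : S → M₁ × M₂) (e : OpenPartialHomeomorph S Plane)
    (e₁ : OpenPartialHomeomorph M₁ Plane) (e₂ : OpenPartialHomeomorph M₂ Plane) : Prop
    extends IsProductChart Φ e e₁ e₂ where
  target : ∃ x δ, 0 < δ ∧ e.target = square x δ
  unit₁ : ∀ z ∈ e.target, chartMetric 𝓘(ℝ, Plane) X₁.metric.inner e₁
    (coordRep (fun q => (Φ q).1) e e₁ z) (fderiv ℝ (coordRep (fun q => (Φ q).1) e e₁) z (bas 0))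
      (fderiv ℝ (coordRep (fun q => (Φ q).1) e e₁) z (bas 0)) = 1
  unit₂ : ∀ z ∈ e.target, chartMetric 𝓘(ℝ, Plane) X₂.metric.inner e₂
    (coordRep (fun q => (Φ q).2) e e₂ z) (fderiv ℝ (coordRep (fun q => (Φ q).2) e e₂) z (bas 1))
      (fderiv ℝ (coordRep (fun q => (Φ q).2) e e₂) z (bas 1)) = 1

theorem IsProductChart.of_source_subset (h : IsProductChart Φ e e₁ e₂)
    (hΦ : ContMDiff 𝓘(ℝ, Plane) (𝓘(ℝ, Plane).prod 𝓘(ℝ, Plane)) ∞ Φ)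
    (he' : e' ∈ IsManifold.maximalAtlas 𝓘(ℝ, Plane) ∞ S) (hsub : e'.source ⊆ e.source)
    (hee' : ⇑e' = e) : IsProductChart Φ e' e₁ e₂ := by
  refine ⟨he', h.mem_atlas₁, h.mem_atlas₂, fun q hq => h.mapsTo q (hsub hq), fun z hz => ?_,
    fun z hz => ?_⟩
  · have := fderiv_coordRep_change (contMDiff_fst_comp hΦ) he' h.mem_atlas₁ (Θ := id) hsub
      (fun q _ => by rw [hee']; rfl) hz (h.mapsTo _ (hsub (e'.map_target hz))).1
      differentiableAt_id (bas 1)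
    rwa [h.fst _ (e.map_source (hsub (e'.map_target hz))), fderiv_id] at this
  · have := fderiv_coordRep_change (contMDiff_snd_comp hΦ) he' h.mem_atlas₂ (Θ := id) hsub
      (fun q _ => by rw [hee']; rfl) hz (h.mapsTo _ (hsub (e'.map_target hz))).2
      differentiableAt_id (bas 0)
    rwa [h.snd _ (e.map_source (hsub (e'.map_target hz))), fderiv_id] at this

theorem exists_square_chart (he : e ∈ IsManifold.maximalAtlas 𝓘(ℝ, Plane) ∞ S) {p : S}
    (hp : p ∈ e.source) : ∃ e' ∈ IsManifold.maximalAtlas 𝓘(ℝ, Plane) ∞ S, p ∈ e'.source ∧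
      e'.source ⊆ e.source ∧ ⇑e' = e ∧ ∃ x δ, 0 < δ ∧ e'.target = square x δ := by
  obtain ⟨e', he', hp', hs, h1, δ, hδ, h2⟩ := exists_chart_square he hp Filter.univ_mem
  exact ⟨e', he', hp', fun q hq => (hs hq).1, h1, _, δ, hδ, h2⟩

theorem smooth_speed (X : OrientedRiemannianSurface M₁)
    (he₁ : e₁ ∈ IsManifold.maximalAtlas 𝓘(ℝ, Plane) ∞ M₁) {a : ℝ → Plane} {l r : ℝ}
    (ha : ContDiffOn ℝ ∞ a (Set.Ioo l r)) (hm : ∀ s ∈ Set.Ioo l r, a s ∈ e₁.target)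
    (h0 : ∀ s ∈ Set.Ioo l r, deriv a s ≠ 0) :
    ContDiffOn ℝ ∞ (fun s => √(chartMetric 𝓘(ℝ, Plane) X.metric.inner e₁ (a s) (deriv a s)
      (deriv a s))) (Set.Ioo l r) := by
  have hG := isRiemannianOn_chartMetric X he₁
  have hd : ContDiffOn ℝ ∞ (deriv a) (Set.Ioo l r) := ha.deriv_of_isOpen isOpen_Ioo (by simp)
  refine ContDiffOn.sqrt (((hG.smooth.comp ha hm).clm_apply hd).clm_apply hd) fun s hs => ?_
  exact (hG.pos _ (hm s hs) _ (h0 s hs)).ne'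

theorem inner_smul_eq_one {B : Plane →L[ℝ] Plane →L[ℝ] ℝ} {w u : Plane} (hB : 0 < B w w)
    (h : √(B w w) • u = w) : B u u = 1 := by
  have h1 : B w w = √(B w w) * √(B w w) * B u u := by
    conv_lhs => rw [← h]
    simp only [map_smul, smul_apply, smul_eq_mul]
    ring
  rw [Real.mul_self_sqrt hB.le] at h1
  exact (mul_eq_left₀ hB.ne').1 h1.symm

/-- Arc length parametrization of both factors. -/
theorem IsProductChart.exists_isUnitSpeedChart (h : IsProductChart Φ e e₁ e₂)
    (hΦ : IsLagrangianImmersion X₁ X₂ Φ) {p : S} (hp : p ∈ e.source) :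
    ∃ e', IsUnitSpeedChart X₁ X₂ Φ e' e₁ e₂ ∧ p ∈ e'.source := by
  obtain ⟨c, hc, hpc, hsub, hce, x, δ, hδ, hsq⟩ := exists_square_chart h.mem_atlas hp
  replace h := h.of_source_subset hΦ.smooth hc hsub hce
  have hs₁ := contMDiff_fst_comp hΦ.smooth
  have hs₂ := contMDiff_snd_comp hΦ.smooth
  clear hsub hce hp
  set f₁ := coordRep (fun q => (Φ q).1) c e₁ with hf₁
  set f₂ := coordRep (fun q => (Φ q).2) c e₂ with hf₂
  have hdom : ∀ z ∈ square x δ, z ∈ coordDomain Φ c e₁ e₂ := fun z hz =>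
    coordDomain_eq h.mapsTo (hsq ▸ hz)
  have hd₁ : ContDiffOn ℝ ∞ f₁ (square x δ) := fun z hz =>
    (contDiffAt_coordRep hs₁ hc h.mem_atlas₁ (hdom z hz).1 (hdom z hz).2.1).contDiffWithinAt
  have hd₂ : ContDiffOn ℝ ∞ f₂ (square x δ) := fun z hz =>
    (contDiffAt_coordRep hs₂ hc h.mem_atlas₂ (hdom z hz).1 (hdom z hz).2.2).contDiffWithinAt
  obtain ⟨a, ha, hfa⟩ := exists_factor hδ hd₁ (i := 0) (j := 1) (by simp)
    fun z hz => h.fst z (hsq ▸ hz)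
  obtain ⟨b, hb, hfb⟩ := exists_factor hδ hd₂ (i := 1) (j := 0) (by simp)
    fun z hz => h.snd z (hsq ▸ hz)
  have had : ∀ {s}, s ∈ Set.Ioo (x 0 - δ) (x 0 + δ) → DifferentiableAt ℝ a s := fun hs =>
    (ha.contDiffAt (isOpen_Ioo.mem_nhds hs)).differentiableAt (by simp)
  have hbd : ∀ {s}, s ∈ Set.Ioo (x 1 - δ) (x 1 + δ) → DifferentiableAt ℝ b s := fun hs =>
    (hb.contDiffAt (isOpen_Ioo.mem_nhds hs)).differentiableAt (by simp)
  have hda : ∀ z ∈ square x δ, ∀ v, fderiv ℝ f₁ z v = v 0 • deriv a (z 0) := fun z hz =>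
    fderiv_factor hfa hz (had (hz 0))
  have hdb : ∀ z ∈ square x δ, ∀ v, fderiv ℝ f₂ z v = v 1 • deriv b (z 1) := fun z hz =>
    fderiv_factor hfb hz (hbd (hz 1))
  have hx := mem_square_self x hδ
  have hpt : ∀ i : Fin 2, ∀ s ∈ Set.Ioo (x i - δ) (x i + δ), ∃ z ∈ square x δ, z i = s :=
    fun i s hs => ⟨_, square_add_smul hx hs, by simp⟩
  have ha0 : ∀ s ∈ Set.Ioo (x 0 - δ) (x 0 + δ), deriv a s ≠ 0 := by
    intro s hs h0
    obtain ⟨z, hz, rfl⟩ := hpt 0 s hs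
    have := coord_immersion (v := bas 0) hΦ hc h.mem_atlas₁ h.mem_atlas₂ (hdom z hz)
      (by rw [← hf₁, hda z hz, h0, smul_zero]) (h.snd z (hsq ▸ hz))
    simp at this
  have hb0 : ∀ s ∈ Set.Ioo (x 1 - δ) (x 1 + δ), deriv b s ≠ 0 := by
    intro s hs h0
    obtain ⟨z, hz, rfl⟩ := hpt 1 s hs
    have := coord_immersion (v := bas 1) hΦ hc h.mem_atlas₁ h.mem_atlas₂ (hdom z hz)
      (h.fst z (hsq ▸ hz)) (by rw [← hf₂, hdb z hz, h0, smul_zero])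
    simp at this
  have hma : ∀ s ∈ Set.Ioo (x 0 - δ) (x 0 + δ), a s ∈ e₁.target := by
    intro s hs
    obtain ⟨z, hz, rfl⟩ := hpt 0 s hs
    rw [← hfa z hz]
    exact e₁.map_source (hdom z hz).2.1
  have hmb : ∀ s ∈ Set.Ioo (x 1 - δ) (x 1 + δ), b s ∈ e₂.target := by
    intro s hs
    obtain ⟨z, hz, rfl⟩ := hpt 1 s hs
    rw [← hfb z hz]
    exact e₂.map_source (hdom z hz).2.2
  have hG₁ := isRiemannianOn_chartMetric X₁ h.mem_atlas₁
  have hG₂ := isRiemannianOn_chartMetric X₂ h.mem_atlas₂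
  obtain ⟨σ, hσ, hσd⟩ := exists_smooth_primitive (smooth_speed X₁ h.mem_atlas₁ ha hma ha0)
  obtain ⟨τ, hτ, hτd⟩ := exists_smooth_primitive (smooth_speed X₂ h.mem_atlas₂ hb hmb hb0)
  set V : ℝ → ℝ := fun s => √(chartMetric 𝓘(ℝ, Plane) X₁.metric.inner e₁ (a s) (deriv a s)
      (deriv a s)) with hV
  set W : ℝ → ℝ := fun s => √(chartMetric 𝓘(ℝ, Plane) X₂.metric.inner e₂ (b s) (deriv b s)
      (deriv b s)) with hW
  have hVp : ∀ s ∈ Set.Ioo (x 0 - δ) (x 0 + δ), 0 < V s := fun s hs =>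
    Real.sqrt_pos.2 (hG₁.pos _ (hma s hs) _ (ha0 s hs))
  have hWp : ∀ s ∈ Set.Ioo (x 1 - δ) (x 1 + δ), 0 < W s := fun s hs =>
    Real.sqrt_pos.2 (hG₂.pos _ (hmb s hs) _ (hb0 s hs))
  -- the arc lengths `σ` and `τ` of the two factors as new coordinates
  set Θ : Plane → Plane := fun z => !₂[σ (z 0), τ (z 1)] with hΘ
  have hΘs : ContDiffOn ℝ ∞ Θ (square x δ) := by
    rw [contDiffOn_euclidean]
    intro l
    fin_cases l
    · exact hσ.comp (EuclideanSpace.proj 0 : Plane →L[ℝ] ℝ).contDiff.contDiffOn fun z hz => hz 0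
    · exact hτ.comp (EuclideanSpace.proj 1 : Plane →L[ℝ] ℝ).contDiff.contDiffOn fun z hz => hz 1
  have hΘd : ∀ z ∈ square x δ, DifferentiableAt ℝ Θ z := fun z hz =>
    (hΘs.contDiffAt ((isOpen_square x δ).mem_nhds hz)).differentiableAt (by simp)
  have hΘf : ∀ z ∈ square x δ, ∀ v : Plane,
      fderiv ℝ Θ z v = (V (z 0) * v 0) • bas 0 + (W (z 1) * v 1) • bas 1 := by
    intro z hz v
    have h0 := (hσd _ (hz 0)).hasFDerivAt.comp z
      (EuclideanSpace.proj 0 : Plane →L[ℝ] ℝ).hasFDerivAt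
    have h1 := (hτd _ (hz 1)).hasFDerivAt.comp z
      (EuclideanSpace.proj 1 : Plane →L[ℝ] ℝ).hasFDerivAt
    have k0 := (EuclideanSpace.proj 0 : Plane →L[ℝ] ℝ).hasFDerivAt.comp z (hΘd z hz).hasFDerivAt
    have k1 := (EuclideanSpace.proj 1 : Plane →L[ℝ] ℝ).hasFDerivAt.comp z (hΘd z hz).hasFDerivAt
    have e0 : fderiv ℝ Θ z v 0 = v 0 * V (z 0) := congrArg (fun L => L v) (k0.unique h0)
    have e1 : fderiv ℝ Θ z v 1 = v 1 * W (z 1) := congrArg (fun L => L v) (k1.unique h1)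
    ext l
    fin_cases l
    · simpa [mul_comm] using e0
    · simpa [mul_comm] using e1
  obtain ⟨c', hc', hpc', hsub', hO, hcc'⟩ := exists_chart_comp hc (isOpen_square x δ) hΘs hpc
    (hsq ▸ c.map_source hpc) (fun v hv => by
      have hz : c p ∈ square x δ := hsq ▸ c.map_source hpc
      rw [hΘf _ hz] at hv
      have h0 := congrArg (fun z : Plane => z 0) hv
      have h1 := congrArg (fun z : Plane => z 1) hv
      simp [(hVp _ (hz 0)).ne', (hWp _ (hz 1)).ne'] at h0 h1
      ext l; fin_cases l <;> simp [h0, h1])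
  obtain ⟨c'', hc'', hpc'', hsub'', hc''e, htarget⟩ := exists_square_chart hc' hpc'
  have hs : c''.source ⊆ c.source := hsub''.trans hsub'
  have hcc'' : ∀ q ∈ c''.source, c'' q = Θ (c q) := fun q hq => by
    rw [hc''e, hcc' q (hsub'' hq)]
  have hmaps : ∀ q ∈ c''.source, (Φ q).1 ∈ e₁.source ∧ (Φ q).2 ∈ e₂.source := fun q hq =>
    h.mapsTo q (hs hq)
  have hy : ∀ z ∈ c''.target, c (c''.symm z) ∈ square x δ := fun z hz =>
    hO _ (hsub'' (c''.map_target hz))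
  have d₁ : ∀ z (hz : z ∈ c''.target) (v : Plane), fderiv ℝ (coordRep (fun q => (Φ q).1) c'' e₁) z
      ((V (c (c''.symm z) 0) * v 0) • bas 0 + (W (c (c''.symm z) 1) * v 1) • bas 1)
      = v 0 • deriv a (c (c''.symm z) 0) := by
    intro z hz v
    rw [← hda _ (hy z hz), ← hΘf _ (hy z hz)]
    exact fderiv_coordRep_change hs₁ hc'' h.mem_atlas₁ hs hcc'' hz
      (hmaps _ (c''.map_target hz)).1 (hΘd _ (hy z hz)) v
  have d₂ : ∀ z (hz : z ∈ c''.target) (v : Plane), fderiv ℝ (coordRep (fun q => (Φ q).2) c'' e₂) z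
      ((V (c (c''.symm z) 0) * v 0) • bas 0 + (W (c (c''.symm z) 1) * v 1) • bas 1)
      = v 1 • deriv b (c (c''.symm z) 1) := by
    intro z hz v
    rw [← hdb _ (hy z hz), ← hΘf _ (hy z hz)]
    exact fderiv_coordRep_change hs₂ hc'' h.mem_atlas₂ hs hcc'' hz
      (hmaps _ (c''.map_target hz)).2 (hΘd _ (hy z hz)) v
  refine ⟨c'', ⟨⟨hc'', h.mem_atlas₁, h.mem_atlas₂, hmaps, fun z hz => ?_, fun z hz => ?_⟩,
    htarget, fun z hz => ?_, fun z hz => ?_⟩, hpc''⟩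
  · have := d₁ z hz (bas 1)
    simpa [(hWp _ (hy z hz 1)).ne'] using this
  · have := d₂ z hz (bas 0)
    simpa [(hVp _ (hy z hz 0)).ne'] using this
  · have := d₁ z hz (bas 0)
    rw [coordRep_eq hs hz, ← hf₁, hfa _ (hy z hz)]
    refine inner_smul_eq_one (w := deriv a (c (c''.symm z) 0))
      (hG₁.pos _ (hma _ (hy z hz 0)) _ (ha0 _ (hy z hz 0))) ?_
    simpa using this
  · have := d₂ z hz (bas 1)
    rw [coordRep_eq hs hz, ← hf₂, hfb _ (hy z hz)]
    refine inner_smul_eq_one (w := deriv b (c (c''.symm z) 1))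
      (hG₂.pos _ (hmb _ (hy z hz 1)) _ (hb0 _ (hy z hz 1))) ?_
    simpa using this

end ArcLength

/-! ### The mean curvature vector of a product of two curves -/

section ProductOfCurves

theorem contDiffOn_acceleration {G : Plane → Plane →L[ℝ] Plane →L[ℝ] ℝ} {U : Set Plane}
    (hG : IsRiemannianOn G U) {a : ℝ → Plane} {l r : ℝ} (ha : ContDiffOn ℝ ∞ a (Set.Ioo l r))
    (haU : ∀ s ∈ Set.Ioo l r, a s ∈ U) :
    ContDiffOn ℝ ∞ (fun s => covDerivAlong G a (deriv a) s (1 : ℝ)) (Set.Ioo l r) := by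
  have h1 := ha.deriv_of_isOpen isOpen_Ioo (m := ∞) (by simp)
  have h2 := h1.deriv_of_isOpen isOpen_Ioo (m := ∞) (by simp)
  simp only [covDerivAlong_deriv]
  exact h2.add (((hG.contDiffOn_christoffelBilin.comp ha haU).clm_apply h1).clm_apply h1)

theorem covDerivAlong_const_smul {G : Plane → Plane →L[ℝ] Plane →L[ℝ] ℝ} {a A : ℝ → Plane} {s : ℝ}
    (c : ℝ) (hA : DifferentiableAt ℝ A s) (u : ℝ) :
    covDerivAlong G a (fun s => c • A s) s u = c • covDerivAlong G a A s u := by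
  rw [covDerivAlong, covDerivAlong, fderiv_fun_const_smul hA, christoffel_smul_right, smul_add]
  rfl

variable {G₁ G₂ : Plane → Plane →L[ℝ] Plane →L[ℝ] ℝ} {U₁ U₂ : Set Plane}
  (h₁ : IsRiemannianOn G₁ U₁) (h₂ : IsRiemannianOn G₂ U₂)
  {GG : Plane × Plane → (Plane × Plane) →L[ℝ] (Plane × Plane) →L[ℝ] ℝ}
  (hGG : ∀ q ∈ U₁ ×ˢ U₂, GG q = blockMetric G₁ G₂ q) {F : Plane → Plane × Plane}
  {x : Plane} {δ : ℝ} {a b : ℝ → Plane}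
  (ha : ContDiffOn ℝ ∞ a (Set.Ioo (x 0 - δ) (x 0 + δ)))
  (hb : ContDiffOn ℝ ∞ b (Set.Ioo (x 1 - δ) (x 1 + δ)))
  (haU : ∀ s ∈ Set.Ioo (x 0 - δ) (x 0 + δ), a s ∈ U₁)
  (hbU : ∀ s ∈ Set.Ioo (x 1 - δ) (x 1 + δ), b s ∈ U₂)
  (hF : ∀ z ∈ square x δ, F z = (a (z 0), b (z 1)))

omit h₁ h₂ hGG ha hb haU hbU in
theorem fderiv_pair {α β : ℝ → Plane} {z : Plane} (hα : DifferentiableAt ℝ α (z 0))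
    (hβ : DifferentiableAt ℝ β (z 1)) (hF : ∀ z ∈ square x δ, F z = (α (z 0), β (z 1)))
    (hz : z ∈ square x δ) (v : Plane) :
    fderiv ℝ F z v = (v 0 • deriv α (z 0), v 1 • deriv β (z 1)) := by
  have h1 := hα.hasFDerivAt.comp z (EuclideanSpace.proj 0 : Plane →L[ℝ] ℝ).hasFDerivAt
  have h2 := hβ.hasFDerivAt.comp z (EuclideanSpace.proj 1 : Plane →L[ℝ] ℝ).hasFDerivAt
  have h3 := (h1.prodMk h2).congr_of_eventuallyEq
    (Filter.eventuallyEq_of_mem ((isOpen_square x δ).mem_nhds hz) hF)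
  rw [h3.fderiv]
  change (fderiv ℝ α (z 0) (v 0), fderiv ℝ β (z 1) (v 1)) = _
  rw [fderiv_eq_smul_deriv, fderiv_eq_smul_deriv]

include h₁ h₂ hGG ha hb haU hbU hF

/-- The ambient covariant derivative of a field with separated variables. -/
theorem covDerivAlong_pair {V : Plane → Plane × Plane} {α β : ℝ → Plane} {z : Plane}
    (hz : z ∈ square x δ) (hα : DifferentiableAt ℝ α (z 0)) (hβ : DifferentiableAt ℝ β (z 1))
    (hV : ∀ z ∈ square x δ, V z = (α (z 0), β (z 1))) (v : Plane) :
    covDerivAlong GG F V z v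
      = (v 0 • covDerivAlong G₁ a α (z 0) (1 : ℝ), v 1 • covDerivAlong G₂ b β (z 1) (1 : ℝ)) := by
  have hq : F z ∈ U₁ ×ˢ U₂ := by rw [hF z hz]; exact ⟨haU _ (hz 0), hbU _ (hz 1)⟩
  have had := (ha.contDiffAt (isOpen_Ioo.mem_nhds (hz 0))).differentiableAt (by simp)
  have hbd := (hb.contDiffAt (isOpen_Ioo.mem_nhds (hz 1))).differentiableAt (by simp)
  have hc : ∀ v w, christoffel GG (F z) v w
      = (christoffel G₁ (a (z 0)) v.1 w.1, christoffel G₂ (b (z 1)) v.2 w.2) := by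
    intro v w
    rw [christoffel_congr (G' := blockMetric G₁ G₂) (Filter.eventuallyEq_of_mem
      ((h₁.isOpen.prod h₂.isOpen).mem_nhds hq) hGG), christoffel_block h₁ h₂ hq, hF z hz]
  simp only [covDerivAlong, hc, fderiv_pair hα hβ hV hz, fderiv_pair had hbd hF hz,
    hV z hz, christoffel_smul_left, fderiv_eq_smul_deriv, one_smul, Prod.mk_add_mk, smul_add]

variable (hau : ∀ s ∈ Set.Ioo (x 0 - δ) (x 0 + δ), G₁ (a s) (deriv a s) (deriv a s) = 1)
  (hbu : ∀ s ∈ Set.Ioo (x 1 - δ) (x 1 + δ), G₂ (b s) (deriv b s) (deriv b s) = 1)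

include hau hbu

theorem inducedMetric_pair {z : Plane} (hz : z ∈ square x δ) (v w : Plane) :
    inducedMetric GG F z v w = v 0 * w 0 + v 1 * w 1 := by
  have hq : (a (z 0), b (z 1)) ∈ U₁ ×ˢ U₂ := ⟨haU _ (hz 0), hbU _ (hz 1)⟩
  have had := (ha.contDiffAt (isOpen_Ioo.mem_nhds (hz 0))).differentiableAt (by simp)
  have hbd := (hb.contDiffAt (isOpen_Ioo.mem_nhds (hz 1))).differentiableAt (by simp)
  simp [inducedMetric, pullbackForm, fderiv_pair had hbd hF hz, hF z hz, hGG _ hq,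
    hau _ (hz 0), hbu _ (hz 1)]
  ring

/-- For a product of unit speed curves the induced metric is flat, so that the mean curvature vector
is half the sum of the accelerations. -/
theorem meanCurvature_pair {z : Plane} (hz : z ∈ square x δ) :
    meanCurvature GG F z = (1 / 2 : ℝ) • (covDerivAlong G₁ a (deriv a) (z 0) (1 : ℝ),
      covDerivAlong G₂ b (deriv b) (z 1) (1 : ℝ)) := by
  have hg : ∀ z ∈ square x δ, ∀ v w, inducedMetric GG F z v w = v 0 * w 0 + v 1 * w 1 :=
    fun z hz => inducedMetric_pair h₁ h₂ hGG ha hb haU hbU hF hau hbu hz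
  have hΓ : ∀ v w, christoffel (inducedMetric GG F) z v w = 0 := by
    intro v w
    refine christoffel_eq_zero_of_eventually_const (B := inducedMetric GG F z) ?_ v w
    filter_upwards [(isOpen_square x δ).mem_nhds hz] with y hy
    ext v w
    rw [hg y hy, hg z hz]
  have hda := ha.deriv_of_isOpen isOpen_Ioo (m := ∞) (by simp)
  have hdb := hb.deriv_of_isOpen isOpen_Ioo (m := ∞) (by simp)
  have had : ∀ {z}, z ∈ square x δ → DifferentiableAt ℝ a (z 0) := fun hz =>
    (ha.contDiffAt (isOpen_Ioo.mem_nhds (hz 0))).differentiableAt (by simp)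
  have hbd : ∀ {z}, z ∈ square x δ → DifferentiableAt ℝ b (z 1) := fun hz =>
    (hb.contDiffAt (isOpen_Ioo.mem_nhds (hz 1))).differentiableAt (by simp)
  have hda' := (hda.contDiffAt (isOpen_Ioo.mem_nhds (hz 0))).differentiableAt (by simp)
  have hdb' := (hdb.contDiffAt (isOpen_Ioo.mem_nhds (hz 1))).differentiableAt (by simp)
  have s0 : secondFundamentalForm GG F z (bas 0) (bas 0)
      = (covDerivAlong G₁ a (deriv a) (z 0) (1 : ℝ), 0) := by
    rw [secondFundamentalForm, hΓ, map_zero, sub_zero, covDerivAlong_pair h₁ h₂ hGG ha hb haU hbU hF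
      hz hda' (differentiableAt_const (0 : Plane)) (fun z hz => by
        rw [fderiv_pair (had hz) (hbd hz) hF hz]; simp)]
    simp
  have s1 : secondFundamentalForm GG F z (bas 1) (bas 1)
      = (0, covDerivAlong G₂ b (deriv b) (z 1) (1 : ℝ)) := by
    rw [secondFundamentalForm, hΓ, map_zero, sub_zero, covDerivAlong_pair h₁ h₂ hGG ha hb haU hbU hF
      hz (differentiableAt_const (0 : Plane)) hdb' (fun z hz => by
        rw [fderiv_pair (had hz) (hbd hz) hF hz]; simp)]
    simp
  have hM : (Matrix.of fun k l : Fin 2 => inducedMetric GG F z (bas k) (bas l)) = 1 := by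
    ext k l
    rw [Matrix.of_apply, hg z hz]
    fin_cases k <;> fin_cases l <;> simp
  rw [meanCurvature, hM, inv_one]
  simp [Fin.sum_univ_two, s0, s1]

/-- The mean curvature vector of a product of curves is parallel only if `∇_{a'} ∇_{a'} a'` is
tangent to `a`, and likewise for the other factor. -/
theorem normal_derivative_eq_zero
    (hpar : ∀ z ∈ square x δ, ∀ (u : Plane) (n : Plane × Plane),
      (∀ v : Plane, GG (F z) (fderiv ℝ F z v) n = 0) →
      GG (F z) (covDerivAlong GG F (meanCurvature GG F) z u) n = 0)
    {z : Plane} (hz : z ∈ square x δ) :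
    (∀ n, G₁ (a (z 0)) (deriv a (z 0)) n = 0 → G₁ (a (z 0)) (covDerivAlong G₁ a
      (fun s => covDerivAlong G₁ a (deriv a) s (1 : ℝ)) (z 0) (1 : ℝ)) n = 0) ∧
    (∀ n, G₂ (b (z 1)) (deriv b (z 1)) n = 0 → G₂ (b (z 1)) (covDerivAlong G₂ b
      (fun s => covDerivAlong G₂ b (deriv b) s (1 : ℝ)) (z 1) (1 : ℝ)) n = 0) := by
  have hA := ((contDiffOn_acceleration h₁ ha haU).contDiffAt
    (isOpen_Ioo.mem_nhds (hz 0))).differentiableAt (by simp)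
  have hB := ((contDiffOn_acceleration h₂ hb hbU).contDiffAt
    (isOpen_Ioo.mem_nhds (hz 1))).differentiableAt (by simp)
  have had := (ha.contDiffAt (isOpen_Ioo.mem_nhds (hz 0))).differentiableAt (by simp)
  have hbd := (hb.contDiffAt (isOpen_Ioo.mem_nhds (hz 1))).differentiableAt (by simp)
  have hH : ∀ u, covDerivAlong GG F (meanCurvature GG F) z u = _ :=
    covDerivAlong_pair h₁ h₂ hGG ha hb haU hbU hF hz (hA.const_smul (1 / 2 : ℝ))
      (hB.const_smul (1 / 2 : ℝ))
      fun z hz => meanCurvature_pair h₁ h₂ hGG ha hb haU hbU hF hau hbu hz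
  have hq : (a (z 0), b (z 1)) ∈ U₁ ×ˢ U₂ := ⟨haU _ (hz 0), hbU _ (hz 1)⟩
  have key : ∀ (u : Plane) (n : Plane × Plane), G₁ (a (z 0)) (deriv a (z 0)) n.1 = 0 →
      G₂ (b (z 1)) (deriv b (z 1)) n.2 = 0 → _ := fun u n hn₁ hn₂ =>
    hpar z hz u n (fun v => by
      rw [fderiv_pair had hbd hF hz, hF z hz, hGG _ hq]
      simp [hn₁, hn₂])
  constructor
  · intro n hn
    have := key (bas 0) (n, 0) hn (map_zero _)
    rw [hH, hF z hz, hGG _ hq] at this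
    change blockMetric G₁ G₂ _ (_ • covDerivAlong G₁ a (fun s => (1 / 2 : ℝ) •
      covDerivAlong G₁ a (deriv a) s (1 : ℝ)) _ _, _) _ = 0 at this
    rw [covDerivAlong_const_smul _ hA] at this
    simpa using this
  · intro n hn
    have := key (bas 1) (0, n) (map_zero _) hn
    rw [hH, hF z hz, hGG _ hq] at this
    change blockMetric G₁ G₂ _ (_, _ • covDerivAlong G₂ b (fun s => (1 / 2 : ℝ) •
      covDerivAlong G₂ b (deriv b) s (1 : ℝ)) _ _) _ = 0 at this
    rw [covDerivAlong_const_smul _ hB] at this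
    simpa using this

end ProductOfCurves

/-! ### Constancy of the geodesic curvature -/

/-- A unit speed curve with unit normal `N` such that `∇ ∇ a'` has no normal component has constant
geodesic curvature. -/
theorem exists_const_curvature {G : Plane → Plane →L[ℝ] Plane →L[ℝ] ℝ} {U : Set Plane}
    (hG : IsRiemannianOn G U) {a N : ℝ → Plane} {l r : ℝ} (ha : ContDiffOn ℝ ∞ a (Set.Ioo l r))
    (hN : ContDiffOn ℝ ∞ N (Set.Ioo l r)) (haU : ∀ s ∈ Set.Ioo l r, a s ∈ U)
    (hNN : ∀ s ∈ Set.Ioo l r, G (a s) (N s) (N s) = 1)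
    (hA : ∀ s ∈ Set.Ioo l r, covDerivAlong G a (deriv a) s (1 : ℝ)
      = G (a s) (covDerivAlong G a (deriv a) s (1 : ℝ)) (N s) • N s)
    (hDA : ∀ s ∈ Set.Ioo l r, G (a s) (covDerivAlong G a
      (fun s => covDerivAlong G a (deriv a) s (1 : ℝ)) s (1 : ℝ)) (N s) = 0) :
    ∃ k : ℝ, ∀ s ∈ Set.Ioo l r, covDerivAlong G a (deriv a) s (1 : ℝ) = k • N s := by
  set A := fun s => covDerivAlong G a (deriv a) s (1 : ℝ) with hAdef
  have hAs : ContDiffOn ℝ ∞ A (Set.Ioo l r) := contDiffOn_acceleration hG ha haU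
  have hd : ∀ {f : ℝ → Plane}, ContDiffOn ℝ ∞ f (Set.Ioo l r) → ∀ s ∈ Set.Ioo l r,
      DifferentiableAt ℝ f s := fun hf s hs =>
    (hf.contDiffAt (isOpen_Ioo.mem_nhds hs)).differentiableAt (by simp)
  -- `κ = G(A, N)` has derivative `G(∇A, N) + G(A, ∇N)`, and `∇N` is orthogonal to `N`
  have hκ : Set.EqOn (deriv fun s => G (a s) (A s) (N s)) 0 (Set.Ioo l r) := by
    intro s hs
    have h1 := hG.fderiv_inner_along (haU s hs) (hd ha s hs) (hd hAs s hs) (hd hN s hs) (1 : ℝ)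
    have h2 := hG.fderiv_inner_along (haU s hs) (hd ha s hs) (hd hN s hs) (hd hN s hs) (1 : ℝ)
    have h3 : (fun s => G (a s) (N s) (N s)) =ᶠ[nhds s] fun _ => 1 :=
      Filter.eventuallyEq_of_mem (isOpen_Ioo.mem_nhds hs) hNN
    rw [h3.fderiv_eq, fderiv_const_apply, hG.symm _ (haU s hs) _ (N s)] at h2
    have h4 : G (a s) (N s) (covDerivAlong G a N s (1 : ℝ)) = 0 := by
      have : (0 : ℝ →L[ℝ] ℝ) (1 : ℝ) = 0 := rfl
      linarith
    rw [hDA s hs, show A s = G (a s) (A s) (N s) • N s from hA s hs, map_smul, smul_apply, h4,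
      smul_zero, add_zero] at h1
    simpa using h1
  have hκd : DifferentiableOn ℝ (fun s => G (a s) (A s) (N s)) (Set.Ioo l r) :=
    (((hG.smooth.comp ha haU).clm_apply hAs).clm_apply hN).differentiableOn (by simp)
  obtain ⟨k, hk⟩ := isOpen_Ioo.exists_is_const_of_deriv_eq_zero isPreconnected_Ioo hκd hκ
  exact ⟨k, fun s hs => by rw [hA s hs]; exact congrArg (· • N s) (hk s hs)⟩

/-- The normal component of a vector orthogonal to a unit vector `w`. -/
theorem eq_smul_chartJ_of_orthogonal {M : Type*} [TopologicalSpace M] [ChartedSpace Plane M]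
    [IsManifold 𝓘(ℝ, Plane) ∞ M] (X : OrientedRiemannianSurface M)
    {e : OpenPartialHomeomorph M Plane} (he : e ∈ IsManifold.maximalAtlas 𝓘(ℝ, Plane) ∞ M)
    {y w v : Plane} (hy : y ∈ e.target)
    (hw : chartMetric 𝓘(ℝ, Plane) X.metric.inner e y w w = 1)
    (hv : chartMetric 𝓘(ℝ, Plane) X.metric.inner e y v w = 0) :
    v = chartMetric 𝓘(ℝ, Plane) X.metric.inner e y v (chartJ X e y w) • chartJ X e y w := by
  have hG := isRiemannianOn_chartMetric X he
  set B := chartMetric 𝓘(ℝ, Plane) X.metric.inner e y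
  set J := chartJ X e y w
  have hJJ : B J J = 1 := by rw [← hw]; exact chartJ_isometry X he hy w w
  have hww : chartMetric 𝓘(ℝ, Plane) X.kahlerForm e y w w = 0 := by
    rw [chartKahler_apply X he hy]; ring
  have hJw : B J w = 0 := (chartMetric_chartJ X he hy w w).trans hww
  set Y := v - B v J • J with hY
  have h1 : B Y w = 0 := by simp [hY, hv, hJw]
  have h2 : B J Y = 0 := by simp [hY, hJJ, hG.symm y hy J v, B]
  have hdet := det_eq_zero_of_kahler X he hy (v := w) (w := Y)
    ((chartMetric_chartJ X he hy w Y).symm.trans h2)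
  -- `Y` is proportional to `w` because `B(Jw, Y) = 0`, and orthogonal to it
  have h3 : ∀ i : Fin 2, w i * B Y Y = 0 := by
    intro i
    have : w i • Y = Y i • w := by
      ext l
      fin_cases i <;> fin_cases l <;> simp <;> linarith
    have h4 := congrArg (B Y) this
    rwa [map_smul, map_smul, h1, smul_zero] at h4
  have hYY : B Y Y = 0 := by
    by_contra h0
    have hw0 : w = 0 := by
      ext i
      simpa [h0] using h3 i
    rw [hw0] at hw
    simp at hw
  have hY0 : Y = 0 := by
    by_contra h0
    exact (hG.pos y hy Y h0).ne' hYY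
  rwa [hY, sub_eq_zero] at hY0

/-! ### The local product decomposition -/

theorem isCurveOfConstantCurvature_of_coordinates {M : Type*} [TopologicalSpace M]
    [ChartedSpace Plane M] [IsManifold 𝓘(ℝ, Plane) ∞ M] (X : OrientedRiemannianSurface M)
    {e : OpenPartialHomeomorph M Plane} (he : e ∈ IsManifold.maximalAtlas 𝓘(ℝ, Plane) ∞ M)
    {a : ℝ → Plane} {l r k : ℝ} (ha : ContDiffOn ℝ ∞ a (Set.Ioo l r))
    (hat : ∀ s ∈ Set.Ioo l r, a s ∈ e.target)
    (hau : ∀ s ∈ Set.Ioo l r,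
      chartMetric 𝓘(ℝ, Plane) X.metric.inner e (a s) (deriv a s) (deriv a s) = 1)
    (hk : ∀ s ∈ Set.Ioo l r, covDerivAlong (chartMetric 𝓘(ℝ, Plane) X.metric.inner e) a (deriv a) s
      (1 : ℝ) = k • chartJ X e (a s) (deriv a s)) :
    IsCurveOfConstantCurvature 𝓘(ℝ, Plane) X.metric.inner X.J (Set.Ioo l r) (e.symm ∘ a) k := by
  refine isCurveOfConstantCurvature_of_curveEqAt isOpen_Ioo
    ((contMDiffOn_symm_of_mem_maximalAtlas he).comp ha.contMDiffOn hat) fun s hs =>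
      ⟨e, he, e.map_target (hat s hs), ?_⟩
  have h1 : e ∘ e.symm ∘ a =ᶠ[nhds s] a := Filter.eventuallyEq_of_mem (isOpen_Ioo.mem_nhds hs)
    fun t ht => e.right_inv (hat t ht)
  have h2 : e ((e.symm ∘ a) s) = a s := e.right_inv (hat s hs)
  refine ⟨?_, ?_⟩
  · rw [h2, h1.deriv_eq, hau s hs]
  · rw [h2, h1.deriv_eq, h1.deriv.deriv_eq, ← covDerivAlong_deriv, hk s hs]

section LocalProduct

variable {M₁ M₂ S : Type*} [TopologicalSpace M₁] [ChartedSpace Plane M₁]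
  [IsManifold 𝓘(ℝ, Plane) ∞ M₁] [TopologicalSpace M₂] [ChartedSpace Plane M₂]
  [IsManifold 𝓘(ℝ, Plane) ∞ M₂] [TopologicalSpace S] [ChartedSpace Plane S]
  [IsManifold 𝓘(ℝ, Plane) ∞ S]
  {X₁ : OrientedRiemannianSurface M₁} {X₂ : OrientedRiemannianSurface M₂} {Φ : S → M₁ × M₂}
  {e : OpenPartialHomeomorph S Plane} {e₁ : OpenPartialHomeomorph M₁ Plane}
  {e₂ : OpenPartialHomeomorph M₂ Plane}

/-- A unit speed curve whose second covariant derivative `∇ ∇ a'` is tangent to it has constant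
geodesic curvature. -/
theorem exists_normal_curvature (X : OrientedRiemannianSurface M₁)
    (he₁ : e₁ ∈ IsManifold.maximalAtlas 𝓘(ℝ, Plane) ∞ M₁)
    {a : ℝ → Plane} {l r : ℝ} (ha : ContDiffOn ℝ ∞ a (Set.Ioo l r))
    (hat : ∀ s ∈ Set.Ioo l r, a s ∈ e₁.target)
    (hau : ∀ s ∈ Set.Ioo l r,
      chartMetric 𝓘(ℝ, Plane) X.metric.inner e₁ (a s) (deriv a s) (deriv a s) = 1)
    (hDA : ∀ s ∈ Set.Ioo l r, ∀ n,
      chartMetric 𝓘(ℝ, Plane) X.metric.inner e₁ (a s) (deriv a s) n = 0 →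
      chartMetric 𝓘(ℝ, Plane) X.metric.inner e₁ (a s)
        (covDerivAlong (chartMetric 𝓘(ℝ, Plane) X.metric.inner e₁) a (fun s =>
          covDerivAlong (chartMetric 𝓘(ℝ, Plane) X.metric.inner e₁) a (deriv a) s (1 : ℝ)) s
          (1 : ℝ)) n = 0) :
    ∃ k, IsCurveOfConstantCurvature 𝓘(ℝ, Plane) X.metric.inner X.J (Set.Ioo l r)
      (e₁.symm ∘ a) k := by
  have hG := isRiemannianOn_chartMetric X he₁
  have hd := ha.deriv_of_isOpen isOpen_Ioo (m := ∞) (by simp)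
  have hN : ContDiffOn ℝ ∞ (fun s => chartJ X e₁ (a s) (deriv a s)) (Set.Ioo l r) :=
    ((contDiffOn_chartJ X he₁).comp ha hat).clm_apply hd
  have hda : ∀ {f : ℝ → Plane}, ContDiffOn ℝ ∞ f (Set.Ioo l r) → ∀ s ∈ Set.Ioo l r,
      DifferentiableAt ℝ f s := fun hf s hs =>
    (hf.contDiffAt (isOpen_Ioo.mem_nhds hs)).differentiableAt (by simp)
  obtain ⟨k, hk⟩ := exists_const_curvature hG ha hN hat
    (fun s hs => (chartJ_isometry X he₁ (hat s hs) _ _).trans (hau s hs))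
    (fun s hs => eq_smul_chartJ_of_orthogonal X he₁ (hat s hs) (hau s hs) (by
      have h1 := hG.fderiv_inner_along (hat s hs) (hda ha s hs) (hda hd s hs) (hda hd s hs) (1 : ℝ)
      have h3 : (fun s => chartMetric 𝓘(ℝ, Plane) X.metric.inner e₁ (a s) (deriv a s) (deriv a s))
        =ᶠ[nhds s] fun _ => 1 := Filter.eventuallyEq_of_mem (isOpen_Ioo.mem_nhds hs) hau
      rw [h3.fderiv_eq, fderiv_const_apply, hG.symm _ (hat s hs) (deriv a s)] at h1
      have : (0 : ℝ →L[ℝ] ℝ) (1 : ℝ) = 0 := rfl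
      linarith))
    (fun s hs => hDA s hs _ (by
      rw [hG.symm _ (hat s hs), chartMetric_chartJ X he₁ (hat s hs),
        chartKahler_apply X he₁ (hat s hs)]
      ring))
  exact ⟨k, isCurveOfConstantCurvature_of_coordinates X he₁ ha hat hau hk⟩

/-- In the chart `e`, whose image is a square, `Φ` is the product of the curves `α` and `β`, which
have constant curvatures. -/
def IsLocalProduct (X₁ : OrientedRiemannianSurface M₁) (X₂ : OrientedRiemannianSurface M₂)
    (Φ : S → M₁ × M₂) (e : OpenPartialHomeomorph S Plane) (x : Plane) (δ : ℝ) (α : ℝ → M₁)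
    (β : ℝ → M₂) (k₁ k₂ : ℝ) : Prop :=
  e ∈ IsManifold.maximalAtlas 𝓘(ℝ, Plane) ∞ S ∧ 0 < δ ∧ e.target = square x δ ∧
  IsCurveOfConstantCurvature 𝓘(ℝ, Plane) X₁.metric.inner X₁.J
    (Set.Ioo (x 0 - δ) (x 0 + δ)) α k₁ ∧
  IsCurveOfConstantCurvature 𝓘(ℝ, Plane) X₂.metric.inner X₂.J
    (Set.Ioo (x 1 - δ) (x 1 + δ)) β k₂ ∧
  ∀ q ∈ e.source, Φ q = (α (e q 0), β (e q 1))

/-- In coordinates that are arc lengths of both factors, the parallel mean curvature condition says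
that both factors have constant geodesic curvature. -/
theorem IsUnitSpeedChart.exists_isLocalProduct (h : IsUnitSpeedChart X₁ X₂ Φ e e₁ e₂)
    (hΦ : IsLagrangianImmersion X₁ X₂ Φ)
    (hpar : HasParallelMeanCurvature (𝓘(ℝ, Plane).prod 𝓘(ℝ, Plane)) (prodMetric X₁ X₂) Φ) :
    ∃ x δ α β k₁ k₂, IsLocalProduct X₁ X₂ Φ e x δ α β k₁ k₂ := by
  obtain ⟨x, δ, hδ, hsq⟩ := h.target
  have hs₁ := contMDiff_fst_comp hΦ.smooth
  have hs₂ := contMDiff_snd_comp hΦ.smooth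
  set f₁ := coordRep (fun q => (Φ q).1) e e₁ with hf₁
  set f₂ := coordRep (fun q => (Φ q).2) e e₂ with hf₂
  have hdom : ∀ z ∈ square x δ, z ∈ coordDomain Φ e e₁ e₂ := fun z hz =>
    coordDomain_eq h.mapsTo (hsq ▸ hz)
  have hd₁ : ContDiffOn ℝ ∞ f₁ (square x δ) := fun z hz =>
    (contDiffAt_coordRep hs₁ h.mem_atlas h.mem_atlas₁ (hdom z hz).1
      (hdom z hz).2.1).contDiffWithinAt
  have hd₂ : ContDiffOn ℝ ∞ f₂ (square x δ) := fun z hz =>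
    (contDiffAt_coordRep hs₂ h.mem_atlas h.mem_atlas₂ (hdom z hz).1
      (hdom z hz).2.2).contDiffWithinAt
  obtain ⟨a, ha, hfa⟩ := exists_factor hδ hd₁ (i := 0) (j := 1) (by simp)
    fun z hz => h.fst z (hsq ▸ hz)
  obtain ⟨b, hb, hfb⟩ := exists_factor hδ hd₂ (i := 1) (j := 0) (by simp)
    fun z hz => h.snd z (hsq ▸ hz)
  have hda : ∀ z ∈ square x δ, ∀ v, fderiv ℝ f₁ z v = v 0 • deriv a (z 0) := fun z hz =>
    fderiv_factor hfa hz ((ha.contDiffAt (isOpen_Ioo.mem_nhds (hz 0))).differentiableAt (by simp))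
  have hdb : ∀ z ∈ square x δ, ∀ v, fderiv ℝ f₂ z v = v 1 • deriv b (z 1) := fun z hz =>
    fderiv_factor hfb hz ((hb.contDiffAt (isOpen_Ioo.mem_nhds (hz 1))).differentiableAt (by simp))
  have hx := mem_square_self x hδ
  have hpt : ∀ i : Fin 2, ∀ s ∈ Set.Ioo (x i - δ) (x i + δ), ∃ z ∈ square x δ, z i = s :=
    fun i s hs => ⟨_, square_add_smul hx hs, by simp⟩
  have hma : ∀ s ∈ Set.Ioo (x 0 - δ) (x 0 + δ), a s ∈ e₁.target := by
    intro s hs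
    obtain ⟨z, hz, rfl⟩ := hpt 0 s hs
    rw [← hfa z hz]
    exact e₁.map_source (hdom z hz).2.1
  have hmb : ∀ s ∈ Set.Ioo (x 1 - δ) (x 1 + δ), b s ∈ e₂.target := by
    intro s hs
    obtain ⟨z, hz, rfl⟩ := hpt 1 s hs
    rw [← hfb z hz]
    exact e₂.map_source (hdom z hz).2.2
  have hau : ∀ s ∈ Set.Ioo (x 0 - δ) (x 0 + δ),
      chartMetric 𝓘(ℝ, Plane) X₁.metric.inner e₁ (a s) (deriv a s) (deriv a s) = 1 := by
    intro s hs
    obtain ⟨z, hz, rfl⟩ := hpt 0 s hs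
    have := h.unit₁ z (hsq ▸ hz)
    rw [← hf₁, hda z hz, hfa z hz] at this
    simpa using this
  have hbu : ∀ s ∈ Set.Ioo (x 1 - δ) (x 1 + δ),
      chartMetric 𝓘(ℝ, Plane) X₂.metric.inner e₂ (b s) (deriv b s) (deriv b s) = 1 := by
    intro s hs
    obtain ⟨z, hz, rfl⟩ := hpt 1 s hs
    have := h.unit₂ z (hsq ▸ hz)
    rw [← hf₂, hdb z hz, hfb z hz] at this
    simpa using this
  have key := fun z hz => normal_derivative_eq_zero
    (isRiemannianOn_chartMetric X₁ h.mem_atlas₁) (isRiemannianOn_chartMetric X₂ h.mem_atlas₂)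
    (GG := chartMetric (𝓘(ℝ, Plane).prod 𝓘(ℝ, Plane)) (prodMetric X₁ X₂) (e₁.prod e₂))
    (fun q hq => chartMetric_prodMetric h.mem_atlas₁ h.mem_atlas₂ hq)
    (F := localRep (𝓘(ℝ, Plane).prod 𝓘(ℝ, Plane)) Φ e (e₁.prod e₂)) ha hb hma hmb
    (fun z hz => by rw [localRep_prod, ← hfa z hz, ← hfb z hz]) hau hbu
    (fun z hz u n hn => hpar e h.mem_atlas (e₁.prod e₂)
      (IsManifold.mem_maximalAtlas_prod h.mem_atlas₁ h.mem_atlas₂) z (hdom z hz).1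
      ⟨(hdom z hz).2.1, (hdom z hz).2.2⟩ u n hn) (z := z) hz
  obtain ⟨k₁, hk₁⟩ := exists_normal_curvature X₁ h.mem_atlas₁ ha hma hau (fun s hs => by
    obtain ⟨z, hz, rfl⟩ := hpt 0 s hs
    exact (key z hz).1)
  obtain ⟨k₂, hk₂⟩ := exists_normal_curvature X₂ h.mem_atlas₂ hb hmb hbu (fun s hs => by
    obtain ⟨z, hz, rfl⟩ := hpt 1 s hs
    exact (key z hz).2)
  refine ⟨x, δ, _, _, k₁, k₂, h.mem_atlas, hδ, hsq, hk₁, hk₂, fun q hq => ?_⟩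
  have hz : e q ∈ square x δ := hsq ▸ e.map_source hq
  have := h.mapsTo q hq
  refine Prod.ext ?_ ?_
  · change _ = e₁.symm (a (e q 0))
    rw [← hfa _ hz]
    simp [hf₁, coordRep, e.left_inv hq, e₁.left_inv this.1]
  · change _ = e₂.symm (b (e q 1))
    rw [← hfb _ hz]
    simp [hf₂, coordRep, e.left_inv hq, e₂.left_inv this.2]

/-- Around each point, a Lagrangian immersion with parallel mean curvature vector is a product of
curves of constant curvature. -/
theorem exists_isLocalProduct {c₁ c₂ : ℝ}
    (h₁ : HasConstantCurvature 𝓘(ℝ, Plane) X₁.metric.inner c₁)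
    (h₂ : HasConstantCurvature 𝓘(ℝ, Plane) X₂.metric.inner c₂)
    (hc : c₁ ≠ c₂) (hΦ : IsLagrangianImmersion X₁ X₂ Φ)
    (hpar : HasParallelMeanCurvature (𝓘(ℝ, Plane).prod 𝓘(ℝ, Plane)) (prodMetric X₁ X₂) Φ) (p : S) :
    ∃ e x δ α β k₁ k₂, IsLocalProduct X₁ X₂ Φ e x δ α β k₁ k₂ ∧ p ∈ e.source := by
  obtain ⟨e, he, hp⟩ := exists_isProductChart hΦ
    (fun he he₁ he₂ _ hx v w => kahler_pullback_eq_zero h₁ h₂ hc hΦ hpar he he₁ he₂ hx v w)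
    (IsManifold.chart_mem_maximalAtlas (Φ p).1) (mem_chart_source Plane (Φ p).1)
    (IsManifold.chart_mem_maximalAtlas (Φ p).2) (mem_chart_source Plane (Φ p).2)
  obtain ⟨e', he', hp'⟩ := he.exists_isUnitSpeedChart hΦ hp
  obtain ⟨x, δ, α, β, k₁, k₂, h⟩ := he'.exists_isLocalProduct hΦ hpar
  exact ⟨e', x, δ, α, β, k₁, k₂, h, hp'⟩

end LocalProduct

/-! ### Transition between product charts -/

/-- A function of the plane whose differential is `± dz_i` is affine in `z_i`. -/
theorem eventually_eq_affine {p : Plane → ℝ} {y : Plane} {i : Fin 2} (hp : ContDiffAt ℝ ∞ p y)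
    (h : ∀ᶠ z in nhds y, (∀ j, j ≠ i → fderiv ℝ p z (bas j) = 0) ∧
      fderiv ℝ p z (bas i) * fderiv ℝ p z (bas i) = 1) :
    ∃ ε c : ℝ, ε * ε = 1 ∧ ∀ᶠ z in nhds y, p z = ε * z i + c := by
  set ε := fderiv ℝ p y (bas i) with hε
  have hε1 : ε * ε = 1 := h.self_of_nhds.2
  have hcont : ContinuousAt (fun z => ε * fderiv ℝ p z (bas i)) y :=
    continuousAt_const.mul
      ((hp.continuousAt_fderiv (by simp)).clm_apply continuousAt_const)
  -- the partial derivative is `± 1` and continuous, so its sign is locally constant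
  have hpos : ∀ᶠ z in nhds y, 0 < ε * fderiv ℝ p z (bas i) :=
    hcont.eventually (lt_mem_nhds (hε1.symm ▸ one_pos : (0 : ℝ) < ε * ε))
  have hdiff : ∀ᶠ z in nhds y, DifferentiableAt ℝ p z := by
    filter_upwards [(hp.of_le (m := 1) (by simp)).eventually (by simp)] with z hz
    exact hz.differentiableAt (by simp)
  have hd : ∀ᶠ z in nhds y, HasFDerivAt (fun z : Plane => p z - ε * z i) (0 : Plane →L[ℝ] ℝ) z := by
    filter_upwards [h, hpos, hdiff] with z hz hz' hzd
    have h1 : fderiv ℝ p z (bas i) = ε := by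
      have hs : (ε * fderiv ℝ p z (bas i)) * (ε * fderiv ℝ p z (bas i)) = 1 := by
        linear_combination ε * ε * hz.2 + hε1
      have h2 : ε * fderiv ℝ p z (bas i) = 1 := by nlinarith
      linear_combination ε * h2 - fderiv ℝ p z (bas i) * hε1
    have h2 := hzd.hasFDerivAt.sub
      ((EuclideanSpace.proj i : Plane →L[ℝ] ℝ).hasFDerivAt (x := z) |>.const_mul ε)
    refine h2.congr_fderiv ?_
    ext v
    have h3 : ∀ j, fderiv ℝ p z (bas j) = ε * (bas j) i := by
      intro j
      by_cases hj : j = i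
      · subst hj; simp [h1]
      · rw [hz.1 j hj]; simp [Ne.symm hj]
    rw [plane_eq v]
    simp only [map_add, map_smul, smul_eq_mul, h3, sub_apply, smul_apply, zero_apply]
    change v 0 * (ε * (bas 0) i - ε * (bas 0) i) + v 1 * (ε * (bas 1) i - ε * (bas 1) i) = _
    ring
  obtain ⟨r, hr, hb⟩ := Metric.eventually_nhds_iff_ball.1 hd
  refine ⟨ε, p y - ε * y i, hε1, ?_⟩
  filter_upwards [Metric.ball_mem_nhds y hr] with z hz
  have := (convex_ball y r).is_const_of_fderivWithin_eq_zero (𝕜 := ℝ)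
    (f := fun z : Plane => p z - ε * z i)
    (fun w hw => (hb w hw).differentiableAt.differentiableWithinAt)
    (fun w hw => by
      rw [fderivWithin_of_isOpen Metric.isOpen_ball hw]; exact (hb w hw).fderiv)
    hz (Metric.mem_ball_self hr)
  simp only at this
  linarith

section Transition

variable {M : Type*} [TopologicalSpace M] [ChartedSpace Plane M] [IsManifold 𝓘(ℝ, Plane) ∞ M]
  {X : OrientedRiemannianSurface M} {α α' : ℝ → M} {A A' : Set ℝ} {k k' : ℝ}

/-- The geodesic curvature of a curve is determined by its germ. -/
theorem IsCurveOfConstantCurvature.curvature_unique {t : ℝ}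
    (hα : IsCurveOfConstantCurvature 𝓘(ℝ, Plane) X.metric.inner X.J A α k) (hA : IsOpen A)
    (hα' : IsCurveOfConstantCurvature 𝓘(ℝ, Plane) X.metric.inner X.J A' α' k') (hA' : IsOpen A')
    (ht : t ∈ A) (ht' : t ∈ A') (h : α =ᶠ[nhds t] α') : k = k' := by
  have hm := mem_chart_source Plane (α t)
  have he := IsManifold.chart_mem_maximalAtlas (I := 𝓘(ℝ, Plane)) (n := ∞) (α t)
  set e := chartAt Plane (α t)
  have h1 := hα.curveEqAt hA he ht hm
  have h2 := curveEqAt_congr X h (hα'.curveEqAt hA' he ht' (h.eq_of_nhds ▸ hm))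
  have h3 := h1.2.symm.trans h2.2
  have h4 := chartJ_isometry X he (e.map_source hm) (deriv (e ∘ α) t) (deriv (e ∘ α) t)
  rw [h1.1] at h4
  have h5 : chartJ X e (e (α t)) (deriv (e ∘ α) t) ≠ 0 := by
    intro h0
    rw [h0, map_zero] at h4
    exact zero_ne_one h4
  exact smul_left_injective ℝ h5 h3

/-- If `α(z_i) = α'(p(z))` for two unit speed curves, then `p` is locally `± z_i + c`. -/
theorem eventually_eq_affine_of_curves
    (hα : IsCurveOfConstantCurvature 𝓘(ℝ, Plane) X.metric.inner X.J A α k) (hA : IsOpen A)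
    (hα' : IsCurveOfConstantCurvature 𝓘(ℝ, Plane) X.metric.inner X.J A' α' k') (hA' : IsOpen A')
    {p : Plane → ℝ} {y : Plane} {i : Fin 2} (hp : ContDiffAt ℝ ∞ p y) (hyA : y i ∈ A)
    (hyA' : p y ∈ A') (h : ∀ᶠ z in nhds y, α (z i) = α' (p z)) :
    ∃ ε c : ℝ, ε * ε = 1 ∧ ∀ᶠ z in nhds y, p z = ε * z i + c := by
  refine eventually_eq_affine hp ?_
  have hm := mem_chart_source Plane (α (y i))
  have he := IsManifold.chart_mem_maximalAtlas (I := 𝓘(ℝ, Plane)) (n := ∞) (α (y i))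
  set e := chartAt Plane (α (y i))
  have hi : ContinuousAt (fun z : Plane => z i) y := by fun_prop
  have e1 : ∀ᶠ z in nhds y, z i ∈ A ∧ α (z i) ∈ e.source :=
    hi.eventually ((hA.eventually_mem hyA).and
      ((hα.contMDiffAt hA hyA).continuousAt.eventually (e.open_source.eventually_mem hm)))
  have e2 : ∀ᶠ z in nhds y, p z ∈ A' := hp.continuousAt.eventually (hA'.eventually_mem hyA')
  have hdiff : ∀ᶠ z in nhds y, DifferentiableAt ℝ p z := by
    filter_upwards [(hp.of_le (m := 1) (by simp)).eventually (by simp)] with z hz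
    exact hz.differentiableAt (by simp)
  filter_upwards [e1, e2, hdiff, h.eventually_nhds] with z hz hz2 hz3 hz4
  have heq : α (z i) = α' (p z) := hz4.self_of_nhds
  have hz5 : α' (p z) ∈ e.source := heq ▸ hz.2
  have c1 := hα.curveEqAt hA he hz.1 hz.2
  have c2 := hα'.curveEqAt hA' he hz2 hz5
  have a1 := ((contDiffAt_curve he (hα.contMDiffAt hA hz.1) hz.2).differentiableAt
    (by simp)).hasFDerivAt.comp z (EuclideanSpace.proj i : Plane →L[ℝ] ℝ).hasFDerivAt
  have a2 := ((contDiffAt_curve he (hα'.contMDiffAt hA' hz2) hz5).differentiableAt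
    (by simp)).hasFDerivAt.comp z hz3.hasFDerivAt
  have a3 := a1.unique (a2.congr_of_eventuallyEq (hz4.mono fun w hw => congrArg e hw))
  have key : ∀ v : Plane, v i • deriv (e ∘ α) (z i)
      = fderiv ℝ p z v • deriv (e ∘ α') (p z) := by
    intro v
    have := congrArg (fun L : Plane →L[ℝ] Plane => L v) a3
    change fderiv ℝ (e ∘ α) (z i) (v i) = fderiv ℝ (e ∘ α') (p z) (fderiv ℝ p z v) at this
    rwa [fderiv_eq_smul_deriv, fderiv_eq_smul_deriv] at this
  refine ⟨fun j hj => ?_, ?_⟩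
  · have := key (bas j)
    have h0 : deriv (e ∘ α') (p z) ≠ 0 := by
      intro h0
      have := c2.1
      rw [h0, map_zero] at this
      exact zero_ne_one this
    rw [PiLp.single_apply, if_neg (Ne.symm hj), zero_smul] at this
    exact (smul_eq_zero.1 this.symm).resolve_right h0
  · have := key (bas i)
    have h1 := c1.1
    simp only [PiLp.single_apply, if_true, one_smul] at this
    rw [this, heq, map_smul, map_smul, smul_apply, c2.1] at h1
    simpa using h1

variable {S : Type*} [TopologicalSpace S] [ChartedSpace Plane S] [IsManifold 𝓘(ℝ, Plane) ∞ S]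
  {e e' : OpenPartialHomeomorph S Plane}

/-- Two charts in which a map depends on one coordinate only, through unit speed curves of constant
curvature, have affinely related coordinates, with slope `±1`. -/
theorem exists_affine_transition {φ : S → M}
    (hα : IsCurveOfConstantCurvature 𝓘(ℝ, Plane) X.metric.inner X.J A α k) (hA : IsOpen A)
    (hα' : IsCurveOfConstantCurvature 𝓘(ℝ, Plane) X.metric.inner X.J A' α' k') (hA' : IsOpen A')
    (he : e ∈ IsManifold.maximalAtlas 𝓘(ℝ, Plane) ∞ S)
    (he' : e' ∈ IsManifold.maximalAtlas 𝓘(ℝ, Plane) ∞ S) (i : Fin 2)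
    (h : ∀ q ∈ e.source, e q i ∈ A ∧ φ q = α (e q i))
    (h' : ∀ q ∈ e'.source, e' q i ∈ A' ∧ φ q = α' (e' q i)) {q : S} (hq : q ∈ e.source)
    (hq' : q ∈ e'.source) :
    ∃ ε c : ℝ, ε * ε = 1 ∧ (∀ᶠ r in nhds q, e' r i = ε * e r i + c) ∧
      ε * e q i + c ∈ A' ∧ k = ε * k' ∧ α =ᶠ[nhds (e q i)] fun s => α' (ε * s + c) := by
  have hψ := contDiffAt_transition he he' hq hq'
  have hp : ContDiffAt ℝ ∞ (fun z => (e' ∘ e.symm) z i) (e q) :=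
    (EuclideanSpace.proj i : Plane →L[ℝ] ℝ).contDiff.contDiffAt.comp _ hψ
  have hN : ∀ᶠ z in nhds (e q), z ∈ e.target ∩ e.symm ⁻¹' e'.source :=
    (e.isOpen_inter_preimage_symm e'.open_source).mem_nhds
      ⟨e.map_source hq, by rw [Set.mem_preimage, e.left_inv hq]; exact hq'⟩
  have hval : ∀ᶠ z in nhds (e q), α (z i) = α' ((e' ∘ e.symm) z i) := by
    filter_upwards [hN] with z hz
    have h1 := (h _ (e.map_target hz.1)).2
    rw [e.right_inv hz.1] at h1
    rw [← h1, (h' _ hz.2).2]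
    rfl
  obtain ⟨ε, c, hε, hev⟩ := eventually_eq_affine_of_curves hα hA hα' hA' hp (h q hq).1
    (by simpa [e.left_inv hq] using (h' q hq').1) hval
  have hev' : ∀ᶠ r in nhds q, e' r i = ε * e r i + c := by
    filter_upwards [(e.continuousAt hq).eventually hev, e.open_source.mem_nhds hq] with r hr hr'
    simpa [e.left_inv hr'] using hr
  have hmem : ε * e q i + c ∈ A' := by
    rw [← hev'.self_of_nhds]; exact (h' q hq').1
  have hg : α =ᶠ[nhds (e q i)] fun s => α' (ε * s + c) := by
    have hl : Filter.Tendsto (fun s : ℝ => e q + (s - e q i) • bas i) (nhds (e q i))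
        (nhds (e q)) := by
      have : Continuous (fun s : ℝ => e q + (s - e q i) • bas i) := by fun_prop
      simpa using this.tendsto (e q i)
    filter_upwards [hl.eventually (hval.and hev)] with s hs
    have := hs.1.trans (congrArg α' hs.2)
    simpa using this
  refine ⟨ε, c, hε, hev', hmem, ?_, hg⟩
  exact hα.curvature_unique hA (hα'.comp_affine hA' hε c)
    (hA'.preimage (by fun_prop)) (h q hq).1 hmem hg

end Transition

/-! ### From local to global products -/

theorem ordConnected_preimage_affine {A : Set ℝ} (hA : A.OrdConnected) {ε : ℝ} (c : ℝ) :
    ((fun t => ε * t + c) ⁻¹' A).OrdConnected := by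
  rcases le_total 0 ε with h | h
  · exact hA.preimage_mono fun s t hst => by gcongr
  · exact hA.preimage_anti fun s t hst =>
      add_le_add_left (mul_le_mul_of_nonpos_left hst h) c

section Globalization

variable {M : Type*} [TopologicalSpace M] [ChartedSpace Plane M] [IsManifold 𝓘(ℝ, Plane) ∞ M]
  {X : OrientedRiemannianSurface M} {α α' : ℝ → M} {A A' : Set ℝ} {k k' : ℝ}
  {S : Type*} [TopologicalSpace S] [ChartedSpace Plane S] [IsManifold 𝓘(ℝ, Plane) ∞ S]
  {e e' : OpenPartialHomeomorph S Plane}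

/-- A maximal curve absorbs, after an affine change of parameter, the curve appearing in any
overlapping chart. -/
theorem IsMaximalCurve.absorb {φ : S → M} (hα : IsMaximalCurve X A α k)
    (hα' : IsCurveOfConstantCurvature 𝓘(ℝ, Plane) X.metric.inner X.J A' α' k') (hA' : IsOpen A')
    (hA'c : A'.OrdConnected)
    (he : e ∈ IsManifold.maximalAtlas 𝓘(ℝ, Plane) ∞ S)
    (he' : e' ∈ IsManifold.maximalAtlas 𝓘(ℝ, Plane) ∞ S) (i : Fin 2)
    (h : ∀ q ∈ e.source, e q i ∈ A ∧ φ q = α (e q i))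
    (h' : ∀ q ∈ e'.source, e' q i ∈ A' ∧ φ q = α' (e' q i)) {q : S} (hq : q ∈ e.source)
    (hq' : q ∈ e'.source) :
    ∃ ε c : ℝ, ε * ε = 1 ∧ ∀ r ∈ e'.source, ε * e' r i + c ∈ A ∧ φ r = α (ε * e' r i + c) := by
  obtain ⟨hA, hAc, hcurve, hmax⟩ := hα
  obtain ⟨ε, c, hε, -, hmem, hk, hg⟩ :=
    exists_affine_transition hcurve hA hα' hA' he he' i h h' hq hq'
  have h1 := hα'.comp_affine hA' hε c
  rw [← hk] at h1
  obtain ⟨h2, h3⟩ := hmax _ _ (hA'.preimage (by fun_prop)) (ordConnected_preimage_affine hA'c c) h1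
    (e q i) ⟨(h q hq).1, hmem⟩ hg
  refine ⟨ε, -(ε * c), hε, fun r hr => ?_⟩
  have h4 : ε * (ε * e' r i + -(ε * c)) + c = e' r i := by
    linear_combination (e' r i - c) * hε
  have h5 : ε * e' r i + -(ε * c) ∈ (fun t => ε * t + c) ⁻¹' A' := by
    rw [Set.mem_preimage, h4]; exact (h' r hr).1
  refine ⟨h2 h5, ?_⟩
  rw [h3 _ h5, h4, (h' r hr).2]

theorem exists_affine_chart (he : e ∈ IsManifold.maximalAtlas 𝓘(ℝ, Plane) ∞ S) {p : S}
    (hp : p ∈ e.source) {ε₁ ε₂ : ℝ} (h₁ : ε₁ ≠ 0) (h₂ : ε₂ ≠ 0) (c₁ c₂ : ℝ) :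
    ∃ e' ∈ IsManifold.maximalAtlas 𝓘(ℝ, Plane) ∞ S, p ∈ e'.source ∧ e'.source ⊆ e.source ∧
      ∀ q ∈ e'.source, e' q 0 = ε₁ * e q 0 + c₁ ∧ e' q 1 = ε₂ * e q 1 + c₂ := by
  set Θ : Plane → Plane := fun z => !₂[ε₁ * z 0 + c₁, ε₂ * z 1 + c₂] with hΘ
  have hs : ContDiff ℝ ∞ Θ := by
    rw [contDiff_euclidean]
    intro i
    fin_cases i
    · exact (contDiff_const.mul (EuclideanSpace.proj 0 : Plane →L[ℝ] ℝ).contDiff).add contDiff_const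
    · exact (contDiff_const.mul (EuclideanSpace.proj 1 : Plane →L[ℝ] ℝ).contDiff).add contDiff_const
  obtain ⟨e', he', hp', hsub, -, hee'⟩ := exists_chart_comp he isOpen_univ hs.contDiffOn hp
    (Set.mem_univ _) (fun v hv => by
      have hd := (hs.differentiable (by simp) (e p)).hasFDerivAt
      have k0 := (EuclideanSpace.proj 0 : Plane →L[ℝ] ℝ).hasFDerivAt.comp (e p) hd
      have k1 := (EuclideanSpace.proj 1 : Plane →L[ℝ] ℝ).hasFDerivAt.comp (e p) hd
      have l0 := ((EuclideanSpace.proj 0 : Plane →L[ℝ] ℝ).hasFDerivAt (x := e p)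
        |>.const_mul ε₁).add_const c₁
      have l1 := ((EuclideanSpace.proj 1 : Plane →L[ℝ] ℝ).hasFDerivAt (x := e p)
        |>.const_mul ε₂).add_const c₂
      have m0 : fderiv ℝ Θ (e p) v 0 = ε₁ * v 0 := congrArg (fun L => L v) (k0.unique l0)
      have m1 : fderiv ℝ Θ (e p) v 1 = ε₂ * v 1 := congrArg (fun L => L v) (k1.unique l1)
      rw [hv] at m0 m1
      ext i
      fin_cases i
      · simpa [h₁] using m0.symm
      · simpa [h₂] using m1.symm)
  refine ⟨e', he', hp', hsub, fun q hq => ?_⟩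
  rw [hee' q hq]
  exact ⟨rfl, rfl⟩

end Globalization

section Global

variable {M₁ M₂ S : Type*} [TopologicalSpace M₁] [T2Space M₁] [ChartedSpace Plane M₁]
  [IsManifold 𝓘(ℝ, Plane) ∞ M₁] [TopologicalSpace M₂] [T2Space M₂] [ChartedSpace Plane M₂]
  [IsManifold 𝓘(ℝ, Plane) ∞ M₂] [TopologicalSpace S] [ChartedSpace Plane S]
  [IsManifold 𝓘(ℝ, Plane) ∞ S]
  {X₁ : OrientedRiemannianSurface M₁} {X₂ : OrientedRiemannianSurface M₂} {Φ : S → M₁ × M₂}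

/-- A map of a connected surface that is locally a product of curves of constant curvature is
globally one. -/
theorem isProductOfConstantCurvatureCurves_of_locally [ConnectedSpace S]
    (h : ∀ p : S, ∃ e x δ α β k₁ k₂, IsLocalProduct X₁ X₂ Φ e x δ α β k₁ k₂ ∧ p ∈ e.source) :
    IsProductOfConstantCurvatureCurves X₁ X₂ Φ := by
  have hcoord : ∀ {e : OpenPartialHomeomorph S Plane} {x δ α β k₁ k₂},
      IsLocalProduct X₁ X₂ Φ e x δ α β k₁ k₂ → ∀ q ∈ e.source,
        (e q 0 ∈ Set.Ioo (x 0 - δ) (x 0 + δ) ∧ (Φ q).1 = α (e q 0)) ∧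
        (e q 1 ∈ Set.Ioo (x 1 - δ) (x 1 + δ) ∧ (Φ q).2 = β (e q 1)) := by
    intro e x δ α β k₁ k₂ hl q hq
    have hm : e q ∈ square x δ := hl.2.2.1 ▸ e.map_source hq
    have hv := hl.2.2.2.2.2 q hq
    exact ⟨⟨hm 0, congrArg Prod.fst hv⟩, ⟨hm 1, congrArg Prod.snd hv⟩⟩
  obtain ⟨p₀⟩ := (inferInstance : Nonempty S)
  obtain ⟨e₀, x, δ, α₀, β₀, k₁, k₂, hl₀, hp₀⟩ := h p₀
  have hδ := hl₀.2.1
  obtain ⟨A, α, hα, hA₀, hαα₀⟩ := hl₀.2.2.2.1.exists_maximal isOpen_Ioo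
    Set.ordConnected_Ioo (t := x 0) ⟨by linarith, by linarith⟩
  obtain ⟨B, β, hβ, hB₀, hββ₀⟩ := hl₀.2.2.2.2.1.exists_maximal isOpen_Ioo
    Set.ordConnected_Ioo (t := x 1) ⟨by linarith, by linarith⟩
  refine ⟨A, B, α, β, k₁, k₂, hα.isOpen, hα.ordConnected, hβ.isOpen, hβ.ordConnected, hα.curve,
    hβ.curve, ?_⟩
  -- the points around which `Φ` is the product of the fixed maximal curves form a clopen set
  set good : Set S := {p | ∃ e ∈ IsManifold.maximalAtlas 𝓘(ℝ, Plane) ∞ S, p ∈ e.source ∧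
      ∀ q ∈ e.source, e q 0 ∈ A ∧ e q 1 ∈ B ∧ Φ q = (α (e q 0), β (e q 1))} with hgood
  have hopen : IsOpen good := by
    rw [isOpen_iff_mem_nhds]
    rintro p ⟨e, he, hp, hv⟩
    exact Filter.mem_of_superset (e.open_source.mem_nhds hp) fun q hq => ⟨e, he, hq, hv⟩
  have hne : good.Nonempty := by
    refine ⟨p₀, e₀, hl₀.1, hp₀, fun q hq => ?_⟩
    obtain ⟨⟨m1, v1⟩, ⟨m2, v2⟩⟩ := hcoord hl₀ q hq
    exact ⟨hA₀ m1, hB₀ m2, Prod.ext (v1.trans (hαα₀ _ m1).symm) (v2.trans (hββ₀ _ m2).symm)⟩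
  have hclosed : IsClosed good := by
    rw [← closure_subset_iff_isClosed]
    intro p hp
    obtain ⟨e', x', δ', α', β', k₁', k₂', hl, hpe'⟩ := h p
    obtain ⟨q, hqe', e, he, hqe, hv⟩ := mem_closure_iff.1 hp e'.source e'.open_source hpe'
    obtain ⟨ε₁, c₁, hε₁, h₁⟩ := hα.absorb (φ := fun q => (Φ q).1) hl.2.2.2.1 isOpen_Ioo Set.ordConnected_Ioo
      he hl.1 0 (fun q hq => ⟨(hv q hq).1, congrArg Prod.fst (hv q hq).2.2⟩)
      (fun q hq => (hcoord hl q hq).1) hqe hqe'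
    obtain ⟨ε₂, c₂, hε₂, h₂⟩ := hβ.absorb (φ := fun q => (Φ q).2) hl.2.2.2.2.1 isOpen_Ioo
      Set.ordConnected_Ioo
      he hl.1 1 (fun q hq => ⟨(hv q hq).2.1, congrArg Prod.snd (hv q hq).2.2⟩)
      (fun q hq => (hcoord hl q hq).2) hqe hqe'
    obtain ⟨e'', he'', hp'', hsub, hval⟩ := exists_affine_chart hl.1 hpe'
      (left_ne_zero_of_mul_eq_one hε₁) (left_ne_zero_of_mul_eq_one hε₂) c₁ c₂
    refine ⟨e'', he'', hp'', fun r hr => ?_⟩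
    rw [(hval r hr).1, (hval r hr).2]
    have a1 := h₁ r (hsub hr)
    have a2 := h₂ r (hsub hr)
    exact ⟨a1.1, a2.1, Prod.ext a1.2 a2.2⟩
  have huniv : good = Set.univ := IsClopen.eq_univ ⟨hclosed, hopen⟩ hne
  intro p
  have hp : p ∈ good := huniv ▸ Set.mem_univ p
  exact hp

end Global

/-! ### Developing maps on the sphere -/

section Developing

variable {B Y Γ ι : Type*} [TopologicalSpace B] [Group Γ] [MulAction Γ Y]

/-- Local functions `u i : U i → Y` that cover `B` and are locally related to each other by unique
elements of the group `Γ`. -/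
structure IsDevelopingAtlas (Γ : Type*) [Group Γ] [MulAction Γ Y] (U : ι → Set B)
    (u : ι → B → Y) : Prop where
  isOpen : ∀ i, IsOpen (U i)
  cover : ∀ x, ∃ i, x ∈ U i
  transition : ∀ i j x, x ∈ U i → x ∈ U j → ∃ g : Γ, ∀ᶠ y in nhds x, u i y = g • u j y
  unique : ∀ i x, x ∈ U i → ∀ g h : Γ, (∀ᶠ y in nhds x, g • u i y = h • u i y) → g = h

namespace IsDevelopingAtlas

variable {U : ι → Set B} {u : ι → B → Y} (h : IsDevelopingAtlas Γ U u)

open Classical in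
/-- The element of `Γ` that relates `u i` to `u j` near `x`. -/
noncomputable def trans (i j : ι) (x : B) : Γ :=
  if hx : x ∈ U i ∧ x ∈ U j then (h.transition i j x hx.1 hx.2).choose else 1

theorem trans_spec {i j : ι} {x : B} (hi : x ∈ U i) (hj : x ∈ U j) :
    ∀ᶠ y in nhds x, u i y = h.trans i j x • u j y := by
  rw [trans, dif_pos ⟨hi, hj⟩]
  exact (h.transition i j x hi hj).choose_spec

theorem trans_eq {i j : ι} {x : B} (hi : x ∈ U i) (hj : x ∈ U j) {g : Γ}
    (hg : ∀ᶠ y in nhds x, u i y = g • u j y) : h.trans i j x = g := by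
  refine h.unique j x hj _ _ ?_
  filter_upwards [h.trans_spec hi hj, hg] with y h1 h2
  rw [← h1, h2]

theorem trans_eventually_eq {i j : ι} {x : B} (hi : x ∈ U i) (hj : x ∈ U j) :
    ∀ᶠ y in nhds x, h.trans i j y = h.trans i j x := by
  filter_upwards [(h.trans_spec hi hj).eventually_nhds, (h.isOpen i).mem_nhds hi,
    (h.isOpen j).mem_nhds hj] with y hy hyi hyj using h.trans_eq hyi hyj hy

/-- The covering space of germs of functions `g • u i`, `g ∈ Γ`, as a fiber bundle with discrete
fiber `Γ`. -/
noncomputable def core [TopologicalSpace Γ] [DiscreteTopology Γ] : FiberBundleCore ι B Γ where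
  baseSet := U
  isOpen_baseSet := h.isOpen
  indexAt x := (h.cover x).choose
  mem_baseSet_at x := (h.cover x).choose_spec
  -- the germ `v • u i` is the germ `(v * g) • u j` if `u i = g • u j`
  coordChange i j x v := v * h.trans i j x
  coordChange_self i x hx v := by
    rw [h.trans_eq hx hx (g := 1) (by simp), mul_one]
  continuousOn_coordChange i j := by
    rintro ⟨x, v⟩ ⟨⟨hi, hj⟩, -⟩
    refine ContinuousAt.continuousWithinAt ?_
    have h1 : ContinuousAt (fun p : B × Γ => p.2 * h.trans i j x) (x, v) :=
      ((continuous_of_discreteTopology (f := fun v : Γ => v * h.trans i j x)).comp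
        continuous_snd).continuousAt
    refine h1.congr ?_
    filter_upwards [continuousAt_fst.eventually (h.trans_eventually_eq hi hj)] with p hp
    rw [hp]
  coordChange_comp i j k x hx v := by
    rw [mul_assoc, h.trans_eq hx.1.1 hx.2 (g := h.trans i j x * h.trans j k x)]
    filter_upwards [h.trans_spec hx.1.1 hx.1.2, h.trans_spec hx.1.2 hx.2] with y h1 h2
    rw [h1, h2, mul_smul]

/-- The value of a germ. -/
noncomputable def eval [TopologicalSpace Γ] [DiscreteTopology Γ] (p : h.core.TotalSpace) : Y :=
  (show Γ from p.2) • u (h.core.indexAt p.1) p.1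

/-- The values of a continuous section of the covering space of germs form a function with the
germs `g • u i`. -/
theorem eval_section [TopologicalSpace Γ] [DiscreteTopology Γ] {σ : B → h.core.TotalSpace}
    (hσ : Continuous σ) (hp : ∀ x, h.core.proj (σ x) = x) (x : B) :
    ∃ i, x ∈ U i ∧ ∃ g : Γ, ∀ᶠ y in nhds x, h.eval (σ y) = g • u i y := by
  have hx := h.core.mem_baseSet_at x
  set i := h.core.indexAt x with hi
  have hsrc : σ x ∈ (h.core.localTriv i).source := by
    rw [h.core.mem_localTriv_source, ← h.core.baseSet_at]
    have hσx : (σ x).1 = x := hp x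
    rw [hσx]
    exact hx
  have hc : ContinuousAt (fun y => ((h.core.localTriv i) (σ y)).2) x :=
    continuousAt_snd.comp
      (((h.core.localTriv i).toOpenPartialHomeomorph.continuousAt hsrc).comp hσ.continuousAt)
  refine ⟨i, hx, ((h.core.localTriv i) (σ x)).2, ?_⟩
  have hev : ∀ᶠ y in nhds x, ((h.core.localTriv i) (σ y)).2 = ((h.core.localTriv i) (σ x)).2 :=
    hc.eventually (p := fun w => w = ((h.core.localTriv i) (σ x)).2)
      (by rw [nhds_discrete]; exact Filter.eventually_pure.2 rfl)
  filter_upwards [hev, (h.isOpen i).mem_nhds hx] with y hy hyi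
  rw [← hy, h.core.localTriv_apply]
  have hσy : (σ y).1 = y := hp y
  have h1 := (h.trans_spec (h.core.mem_baseSet_at y) hyi).self_of_nhds
  change (show Γ from (σ y).2) • u (h.core.indexAt (σ y).1) (σ y).1
    = ((show Γ from (σ y).2) * h.trans (h.core.indexAt (σ y).1) i (σ y).1) • u i y
  rw [mul_smul, hσy, h1]

end IsDevelopingAtlas

/-- Lifting through a covering over a set homeomorphic to a normed space. -/
theorem IsCoveringMap.exists_section_on {E V : Type*} [TopologicalSpace E] [NormedAddCommGroup V]
    [NormedSpace ℝ V] {p : E → B} (hp : IsCoveringMap p) (T : OpenPartialHomeomorph B V)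
    (hT : T.target = Set.univ) {x₀ : B} (hx₀ : x₀ ∈ T.source) {e₀ : E} (he₀ : p e₀ = x₀) :
    ∃ σ : B → E, ContinuousOn σ T.source ∧ (∀ x ∈ T.source, p (σ x) = x) ∧ σ x₀ = e₀ := by
  have hc : Continuous T.symm := by
    rw [← continuousOn_univ, ← hT]; exact T.continuousOn_symm
  obtain ⟨F, ⟨h1, h2⟩, -⟩ := hp.existsUnique_continuousMap_lifts ⟨T.symm, hc⟩ (T x₀) e₀
    (by simp [he₀, T.left_inv hx₀])
  refine ⟨F ∘ T, F.continuous.comp_continuousOn T.continuousOn, fun x hx => ?_, h1⟩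
  have := congrFun h2 (T x)
  simpa [T.left_inv hx] using this

/-- A covering of a space homeomorphic to the sphere has continuous sections: the stereographic
projections from two antipodal points provide contractible open sets with connected intersection,
and sections over them glue once they agree at one point. -/
theorem IsCoveringMap.exists_section_sphere {E : Type*} [TopologicalSpace E] {p : E → B}
    (hp : IsCoveringMap p) (hs : Function.Surjective p)
    (φ : B ≃ₜ Metric.sphere (0 : EuclideanSpace ℝ (Fin 3)) 1) :
    ∃ σ : B → E, Continuous σ ∧ ∀ x, p (σ x) = x := by
  classical
  have : Fact (Module.finrank ℝ (EuclideanSpace ℝ (Fin 3)) = 2 + 1) := ⟨by simp⟩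
  let v : Metric.sphere (0 : EuclideanSpace ℝ (Fin 3)) 1 :=
    ⟨EuclideanSpace.single 0 1, by simp⟩
  let T : Metric.sphere (0 : EuclideanSpace ℝ (Fin 3)) 1 →
      OpenPartialHomeomorph B (EuclideanSpace ℝ (Fin 2)) := fun w =>
    φ.toOpenPartialHomeomorph.trans (stereographic' 2 w)
  have hTt : ∀ w, (T w).target = Set.univ := fun w => by simp [T]
  have hTs : ∀ w x, x ∈ (T w).source ↔ φ x ≠ w := fun w x => by simp [T]
  have hvv : v ≠ -v := ne_neg_of_mem_unit_sphere ℝ v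
  have hcover : ∀ x, x ∈ (T v).source ∨ x ∈ (T (-v)).source := by
    intro x
    rw [hTs, hTs]
    by_contra! h
    exact hvv (h.1.symm.trans h.2)
  have hconn : IsConnected ((T v).source ∩ (T (-v)).source) := by
    have h1 : IsConnected ({(T v) (φ.symm (-v))}ᶜ : Set (EuclideanSpace ℝ (Fin 2))) :=
      isConnected_compl_singleton_of_one_lt_rank (by simp [← Module.finrank_eq_rank]) _
    have h2 : (T v).source ∩ (T (-v)).source
        = (T v).symm '' ({(T v) (φ.symm (-v))}ᶜ : Set (EuclideanSpace ℝ (Fin 2))) := by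
      have hm : φ.symm (-v) ∈ (T v).source := by rw [hTs]; simpa using hvv.symm
      ext x
      constructor
      · rintro ⟨hx, hx'⟩
        refine ⟨T v x, fun h => ?_, (T v).left_inv hx⟩
        rw [hTs] at hx'
        exact hx' (by rw [(T v).injOn hx hm h]; simp)
      · rintro ⟨z, hz, rfl⟩
        have hz' : z ∈ (T v).target := by rw [hTt]; trivial
        refine ⟨(T v).map_target hz', ?_⟩
        rw [hTs]
        intro h
        refine hz ?_
        rw [Set.mem_singleton_iff, ← h]
        simp [(T v).right_inv hz']
    rw [h2]
    exact h1.image _ ((T v).continuousOn_symm.mono (by rw [hTt]; exact Set.subset_univ _))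
  obtain ⟨x₀, hx₀⟩ := hconn.nonempty
  obtain ⟨e₀, he₀⟩ := hs x₀
  obtain ⟨σ, hσc, hσp, hσ0⟩ := IsCoveringMap.exists_section_on hp (T v) (hTt v) hx₀.1 he₀
  obtain ⟨τ, hτc, hτp, hτ0⟩ := IsCoveringMap.exists_section_on hp (T (-v)) (hTt (-v)) hx₀.2 he₀
  have hag : Set.EqOn σ τ ((T v).source ∩ (T (-v)).source) :=
    hp.eqOn_of_comp_eqOn hconn.isPreconnected (hσc.mono Set.inter_subset_left)
      (hτc.mono Set.inter_subset_right)
      (fun x hx => (hσp x hx.1).trans (hτp x hx.2).symm) hx₀ (hσ0.trans hτ0.symm)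
  have hτ : Set.EqOn ((T v).source.piecewise σ τ) τ (T (-v)).source := by
    intro x hx
    by_cases h : x ∈ (T v).source
    · rw [Set.piecewise_eq_of_mem _ _ _ h, hag ⟨h, hx⟩]
    · rw [Set.piecewise_eq_of_notMem _ _ _ h]
  have hσ : Set.EqOn ((T v).source.piecewise σ τ) σ (T v).source := fun x hx =>
    Set.piecewise_eq_of_mem _ _ _ hx
  refine ⟨(T v).source.piecewise σ τ, continuous_iff_continuousAt.2 fun x => ?_, fun x => ?_⟩
  · rcases hcover x with h | h
    · exact (hσc.congr hσ).continuousAt ((T v).open_source.mem_nhds h)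
    · exact (hτc.congr hτ).continuousAt ((T (-v)).open_source.mem_nhds h)
  · rcases hcover x with h | h
    · rw [hσ h, hσp x h]
    · rw [hτ h, hτp x h]

/-- On a space homeomorphic to the sphere, a developing atlas glues to a global function. -/
theorem IsDevelopingAtlas.exists_global {U : ι → Set B} {u : ι → B → Y}
    (h : IsDevelopingAtlas Γ U u) (φ : B ≃ₜ Metric.sphere (0 : EuclideanSpace ℝ (Fin 3)) 1) :
    ∃ s : B → Y, ∀ x, ∃ i, x ∈ U i ∧ ∃ g : Γ, ∀ᶠ y in nhds x, s y = g • u i y := by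
  -- the discrete topology on `Γ`
  let _ : TopologicalSpace Γ := ⊥
  have : DiscreteTopology Γ := ⟨rfl⟩
  have hcov : IsCoveringMap h.core.proj := FiberBundle.isCoveringMap (F := Γ) (E := h.core.Fiber)
  obtain ⟨σ, hσ, hp⟩ := IsCoveringMap.exists_section_sphere hcov
    (fun x => ⟨⟨x, (1 : Γ)⟩, rfl⟩) φ
  exact ⟨_, h.eval_section hσ hp⟩

end Developing

/-! ### Products of curves on the sphere -/

section Spheres

theorem exists_slope_intercept (g : ℝ ≃ᵃ[ℝ] ℝ) :
    ∃ m d : ℝ, m ≠ 0 ∧ ∀ z, g z = m * z + d := by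
  have h : ∀ z, g z = g.linear 1 * z + g 0 := by
    intro z
    have h1 := g.map_vadd 0 z
    simp only [vadd_eq_add, add_zero] at h1
    have h2 : g.linear z = z * g.linear 1 := by
      conv_lhs => rw [← mul_one z, ← smul_eq_mul, map_smul, smul_eq_mul]
    rw [h1, h2]
    ring
  refine ⟨g.linear 1, g 0, fun h0 => ?_, h⟩
  exact zero_ne_one (g.injective (by rw [h 0, h 1, h0]; simp))

/-- The group of affine bijections of the line acts on the line. -/
noncomputable abbrev affineAction : MulAction (ℝ ≃ᵃ[ℝ] ℝ) ℝ where
  smul g y := g y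
  one_smul _ := rfl
  mul_smul _ _ _ := rfl

variable {M₁ M₂ S : Type*} [TopologicalSpace M₁] [ChartedSpace Plane M₁]
  [IsManifold 𝓘(ℝ, Plane) ∞ M₁] [TopologicalSpace M₂] [ChartedSpace Plane M₂]
  [IsManifold 𝓘(ℝ, Plane) ∞ M₂] [TopologicalSpace S] [ChartedSpace Plane S]
  [IsManifold 𝓘(ℝ, Plane) ∞ S]
  {X₁ : OrientedRiemannianSurface M₁} {X₂ : OrientedRiemannianSurface M₂} {Φ : S → M₁ × M₂}

omit [ChartedSpace Plane S] [IsManifold 𝓘(ℝ, Plane) ∞ S] in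
/-- The first coordinate of a chart takes all values near a given one. -/
theorem eventually_exists_coordinate {e : OpenPartialHomeomorph S Plane} {x : S} (hx : x ∈ e.source)
    {P : S → Prop} (hP : ∀ᶠ y in nhds x, P y) :
    ∀ᶠ r in nhds (0 : ℝ), ∃ y, P y ∧ e y 0 = e x 0 + r := by
  have hc : Filter.Tendsto (fun r : ℝ => e x + r • bas 0) (nhds 0) (nhds (e x)) := by
    have : Continuous (fun r : ℝ => e x + r • bas 0) := by fun_prop
    simpa using this.tendsto 0
  have h1 := hc.eventually ((e.eventually_right_inverse (e.map_source hx)).and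
    ((e.tendsto_symm hx).eventually hP))
  filter_upwards [h1] with r hr
  exact ⟨_, hr.2, by rw [hr.1]; simp⟩

/-- On a sphere no map is a product of curves of constant curvature: the arc length parameter of
the first curve would be a global continuous function without a maximum. -/
theorem IsProductOfConstantCurvatureCurves.not_homeomorph_sphere
    (h : IsProductOfConstantCurvatureCurves X₁ X₂ Φ)
    (φ : S ≃ₜ Metric.sphere (0 : EuclideanSpace ℝ (Fin 3)) 1) : False := by
  obtain ⟨A, _, α, _, k, _, hA, -, -, -, hα, -, hcharts⟩ := h
  let _ := affineAction
  -- the charts that separate the variables, with the parameter of the first curve as local function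
  let ι : Type _ := {e : OpenPartialHomeomorph S Plane //
    e ∈ IsManifold.maximalAtlas 𝓘(ℝ, Plane) ∞ S ∧ ∀ q ∈ e.source, e q 0 ∈ A ∧ (Φ q).1 = α (e q 0)}
  have hdev : IsDevelopingAtlas (ℝ ≃ᵃ[ℝ] ℝ) (fun i : ι => i.1.source)
      (fun (i : ι) (x : S) => i.1 x 0) := by
    refine ⟨fun i => i.1.open_source, fun x => ?_, fun i j x hi hj => ?_, fun i x hx g g' hg => ?_⟩
    · obtain ⟨e, he, hx, hv⟩ := hcharts x
      exact ⟨⟨e, he, fun q hq => ⟨(hv q hq).1, congrArg Prod.fst (hv q hq).2.2⟩⟩, hx⟩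
    · obtain ⟨ε, c, hε, hev, -⟩ := exists_affine_transition (φ := fun q => (Φ q).1) hα hA hα hA
        j.2.1 i.2.1 0 j.2.2 i.2.2 hj hi
      refine ⟨(LinearEquiv.smulOfNeZero ℝ ℝ ε
        (left_ne_zero_of_mul_eq_one hε)).toAffineEquiv.trans (AffineEquiv.constVAdd ℝ ℝ c), ?_⟩
      filter_upwards [hev] with y hy
      rw [hy, add_comm]
      rfl
    · obtain ⟨m, d, -, hm⟩ := exists_slope_intercept g
      obtain ⟨m', d', -, hm'⟩ := exists_slope_intercept g'
      have h1 : ∀ᶠ r in nhds (0 : ℝ), m * (i.1 x 0 + r) + d = m' * (i.1 x 0 + r) + d' := by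
        filter_upwards [eventually_exists_coordinate hx hg] with r ⟨y, hy, hyr⟩
        rw [← hm, ← hm', ← hyr]
        exact hy
      obtain ⟨r, hr, hr0⟩ := ((h1.filter_mono nhdsWithin_le_nhds).and
        (self_mem_nhdsWithin (s := {0}ᶜ))).exists
      have h2 := h1.self_of_nhds
      have h3 : (m - m') * r = 0 := by linear_combination hr - h2
      have h4 : m = m' := sub_eq_zero.1 ((mul_eq_zero.1 h3).resolve_right hr0)
      subst h4
      have h5 : d = d' := by linarith
      ext z
      rw [hm, hm', h5]
  obtain ⟨s, hs⟩ := hdev.exists_global φ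
  have hcont : Continuous s := by
    rw [continuous_iff_continuousAt]
    intro x
    obtain ⟨i, hx, g, hg⟩ := hs x
    obtain ⟨m, d, -, hm⟩ := exists_slope_intercept g
    have h1 : ContinuousAt (fun y => m * i.1 y 0 + d) x := by
      have := i.1.continuousAt hx
      have h0 : ContinuousAt (fun y => i.1 y 0) x :=
        (EuclideanSpace.proj 0 : Plane →L[ℝ] ℝ).continuous.continuousAt.comp this
      exact (continuousAt_const.mul h0).add continuousAt_const
    refine h1.congr ?_
    filter_upwards [hg] with y hy
    rw [hy, ← hm]
    rfl
  -- at a maximum of `s`, the coordinate `s = m z₀ + d` with `m ≠ 0` takes larger values nearby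
  have : CompactSpace S := φ.symm.compactSpace
  have : Nonempty S := ⟨φ.symm ⟨EuclideanSpace.single 0 1, by simp⟩⟩
  obtain ⟨x, -, hmax⟩ := isCompact_univ.exists_isMaxOn Set.univ_nonempty hcont.continuousOn
  obtain ⟨i, hx, g, hg⟩ := hs x
  obtain ⟨m, d, hm0, hm⟩ := exists_slope_intercept g
  have h1 : ∀ᶠ r in nhds (0 : ℝ), m * r ≤ 0 := by
    filter_upwards [eventually_exists_coordinate hx hg] with r ⟨y, hy, hyr⟩
    have h2 : s y ≤ s x := hmax (Set.mem_univ y)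
    rw [hy, hg.self_of_nhds] at h2
    change g _ ≤ g _ at h2
    rw [hm, hm, hyr] at h2
    linarith
  have h2 : ∀ᶠ r in nhds (0 : ℝ), m * (m * r) ≤ 0 := by
    have hc : Continuous fun r : ℝ => m * r := by fun_prop
    exact (hc.tendsto' 0 0 (by simp)).eventually h1
  obtain ⟨r, hr, hr0⟩ := ((h2.filter_mono nhdsWithin_le_nhds).and
    (self_mem_nhdsWithin (s := Set.Ioi (0 : ℝ)))).exists
  have : 0 < m * (m * r) := by
    rw [← mul_assoc]
    exact mul_pos (mul_self_pos.2 hm0) hr0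
  linarith

end Spheres

end LagrangianProduct

theorem proposition2
    {M₁ : Type*} [TopologicalSpace M₁] [T2Space M₁] [ChartedSpace Plane M₁]
    [IsManifold 𝓘(ℝ, Plane) ∞ M₁]
    {M₂ : Type*} [TopologicalSpace M₂] [T2Space M₂] [ChartedSpace Plane M₂]
    [IsManifold 𝓘(ℝ, Plane) ∞ M₂]
    (X₁ : OrientedRiemannianSurface M₁) (X₂ : OrientedRiemannianSurface M₂)
    (c₁ c₂ : ℝ)
    (h₁ : HasConstantCurvature 𝓘(ℝ, Plane) X₁.metric.inner c₁)
    (h₂ : HasConstantCurvature 𝓘(ℝ, Plane) X₂.metric.inner c₂)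
    (hc : c₁ ≠ c₂)
    {S : Type*} [TopologicalSpace S] [T2Space S] [ConnectedSpace S] [ChartedSpace Plane S]
    [IsManifold 𝓘(ℝ, Plane) ∞ S]
    (Φ : S → M₁ × M₂) (hΦ : IsLagrangianImmersion X₁ X₂ Φ) :
    (IsMinimal (𝓘(ℝ, Plane).prod 𝓘(ℝ, Plane)) (prodMetric X₁ X₂) Φ ∨
        HasParallelMeanCurvature (𝓘(ℝ, Plane).prod 𝓘(ℝ, Plane)) (prodMetric X₁ X₂) Φ →
      IsProductOfConstantCurvatureCurves X₁ X₂ Φ) ∧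
    (Nonempty (S ≃ₜ Metric.sphere (0 : EuclideanSpace ℝ (Fin 3)) 1) →
      ¬ IsMinimal (𝓘(ℝ, Plane).prod 𝓘(ℝ, Plane)) (prodMetric X₁ X₂) Φ) := by
  have hpart : IsMinimal (𝓘(ℝ, Plane).prod 𝓘(ℝ, Plane)) (prodMetric X₁ X₂) Φ ∨
      HasParallelMeanCurvature (𝓘(ℝ, Plane).prod 𝓘(ℝ, Plane)) (prodMetric X₁ X₂) Φ →
      IsProductOfConstantCurvatureCurves X₁ X₂ Φ := by
    intro h
    have hpar := h.elim (IsMinimal.hasParallelMeanCurvature hΦ.smooth.continuous) id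
    exact isProductOfConstantCurvatureCurves_of_locally
      (exists_isLocalProduct h₁ h₂ hc hΦ hpar)
  exact ⟨hpart, fun ⟨φ⟩ hmin =>
    (hpart (Or.inl hmin)).not_homeomorph_sphere φ⟩
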